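/- Let $P$ be a simple polygon in the plane (a closed region with boundary $\partial P$) and let $k\ge 0$ be an integer. Call two points $p,q$ $m$-visible if the segment $pq$ meets $\partial P$ in at most $m$ points other than $p$ and $q$; the $m$-visibility polygon of $p$ is the set of points of $P$ that are $m$-visible from $p$. The partition lines of the $k$-cell decomposition of $P$ are the boundaries of the $m$-visibility polygons of all vertices of $P$, for all even $m$ with $0\le m\le k$; its cells are the connected components of $P$ minus the partition lines. The shadows of $p$ are the connected components of the set of points of $P$ that are not $k$-visible from $p$. Let a pursuer move continuously, along $\gamma:[a,b]\to C$, within one cell $C$. For $a\le s\le t\le b$, say that a shadow $A$ of $\gamma(s)$ evolves into a shadow $B$ of $\gamma(t)$ if there is a continuous $\sigma:[s,t]\to P$ with $\sigma(s)\in A$, $\sigma(t)\in B$ and $\sigma(\tau)$ not $k$-visible from $\gamma(\tau)$ for every $\tau\in[s,t]$. Then the decomposition is complete, that is, for all $a\le s\le t\le b$ none of the following four events happens between the times $s$ and $t$: appear (some shadow of $\gamma(t)$ evolves from no shadow of $\gamma(s)$), disappear (some shadow of $\gamma(s)$ evolves into no shadow of $\gamma(t)$), merge (two different shadows of $\gamma(s)$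 evolve into the same shadow of $\gamma(t)$), split (some shadow of $\gamma(s)$ evolves into two different shadows of $\gamma(t)$). -/

import Mathlib

open Set

/-- The Euclidean plane. -/
abbrev Plane : Type := EuclideanSpace ℝ (Fin 2)

namespace KModem

variable {n : ℕ}

/-- A simple polygon: at least three vertices, pairwise distinct, and two different edges
have no point in common other than the vertex at which one ends and the other begins. -/
structure IsSimple (poly : Polygon Plane n) : Prop where
  three_le : 3 ≤ n
  vertices_injective : Function.Injective poly.vertices
  edges_inter : ∀ i j : Fin n, i ≠ j → ∀ x ∈ poly.edgeSet ℝ i ∩ poly.edgeSet ℝ j,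
    (j = finRotate n i ∧ x = poly j) ∨ (i = finRotate n j ∧ x = poly i)

/-- The points enclosed by the polygon, by the even-odd rule: the points off the boundary from
which every ray that passes through no vertex crosses the boundary an odd number of times. -/
def inside (poly : Polygon Plane n) : Set Plane :=
  {x | x ∉ poly.boundary ℝ ∧ ∀ d : Plane, d ≠ 0 →
    (∀ (i : Fin n) (t : ℝ), 0 ≤ t → x + t • d ≠ poly i) →
    Odd {t : ℝ | 0 ≤ t ∧ x + t • d ∈ poly.boundary ℝ}.ncard}

/-- The polygon as a closed region: its boundary together with the points it encloses. -/
def region (poly : Polygon Plane n) : Set Plane :=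
  poly.boundary ℝ ∪ inside poly

/-- `p` and `q` are `m`-visible: strictly between `p` and `q`, the segment `pq` meets the
boundary of the polygon in at most `m` points. -/
def Visible (poly : Polygon Plane n) (m : ℕ) (p q : Plane) : Prop :=
  ((segment ℝ p q \ {p, q}) ∩ poly.boundary ℝ).encard ≤ m

/-- The `m`-visibility polygon of `p`. -/
def visibilityPolygon (poly : Polygon Plane n) (m : ℕ) (p : Plane) : Set Plane :=
  {q ∈ region poly | Visible poly m p q}

/-- The partition lines of the `k`-cell decomposition: the boundaries of the `m`-visibility
polygons of all vertices, for all even `m ≤ k`. -/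
def partitionLines (poly : Polygon Plane n) (k : ℕ) : Set Plane :=
  {x | ∃ (i : Fin n) (m : ℕ), Even m ∧ m ≤ k ∧ x ∈ frontier (visibilityPolygon poly m (poly i))}

/-- The cells of the `k`-cell decomposition: the connected components of what remains of the
polygon when the partition lines are removed. -/
def IsCell (poly : Polygon Plane n) (k : ℕ) (C : Set Plane) : Prop :=
  ∃ x ∈ region poly \ partitionLines poly k,
    C = connectedComponentIn (region poly \ partitionLines poly k) x

/-- The points of the polygon that a pursuer at `p` with a `k`-modem does not see. -/
def unseen (poly : Polygon Plane n) (k : ℕ) (p : Plane) : Set Plane :=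
  {q ∈ region poly | ¬ Visible poly k p q}

/-- The shadows of `p`: the maximal connected sets of points of the polygon invisible to `p`. -/
def IsShadow (poly : Polygon Plane n) (k : ℕ) (p : Plane) (S : Set Plane) : Prop :=
  ∃ x ∈ unseen poly k p, S = connectedComponentIn (unseen poly k p) x

/-- While the pursuer moves along `γ` during the time interval `[s, t]`, the set `A` of unseen
points at time `s` evolves into the set `B` of unseen points at time `t`: some point can move
continuously from `A` to `B` and remain unseen all the time. -/
def EvolvesInto (poly : Polygon Plane n) (k : ℕ) (γ : ℝ → Plane) (s t : ℝ)
    (A B : Set Plane) : Prop :=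
  ∃ σ : ℝ → Plane, ContinuousOn σ (Icc s t) ∧ (∀ τ ∈ Icc s t, σ τ ∈ unseen poly k (γ τ)) ∧
    σ s ∈ A ∧ σ t ∈ B

/-- Between the times `s` and `t` a shadow appears: some shadow at time `t` has not evolved from
any shadow at time `s`. -/
def AppearEvent (poly : Polygon Plane n) (k : ℕ) (γ : ℝ → Plane) (s t : ℝ) : Prop :=
  ∃ B, IsShadow poly k (γ t) B ∧
    ∀ A, IsShadow poly k (γ s) A → ¬ EvolvesInto poly k γ s t A B

/-- Between the times `s` and `t` a shadow disappears: some shadow at time `s` evolves into no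
shadow at time `t`. -/
def DisappearEvent (poly : Polygon Plane n) (k : ℕ) (γ : ℝ → Plane) (s t : ℝ) : Prop :=
  ∃ A, IsShadow poly k (γ s) A ∧
    ∀ B, IsShadow poly k (γ t) B → ¬ EvolvesInto poly k γ s t A B

/-- Between the times `s` and `t` shadows merge: two different shadows at time `s` evolve into
the same shadow at time `t`. -/
def MergeEvent (poly : Polygon Plane n) (k : ℕ) (γ : ℝ → Plane) (s t : ℝ) : Prop :=
  ∃ A₁ A₂ B, IsShadow poly k (γ s) A₁ ∧ IsShadow poly k (γ s) A₂ ∧ A₁ ≠ A₂ ∧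
    IsShadow poly k (γ t) B ∧ EvolvesInto poly k γ s t A₁ B ∧ EvolvesInto poly k γ s t A₂ B

/-- Between the times `s` and `t` a shadow splits: some shadow at time `s` evolves into two
different shadows at time `t`. -/
def SplitEvent (poly : Polygon Plane n) (k : ℕ) (γ : ℝ → Plane) (s t : ℝ) : Prop :=
  ∃ A B₁ B₂, IsShadow poly k (γ s) A ∧ IsShadow poly k (γ t) B₁ ∧ IsShadow poly k (γ t) B₂ ∧
    B₁ ≠ B₂ ∧ EvolvesInto poly k γ s t A B₁ ∧ EvolvesInto poly k γ s t A B₂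

end KModem

open Filter Topology

/-! Shadows change their pattern only where the view from the pursuer changes its type, and inside a
cell it does not. The proof separates a topological from a geometric half.

Topology. Call the unseen sets `U τ` tame if, near every time `τ₀` and point `z`, small
neighborhoods of `z` either miss all nearby `U τ` or meet each of them in one connected piece,
around an interior point common to all of them. Cover the compact polygon by finitely many such
neighborhoods. Their overlaps inside `U τ` determine which points lie in a common component, and
these overlaps are stable in time. Hence two moving unseen points share a component always or never
(`connIn_iff_of_continuousOn`), which excludes merging and splitting. Moreover every component
contains interior points, and these can be carried forward and, with time reversed, backward
(`exists_continuation_of_mem`, `exists_continuation_back`), which excludes disappearing and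
appearing. `KModem.no_events_of_tame` collects this.

Geometry. Let `p` be a point of the polygon off the partition lines and `K` the largest even number
with `K ≤ k`. The boundary consists of partition lines, so `p` is enclosed, and by the even-odd rule
an enclosed point is separated from `p` by an even number of transversal crossings; this is why even
`m` suffice. Suppose that a line of sight with at most `K` transversal crossings runs along an edge
or reaches a vertex behind a tangency. Then, for some even `m ≤ K`, a vertex `m`-sees points
arbitrarily close to `p`, but not all points close to `p`, and `p` is on a partition line
(`mem_partitionLines_of_edgeSplit`, `mem_partitionLines_of_tang`). So by `crossings_cases` every
line of sight from `p` has more than `K` transversal crossings, or at most `K` of them and at most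
one tangency.

In the first case all enclosed points near `z` are unseen from all points near `p`. In the second
case, counting the crossings of nearby segments shows that the unseen set near `z` is empty or
agrees with a convex set (a wedge or a half-plane, with or without its edges) that moves with `p`.
Both situations are tame, which gives `tameNear_unseen`. -/

/-- A family `U` of subsets of a space, indexed by time, is tame near a point `z` at time `τ₀` if
arbitrarily small neighborhoods of `z` either miss `U τ` for all times `τ` near `τ₀`, or meet all of
these sets in one connected piece around a common interior point. -/
def TameAt {X : Type*} [TopologicalSpace X] (U : ℝ → Set X) (I : Set ℝ) (τ₀ : ℝ) (z : X) : Prop :=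
  ∀ G : Set X, IsOpen G → z ∈ G → ∃ B : Set X, IsOpen B ∧ z ∈ B ∧ B ⊆ G ∧
    ((∀ᶠ τ in 𝓝[I] τ₀, B ∩ U τ = ∅) ∨
      ∃ q ∈ B, (∀ᶠ τ in 𝓝[I] τ₀, IsPreconnected (B ∩ U τ) ∧
          IsPreconnected (B ∩ interior (U τ)) ∧ q ∈ interior (U τ)) ∧
        (z ∈ interior (U τ₀) → ∀ᶠ τ in 𝓝[I] τ₀, B ⊆ U τ))

/-! ### Connectedness inside a set -/

/-- Two points lie in a common preconnected subset of `A`. -/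
def ConnIn {X : Type*} [TopologicalSpace X] (A : Set X) (x y : X) : Prop :=
  ∃ S ⊆ A, IsPreconnected S ∧ x ∈ S ∧ y ∈ S

namespace ConnIn

variable {X : Type*} [TopologicalSpace X] {A : Set X} {x y z : X}

lemma symm (h : ConnIn A x y) : ConnIn A y x := by
  obtain ⟨S, h1, h2, h3, h4⟩ := h
  exact ⟨S, h1, h2, h4, h3⟩

lemma trans (h : ConnIn A x y) (h' : ConnIn A y z) : ConnIn A x z := by
  obtain ⟨S, h1, h2, h3, h4⟩ := h
  obtain ⟨T, k1, k2, k3, k4⟩ := h'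
  exact ⟨S ∪ T, union_subset h1 k1, IsPreconnected.union y h4 k3 h2 k2, Or.inl h3, Or.inr k4⟩

lemma mem_component (h : ConnIn A x y) : y ∈ connectedComponentIn A x := by
  obtain ⟨S, h1, h2, h3, h4⟩ := h
  exact h2.subset_connectedComponentIn h3 h1 h4

lemma of_mem_component (hy : y ∈ connectedComponentIn A x) : ConnIn A x y := by
  have hx : x ∈ A := by
    by_contra hx
    rw [connectedComponentIn_eq_empty hx] at hy
    exact hy
  exact ⟨_, connectedComponentIn_subset A x, isPreconnected_connectedComponentIn,
    mem_connectedComponentIn hx, hy⟩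

end ConnIn

/-- Otherwise the union of the `D i` with `P i` and the union of those without would separate `S`,
since `hstep` keeps them disjoint on `S`. This replaces explicit chains of overlapping sets. -/
lemma IsPreconnected.forall_of_cover {X ι : Type*} [TopologicalSpace X] {S : Set X}
    (hS : IsPreconnected S) {F : Set ι} {D : ι → Set X} {P : ι → Prop}
    (hD : ∀ i ∈ F, IsOpen (D i)) (hcov : ∀ x ∈ S, ∃ i ∈ F, x ∈ D i)
    (hstep : ∀ i ∈ F, ∀ j ∈ F, (S ∩ D i ∩ D j).Nonempty → P i → P j)
    {i : ι} (hi : i ∈ F) {x : X} (hx : x ∈ S ∩ D i) (hPi : P i)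
    {j : ι} (hj : j ∈ F) {y : X} (hy : y ∈ S ∩ D j) : P j := by
  by_contra hPj
  obtain ⟨w, hwS, hw1, hw2⟩ := hS (⋃ k ∈ {k ∈ F | P k}, D k) (⋃ k ∈ {k ∈ F | ¬ P k}, D k)
    (isOpen_biUnion fun k hk => hD k hk.1) (isOpen_biUnion fun k hk => hD k hk.1)
    (fun w hw => by
      obtain ⟨k, hk, hwk⟩ := hcov w hw
      by_cases hPk : P k
      · exact Or.inl (mem_biUnion (show k ∈ {k ∈ F | P k} from ⟨hk, hPk⟩) hwk)
      · exact Or.inr (mem_biUnion (show k ∈ {k ∈ F | ¬ P k} from ⟨hk, hPk⟩) hwk))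
    ⟨x, hx.1, mem_biUnion (show i ∈ {k ∈ F | P k} from ⟨hi, hPi⟩) hx.2⟩
    ⟨y, hy.1, mem_biUnion (show j ∈ {k ∈ F | ¬ P k} from ⟨hj, hPj⟩) hy.2⟩
  simp only [mem_iUnion, mem_ofPred_eq, exists_prop] at hw1 hw2
  obtain ⟨k, ⟨hk, hPk⟩, hwk⟩ := hw1
  obtain ⟨l, ⟨hl, hPl⟩, hwl⟩ := hw2
  exact hPl (hstep k hk l hl ⟨w, ⟨hwS, hwk⟩, hwl⟩ hPk)

/-! ### Components of a tame family do not change -/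

section Tame

variable {X : Type*} [MetricSpace X] {U : ℝ → Set X} {I : Set ℝ} {K : Set X} {τ₀ : ℝ}

/-- At a point of `U τ₀` the first alternative of tameness fails at the time `τ₀` itself. -/
lemma TameAt.exists_mem {z : X} (h : TameAt U I τ₀ z) (hτ : τ₀ ∈ I) (hz : z ∈ U τ₀) {G : Set X}
    (hG : IsOpen G) (hzG : z ∈ G) : ∃ B : Set X, IsOpen B ∧ z ∈ B ∧ B ⊆ G ∧
      ∃ q ∈ B, (∀ᶠ τ in 𝓝[I] τ₀, IsPreconnected (B ∩ U τ) ∧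
          IsPreconnected (B ∩ interior (U τ)) ∧ q ∈ interior (U τ)) ∧
        (z ∈ interior (U τ₀) → ∀ᶠ τ in 𝓝[I] τ₀, B ⊆ U τ) := by
  obtain ⟨B, hB, hzB, hBG, h | h⟩ := h G hG hzG
  · have := h.self_of_nhdsWithin hτ
    have : z ∈ B ∩ U τ₀ := ⟨hzB, hz⟩
    simp_all
  · exact ⟨B, hB, hzB, hBG, h⟩

/-- Upper semicontinuity: a neighborhood of the second kind inside `G` would contain its common
point `q ∈ U τ₀`, so near each point of `Q` only the first alternative is possible, and compactness
finishes. -/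
lemma eventually_inter_eq_empty (hτ : τ₀ ∈ I) (hU : ∀ z ∈ K, TameAt U I τ₀ z) {Q G : Set X}
    (hQ : IsCompact Q) (hQK : Q ⊆ K) (hG : IsOpen G) (hQG : Q ⊆ G) (hGU : G ∩ U τ₀ = ∅) :
    ∀ᶠ τ in 𝓝[I] τ₀, Q ∩ U τ = ∅ := by
  refine hQ.induction_on (p := fun s => ∀ᶠ τ in 𝓝[I] τ₀, s ∩ U τ = ∅) (by simp) ?_ ?_ ?_
  · exact fun s t hst h => h.mono fun τ h => subset_empty_iff.1
      ((inter_subset_inter_left _ hst).trans h.subset)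
  · intro s t hs ht
    filter_upwards [hs, ht] with τ h1 h2
    rw [union_inter_distrib_right, h1, h2, union_empty]
  · intro x hx
    obtain ⟨B, hB, hzB, hBG, h | ⟨q, hq, h, -⟩⟩ := hU x (hQK hx) G hG (hQG hx)
    · exact ⟨B, mem_nhdsWithin_of_mem_nhds (hB.mem_nhds hzB), h⟩
    · have := interior_subset (h.self_of_nhdsWithin hτ).2.2
      have : q ∈ G ∩ U τ₀ := ⟨hBG hq, this⟩
      simp_all

/-- Two nested families are needed: the `D z` cover `K`, while the larger `B z` carry the
connectedness. The closure of `D z` inside `B z` leaves room for the semicontinuity of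
`eventually_inter_eq_empty`. -/
lemma exists_tame_cover (hK : IsCompact K) (hU : ∀ z ∈ K, TameAt U I τ₀ z) :
    ∃ (F : Finset X) (D B : X → Set X) (q : X → X), (∀ x ∈ K, ∃ z ∈ F, x ∈ D z) ∧
      ∀ z ∈ F, IsOpen (D z) ∧ closure (D z) ⊆ B z ∧ IsOpen (B z) ∧
        ((∀ᶠ τ in 𝓝[I] τ₀, B z ∩ U τ = ∅) ∨
          (q z ∈ B z ∧ ∀ᶠ τ in 𝓝[I] τ₀, IsPreconnected (B z ∩ U τ) ∧
          IsPreconnected (B z ∩ interior (U τ)) ∧ q z ∈ interior (U τ))) := by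
  have key : ∀ z : X, ∃ (D B : Set X) (q : X), z ∈ K → z ∈ D ∧ IsOpen D ∧ closure D ⊆ B ∧ IsOpen B ∧
        ((∀ᶠ τ in 𝓝[I] τ₀, B ∩ U τ = ∅) ∨
          (q ∈ B ∧ ∀ᶠ τ in 𝓝[I] τ₀, IsPreconnected (B ∩ U τ) ∧
          IsPreconnected (B ∩ interior (U τ)) ∧ q ∈ interior (U τ))) := by
    intro z
    by_cases hz : z ∈ K
    · obtain ⟨B, hB, hzB, -, h⟩ := hU z hz univ isOpen_univ trivial
      obtain ⟨r, hr, hrB⟩ := Metric.nhds_basis_closedBall.mem_iff.1 (hB.mem_nhds hzB)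
      have hc : closure (Metric.ball z r) ⊆ B :=
        Metric.closure_ball_subset_closedBall.trans hrB
      rcases h with h | ⟨q, hq, h, -⟩
      · exact ⟨Metric.ball z r, B, z, fun _ => ⟨Metric.mem_ball_self hr, Metric.isOpen_ball, hc, hB,
          Or.inl h⟩⟩
      · exact ⟨Metric.ball z r, B, q, fun _ => ⟨Metric.mem_ball_self hr, Metric.isOpen_ball, hc, hB,
          Or.inr ⟨hq, h⟩⟩⟩
    · exact ⟨∅, ∅, z, fun h => absurd h hz⟩
  choose D B q h using key
  obtain ⟨F, hF, hcov⟩ := hK.elim_nhds_subcover D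
    fun x hx => (h x hx).2.1.mem_nhds (h x hx).1
  refine ⟨F, D, B, q, fun x hx => ?_, fun z hz => (h z (hF z hz)).2⟩
  simpa using hcov hx

/-- Whether two points that stay in the family lie in the same component does not change. -/
lemma eventually_connIn_iff (hK : IsCompact K) (hτ : τ₀ ∈ I) (hU : ∀ z ∈ K, TameAt U I τ₀ z)
    (hUK : ∀ τ ∈ I, U τ ⊆ K) {x y : X} (hx : ∀ᶠ τ in 𝓝[I] τ₀, x ∈ U τ)
    (hy : ∀ᶠ τ in 𝓝[I] τ₀, y ∈ U τ) :
    ∀ᶠ τ in 𝓝[I] τ₀, (ConnIn (U τ) x y ↔ ConnIn (U τ₀) x y) := by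
  obtain ⟨F, D, B, q, hcov, hF⟩ := exists_tame_cover hK hU
  have hx0 := hx.self_of_nhdsWithin hτ
  have hy0 := hy.self_of_nhdsWithin hτ
  have hDB : ∀ z ∈ F, D z ⊆ B z := fun z hz => subset_closure.trans (hF z hz).2.1
  have hD : ∀ z ∈ F, (B z ∩ U τ₀).Nonempty → q z ∈ B z ∧ ∀ᶠ τ in 𝓝[I] τ₀,
      IsPreconnected (B z ∩ U τ) ∧ q z ∈ U τ := by
    intro z hz hne
    rcases (hF z hz).2.2.2 with h | h
    · rw [h.self_of_nhdsWithin hτ] at hne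
      simp at hne
    · exact ⟨h.1, h.2.mono fun τ h => ⟨h.1, interior_subset h.2.2⟩⟩
  -- Overlaps cannot appear: the closures of `D i` and `D j` meet `K` in a compact subset of `B i ∩
  -- B j`, which is disjoint from `U τ₀`.
  have hadj : ∀ i ∈ F, ∀ j ∈ F, B i ∩ B j ∩ U τ₀ = ∅ → ∀ᶠ τ in 𝓝[I] τ₀, D i ∩ D j ∩ U τ = ∅ := by
    intro i hi j hj h
    have := eventually_inter_eq_empty hτ hU (Q := closure (D i) ∩ closure (D j) ∩ K)
      (hK.inter_left (isClosed_closure.inter isClosed_closure)) inter_subset_right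
      ((hF i hi).2.2.1.inter (hF j hj).2.2.1)
      (inter_subset_left.trans (inter_subset_inter (hF i hi).2.1 (hF j hj).2.1)) h
    filter_upwards [this, self_mem_nhdsWithin] with τ h hτ
    rw [← subset_empty_iff, ← h]
    exact fun x hx => ⟨⟨⟨subset_closure hx.1.1, subset_closure hx.1.2⟩, hUK τ hτ hx.2⟩, hx.2⟩
  have hstep : ∀ j ∈ F, ∀ w ∈ B j, (∀ᶠ τ in 𝓝[I] τ₀, w ∈ U τ) →
      ∀ᶠ τ in 𝓝[I] τ₀, ConnIn (U τ) w (q j) := by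
    intro j hj w hw hwU
    obtain ⟨h1, h2⟩ := hD j hj ⟨w, hw, hwU.self_of_nhdsWithin hτ⟩
    filter_upwards [h2, hwU] with τ h2 h3
    exact ⟨B j ∩ U τ, inter_subset_right, h2.1, ⟨hw, h3⟩, h1, h2.2⟩
  -- Overlaps cannot get lost: a tame neighborhood inside `B i ∩ B j` has a point `p` that belongs
  -- to all nearby `U τ` and links `q i` to `q j`.
  have hlink : ∀ i ∈ F, ∀ j ∈ F, (B i ∩ B j ∩ U τ₀).Nonempty →
      ∀ᶠ τ in 𝓝[I] τ₀, ConnIn (U τ) (q i) (q j) := by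
    rintro i hi j hj ⟨w, ⟨hwi, hwj⟩, hw⟩
    obtain ⟨B', -, -, hB', p, hp, h, -⟩ := (hU w (hUK _ hτ hw)).exists_mem hτ hw
      ((hF i hi).2.2.1.inter (hF j hj).2.2.1) ⟨hwi, hwj⟩
    have hp' : ∀ᶠ τ in 𝓝[I] τ₀, p ∈ U τ := h.mono fun τ h => interior_subset h.2.2
    filter_upwards [hstep i hi p (hB' hp).1 hp', hstep j hj p (hB' hp).2 hp'] with τ h1 h2
    exact h1.symm.trans h2
  obtain ⟨i, hiF, hi⟩ := hcov x (hUK _ hτ hx0)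
  obtain ⟨j, hjF, hj⟩ := hcov y (hUK _ hτ hy0)
  have hxi := hstep i hiF x (hDB i hiF hi) hx
  have hyj := hstep j hjF y (hDB j hjF hj) hy
  by_cases hxy : ConnIn (U τ₀) x y
  · simp only [hxy, iff_true]
    obtain ⟨S, hS, hSc, hxS, hyS⟩ := hxy
    have := hSc.forall_of_cover (F := (F : Set X)) (D := D)
      (P := fun j => ∀ᶠ τ in 𝓝[I] τ₀, ConnIn (U τ) x (q j)) (fun j hj => (hF j hj).1)
      (fun w hw => by simpa using hcov w (hUK _ hτ (hS hw))) ?_ hiF ⟨hxS, hi⟩ hxi hjF ⟨hyS, hj⟩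
    · filter_upwards [this, hyj] with τ h1 h2
      exact h1.trans h2.symm
    · rintro i hi j hj ⟨w, ⟨hwS, hwi⟩, hwj⟩ h
      filter_upwards [h, hlink i hi j hj ⟨w, ⟨hDB i hi hwi, hDB j hj hwj⟩, hS hwS⟩] with τ h1 h2
      exact h1.trans h2
  · have hall : ∀ᶠ τ in 𝓝[I] τ₀, ∀ i ∈ F, ∀ j ∈ F, B i ∩ B j ∩ U τ₀ = ∅ → D i ∩ D j ∩ U τ = ∅ := by
      rw [Filter.eventually_all_finset]
      intro i hi
      rw [Filter.eventually_all_finset]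
      intro j hj
      rw [Filter.eventually_imp_distrib_left]
      exact hadj i hi j hj
    filter_upwards [hall, self_mem_nhdsWithin] with τ hall hτI
    simp only [hxy, iff_false]
    rintro ⟨S, hS, hSc, hxS, hyS⟩
    -- A connection at time `τ` runs through overlapping `D`'s; by `hall` the corresponding `B`'s
    -- overlap inside `U τ₀`, so the connection exists at time `τ₀` as well.
    have := hSc.forall_of_cover (F := (F : Set X)) (D := D)
      (P := fun j => ConnIn (U τ₀) x (q j)) (fun j hj => (hF j hj).1)
      (fun w hw => by simpa using hcov w (hUK _ hτI (hS hw))) ?_ hiF ⟨hxS, hi⟩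
      (hxi.self_of_nhdsWithin hτ) hjF ⟨hyS, hj⟩
    · exact hxy (this.trans (hyj.self_of_nhdsWithin hτ).symm)
    · rintro i hi j hj ⟨w, ⟨hwS, hwi⟩, hwj⟩ h
      refine h.trans ((hlink i hi j hj ?_).self_of_nhdsWithin hτ)
      by_contra hne
      have := hall i hi j hj (not_nonempty_iff_eq_empty.1 hne)
      have hmem : w ∈ D i ∩ D j ∩ U τ := ⟨⟨hwi, hwj⟩, hS hwS⟩
      simp [this] at hmem

/-- Whether two moving points of the family lie in the same component does not change. -/
lemma connIn_iff_of_continuousOn (hK : IsCompact K) (hI : IsPreconnected I)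
    (hU : ∀ τ ∈ I, ∀ z ∈ K, TameAt U I τ z) (hUK : ∀ τ ∈ I, U τ ⊆ K) {f g : ℝ → X}
    (hf : ContinuousOn f I) (hg : ContinuousOn g I) (hfU : ∀ τ ∈ I, f τ ∈ U τ)
    (hgU : ∀ τ ∈ I, g τ ∈ U τ) {s t : ℝ} (hs : s ∈ I) (ht : t ∈ I) :
    ConnIn (U s) (f s) (g s) ↔ ConnIn (U t) (f t) (g t) := by
  -- For a short time a moving point can be replaced by a fixed one, the common interior point of a
  -- tame neighborhood.
  have hloc : ∀ τ₀ ∈ I, ∀ f : ℝ → X, ContinuousOn f I → (∀ τ ∈ I, f τ ∈ U τ) →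
      ∃ p, (∀ᶠ τ in 𝓝[I] τ₀, p ∈ U τ) ∧ ∀ᶠ τ in 𝓝[I] τ₀, ConnIn (U τ) (f τ) p := by
    intro τ₀ hτ₀ f hf hfU
    obtain ⟨B, hB, hfB, -, p, hp, h, -⟩ := (hU τ₀ hτ₀ _ (hUK _ hτ₀ (hfU _ hτ₀))).exists_mem hτ₀
      (hfU _ hτ₀) isOpen_univ trivial
    refine ⟨p, h.mono fun τ h => interior_subset h.2.2, ?_⟩
    filter_upwards [h, (hf τ₀ hτ₀) (hB.mem_nhds hfB), self_mem_nhdsWithin] with τ h hτ hI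
    exact ⟨B ∩ U τ, inter_subset_right, h.1, ⟨hτ, hfU τ hI⟩, hp, interior_subset h.2.2⟩
  have hconst : ∀ τ₀ ∈ I, ∀ᶠ τ in 𝓝[I] τ₀,
      (ConnIn (U τ) (f τ) (g τ) ↔ ConnIn (U τ₀) (f τ₀) (g τ₀)) := by
    intro τ₀ hτ₀
    obtain ⟨p, hp, hfp⟩ := hloc τ₀ hτ₀ f hf hfU
    obtain ⟨r, hr, hgr⟩ := hloc τ₀ hτ₀ g hg hgU
    have key := eventually_connIn_iff hK hτ₀ (hU τ₀ hτ₀) hUK hp hr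
    have hfp0 := hfp.self_of_nhdsWithin hτ₀
    have hgr0 := hgr.self_of_nhdsWithin hτ₀
    filter_upwards [key, hfp, hgr] with τ h1 h2 h3
    exact ⟨fun h => (hfp0.trans (h1.1 ((h2.symm.trans h).trans h3))).trans hgr0.symm,
      fun h => (h2.trans (h1.2 ((hfp0.symm.trans h).trans hgr0))).trans h3.symm⟩
  classical
  -- A locally constant truth value on a preconnected set of times is constant.
  have := hI.constant (Y := Bool) (f := fun τ => decide (ConnIn (U τ) (f τ) (g τ))) ?_ hs ht
  · simpa using this
  · intro τ₀ hτ₀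
    refine ContinuousWithinAt.congr_of_eventuallyEq (f := fun _ => decide (ConnIn (U τ₀) (f τ₀) (g τ₀)))
      continuousWithinAt_const ?_ rfl
    filter_upwards [hconst τ₀ hτ₀] with τ h
    simpa using h

end Tame

/-! ### Continuation of points of a tame family -/

section Tame

variable {X : Type*} [MetricSpace X] {U : ℝ → Set X} {I : Set ℝ} {K : Set X} {τ₀ : ℝ}

/-- Lower semicontinuity of the interiors, uniformly on compact sets; the last clause of `TameAt`
exists for this purpose. -/
lemma eventually_subset_interior (hτ : τ₀ ∈ I) (hU : ∀ z ∈ U τ₀, TameAt U I τ₀ z) {Γ : Set X}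
    (hΓ : IsCompact Γ) (hΓU : Γ ⊆ interior (U τ₀)) : ∀ᶠ τ in 𝓝[I] τ₀, Γ ⊆ interior (U τ) := by
  refine hΓ.induction_on (p := fun s => ∀ᶠ τ in 𝓝[I] τ₀, s ⊆ interior (U τ)) (by simp) ?_ ?_ ?_
  · exact fun s t hst h => h.mono fun τ h => hst.trans h
  · intro s t hs ht
    filter_upwards [hs, ht] with τ h1 h2 using union_subset h1 h2
  · intro x hx
    have hxU := interior_subset (hΓU hx)
    obtain ⟨B, hB, hxB, -, q, -, -, h⟩ := (hU x hxU).exists_mem hτ hxU isOpen_univ trivial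
    exact ⟨B, mem_nhdsWithin_of_mem_nhds (hB.mem_nhds hxB),
      (h (hΓU hx)).mono fun τ h => hB.subset_interior_iff.2 h⟩

/-- A point of the interior can move for a short time, staying in the interior. -/
lemma eventually_exists_extension [LocallyPathConnectedSpace X] (hK : IsCompact K) {s t : ℝ}
    (hU : ∀ τ ∈ Icc s t, ∀ z ∈ K, TameAt U (Icc s t) τ z) (hUK : ∀ τ ∈ Icc s t, U τ ⊆ K)
    (hτ : τ₀ ∈ Icc s t) :
    ∃ ε > 0, ∀ t₁ ∈ Icc s t, ∀ t₂ ∈ Icc s t, |t₁ - τ₀| < ε → |t₂ - τ₀| < ε → t₁ < t₂ →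
      ∀ x ∈ interior (U t₁), ∃ f : ℝ → X, Continuous f ∧ f t₁ = x ∧
        ∀ u ∈ Icc t₁ t₂, f u ∈ interior (U u) := by
  obtain ⟨F, D, B, q, hcov, hF⟩ := exists_tame_cover hK (hU τ₀ hτ)
  have hall : ∀ᶠ τ in 𝓝[Icc s t] τ₀, ∀ z ∈ F,
      ((∀ᶠ τ in 𝓝[Icc s t] τ₀, B z ∩ U τ = ∅) → B z ∩ U τ = ∅) ∧
      (¬ (∀ᶠ τ in 𝓝[Icc s t] τ₀, B z ∩ U τ = ∅) →
        q z ∈ B z ∧ IsPreconnected (B z ∩ interior (U τ)) ∧ q z ∈ interior (U τ)) := by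
    rw [Filter.eventually_all_finset]
    intro z hz
    by_cases h : ∀ᶠ τ in 𝓝[Icc s t] τ₀, B z ∩ U τ = ∅
    · exact h.mono fun τ h' => ⟨fun _ => h', fun h'' => absurd h h''⟩
    · obtain ⟨h1, h2⟩ := (hF z hz).2.2.2.resolve_left h
      exact h2.mono fun τ h' => ⟨fun h'' => absurd h'' h, fun _ => ⟨h1, h'.2⟩⟩
  -- The cover is fixed at time `τ₀`, so one `ε` serves all starting times near `τ₀` and all
  -- starting points.
  obtain ⟨ε, hε, hball⟩ := Metric.mem_nhdsWithin_iff.1 hall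
  refine ⟨ε, hε, fun t₁ ht₁ t₂ ht₂ h1 h2 h12 x hx => ?_⟩
  obtain ⟨z, hz, hxz⟩ := hcov x (hUK _ ht₁ (interior_subset hx))
  have hxB : x ∈ B z := (hF z hz).2.1 (subset_closure hxz)
  have hgood : ∀ u ∈ Icc t₁ t₂, q z ∈ B z ∧ IsPreconnected (B z ∩ interior (U u)) ∧
      q z ∈ interior (U u) := by
    intro u hu
    have hmem : ∀ v ∈ Icc t₁ t₂, v ∈ Metric.ball τ₀ ε ∩ Icc s t := by
      refine fun v hv => ⟨?_, ht₁.1.trans hv.1, hv.2.trans ht₂.2⟩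
      rw [Metric.mem_ball, Real.dist_eq, abs_lt]
      rw [abs_lt] at h1 h2
      constructor <;> linarith [hv.1, hv.2]
    refine (hball (hmem u hu) z hz).2 fun h => ?_
    have := (hball (hmem t₁ ⟨le_rfl, h12.le⟩) z hz).1 h
    exact absurd this (Set.Nonempty.ne_empty ⟨x, hxB, interior_subset hx⟩)
  obtain ⟨hqB, hpc, hqU⟩ := hgood t₁ ⟨le_rfl, h12.le⟩
  have hpath : IsPathConnected (B z ∩ interior (U t₁)) := by
    rw [← ((hF z hz).2.2.1.inter isOpen_interior).isConnected_iff_isPathConnected]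
    exact ⟨⟨x, hxB, hx⟩, hpc⟩
  obtain ⟨P, hP⟩ := hpath.joinedIn x ⟨hxB, hx⟩ (q z) ⟨hqB, hqU⟩
  have hΓ := eventually_subset_interior ht₁ (fun z hz => hU t₁ ht₁ z (hUK _ ht₁ hz))
    (isCompact_range P.continuous) (range_subset_iff.2 fun u => (hP u).2)
  obtain ⟨η, hη, hηball⟩ := Metric.mem_nhdsWithin_iff.1 hΓ
  refine ⟨fun u => P.extend ((u - t₁) / (η / 2)), by fun_prop, by simp, fun u hu => ?_⟩
  rcases le_or_gt (u - t₁) (η / 2) with h | h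
  · refine hηball ⟨?_, ht₁.1.trans hu.1, hu.2.trans ht₂.2⟩ ?_
    · rw [Metric.mem_ball, Real.dist_eq, abs_of_nonneg (by linarith [hu.1])]
      linarith
    · rw [← P.extend_range]
      exact mem_range_self _
  · show P.extend ((u - t₁) / (η / 2)) ∈ _
    rw [P.extend_of_one_le]
    · exact (hgood u hu).2.2
    · rw [le_div_iff₀ (by positivity)]
      linarith

/-- Every point of the interior at time `s` can be continued up to time `t`. -/
lemma exists_continuation [LocallyPathConnectedSpace X] (hK : IsCompact K) {s t : ℝ} (hst : s ≤ t)
    (hU : ∀ τ ∈ Icc s t, ∀ z ∈ K, TameAt U (Icc s t) τ z) (hUK : ∀ τ ∈ Icc s t, U τ ⊆ K)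
    {x : X} (hx : x ∈ interior (U s)) : ∃ f : ℝ → X, ContinuousOn f (Icc s t) ∧ f s = x ∧
        ∀ u ∈ Icc s t, f u ∈ interior (U u) := by
  classical
  -- The times up to which `x` can be continued. The uniform `ε` works on both sides of `τ₀`, so `R`
  -- is locally constant and no limit has to be taken at a supremum.
  let R : ℝ → Prop := fun r => ∃ f : ℝ → X, ContinuousOn f (Icc s r) ∧ f s = x ∧
        ∀ u ∈ Icc s r, f u ∈ interior (U u)
  have hmono : ∀ r r', r ≤ r' → R r' → R r := by
    rintro r r' hr ⟨f, hf, hfx, hfU⟩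
    exact ⟨f, hf.mono (Icc_subset_Icc_right hr), hfx, fun u hu => hfU u ⟨hu.1, hu.2.trans hr⟩⟩
  have hs : R s := by
    refine ⟨fun _ => x, continuousOn_const, rfl, fun u hu => ?_⟩
    rw [show u = s from le_antisymm hu.2 hu.1]
    exact hx
  have hext : ∀ τ₀ ∈ Icc s t, ∃ ε > 0, ∀ t₁ ∈ Icc s t, ∀ t₂ ∈ Icc s t, |t₁ - τ₀| < ε →
      |t₂ - τ₀| < ε → R t₁ → R t₂ := by
    intro τ₀ hτ₀
    obtain ⟨ε, hε, h⟩ := eventually_exists_extension hK hU hUK hτ₀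
    refine ⟨ε, hε, fun t₁ ht₁ t₂ ht₂ h1 h2 hR => ?_⟩
    rcases le_or_gt t₂ t₁ with h12 | h12
    · exact hmono _ _ h12 hR
    obtain ⟨f, hf, hfx, hfU⟩ := hR
    obtain ⟨g, hg, hgx, hgU⟩ := h t₁ ht₁ t₂ ht₂ h1 h2 h12 (f t₁) (hfU t₁ ⟨ht₁.1, le_rfl⟩)
    refine ⟨fun u => if u ≤ t₁ then f u else g u, ?_, ?_, ?_⟩
    · rw [← Icc_union_Icc_eq_Icc ht₁.1 h12.le]
      refine ContinuousOn.union_of_isClosed ?_ ?_ isClosed_Icc isClosed_Icc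
      · exact hf.congr fun u hu => if_pos hu.2
      · refine hg.continuousOn.congr fun u hu => ?_
        rcases hu.1.eq_or_lt with rfl | hlt
        · simp [hgx]
        · exact if_neg (not_le.2 hlt)
    · simp [ht₁.1, hfx]
    · intro u hu
      rcases le_or_gt u t₁ with h | h
      · simpa [h] using hfU u ⟨hu.1, h⟩
      · simpa [not_le.2 h] using hgU u ⟨h.le, hu.2⟩
  have := isPreconnected_Icc.constant (Y := Bool) (f := fun r => decide (R r)) (s := Icc s t) ?_
    (left_mem_Icc.2 hst) (right_mem_Icc.2 hst)
  · have h : R s ↔ R t := by simpa using this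
    exact h.1 hs
  · intro τ₀ hτ₀
    obtain ⟨ε, hε, h⟩ := hext τ₀ hτ₀
    refine ContinuousWithinAt.congr_of_eventuallyEq (f := fun _ => decide (R τ₀))
      continuousWithinAt_const ?_ rfl
    filter_upwards [self_mem_nhdsWithin, mem_nhdsWithin_of_mem_nhds (Metric.ball_mem_nhds τ₀ hε)]
      with τ hτ hd
    have h0 : |τ₀ - τ₀| < ε := by simpa using hε
    have hd' : |τ - τ₀| < ε := hd
    simpa using ⟨h τ hτ τ₀ hτ₀ hd' h0, h τ₀ hτ₀ τ hτ h0 hd'⟩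

/-- Every point of the family can, up to its connected component, be continued. -/
lemma exists_continuation_of_mem [LocallyPathConnectedSpace X] (hK : IsCompact K) {s t : ℝ}
    (hst : s ≤ t) (hU : ∀ τ ∈ Icc s t, ∀ z ∈ K, TameAt U (Icc s t) τ z)
    (hUK : ∀ τ ∈ Icc s t, U τ ⊆ K) {x : X} (hx : x ∈ U s) :
    ∃ f : ℝ → X, ContinuousOn f (Icc s t) ∧ ConnIn (U s) x (f s) ∧ ∀ u ∈ Icc s t, f u ∈ U u := by
  have hs : s ∈ Icc s t := left_mem_Icc.2 hst
  obtain ⟨B, hB, hxB, -, q, hq, h, -⟩ := (hU s hs x (hUK s hs hx)).exists_mem hs hx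
    isOpen_univ trivial
  have h := h.self_of_nhdsWithin hs
  obtain ⟨f, hf, hfq, hfU⟩ := exists_continuation hK hst hU hUK h.2.2
  refine ⟨f, hf, ?_, fun u hu => interior_subset (hfU u hu)⟩
  rw [hfq]
  exact ⟨B ∩ U s, inter_subset_right, h.1, ⟨hxB, hx⟩, hq, interior_subset h.2.2⟩

/-- Every point of the family can, up to its connected component, be traced back. -/
lemma exists_continuation_back [LocallyPathConnectedSpace X] (hK : IsCompact K) {s t : ℝ}
    (hst : s ≤ t) (hU : ∀ τ ∈ Icc s t, ∀ z ∈ K, TameAt U (Icc s t) τ z)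
    (hUK : ∀ τ ∈ Icc s t, U τ ⊆ K) {x : X} (hx : x ∈ U t) :
    ∃ f : ℝ → X, ContinuousOn f (Icc s t) ∧ ConnIn (U t) x (f t) ∧ ∀ u ∈ Icc s t, f u ∈ U u := by
  -- Time is reversed by `τ ↦ s + t - τ`, which preserves `Icc s t` and tameness.
  have hmem : ∀ τ, τ ∈ Icc s t ↔ s + t - τ ∈ Icc s t := fun τ =>
    ⟨fun h => ⟨by linarith [h.2], by linarith [h.1]⟩, fun h => ⟨by linarith [h.2], by linarith [h.1]⟩⟩
  have hmaps : MapsTo (fun τ => s + t - τ) (Icc s t) (Icc s t) := fun τ h => (hmem τ).1 h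
  have hU' : ∀ τ ∈ Icc s t, ∀ z ∈ K, TameAt (fun τ => U (s + t - τ)) (Icc s t) τ z := by
    intro τ₀ hτ₀ z hz G hG hzG
    have htend : Tendsto (fun τ => s + t - τ) (𝓝[Icc s t] τ₀) (𝓝[Icc s t] (s + t - τ₀)) :=
      tendsto_nhdsWithin_of_tendsto_nhds_of_eventually_within _
        ((Continuous.tendsto (by fun_prop) τ₀).mono_left nhdsWithin_le_nhds)
        (eventually_of_mem self_mem_nhdsWithin hmaps)
    obtain ⟨B, hB, hzB, hBG, h | ⟨q, hq, h, h'⟩⟩ := hU _ ((hmem _).1 hτ₀) z hz G hG hzG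
    · exact ⟨B, hB, hzB, hBG, Or.inl (htend.eventually h)⟩
    · exact ⟨B, hB, hzB, hBG, Or.inr ⟨q, hq, htend.eventually h, fun hz => htend.eventually (h' hz)⟩⟩
  obtain ⟨f, hf, hfx, hfU⟩ := exists_continuation_of_mem (U := fun τ => U (s + t - τ)) hK hst
    hU' (fun τ hτ => hUK _ ((hmem τ).1 hτ)) (x := x) (by simpa using hx)
  exact ⟨fun τ => f (s + t - τ), hf.comp (by fun_prop) hmaps, by simpa using hfx,
    fun u hu => by simpa using hfU _ ((hmem u).1 hu)⟩

end Tame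

/-! ### Shadow events for tame unseen sets -/

namespace KModem

/-- If the unseen sets are tame, then no shadow event happens. -/
lemma no_events_of_tame {n : ℕ} {poly : Polygon Plane n} {k : ℕ} {γ : ℝ → Plane} {s t : ℝ}
    (hst : s ≤ t) (hK : IsCompact (region poly))
    (hU : ∀ τ ∈ Icc s t, ∀ z ∈ region poly,
      TameAt (fun τ => unseen poly k (γ τ)) (Icc s t) τ z) :
    ¬ AppearEvent poly k γ s t ∧ ¬ DisappearEvent poly k γ s t ∧
      ¬ MergeEvent poly k γ s t ∧ ¬ SplitEvent poly k γ s t := by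
  have hs := left_mem_Icc.2 hst
  have ht := right_mem_Icc.2 hst
  have hUK : ∀ τ ∈ Icc s t, unseen poly k (γ τ) ⊆ region poly := fun τ _ x hx => hx.1
  have hconn := @connIn_iff_of_continuousOn _ _ (fun τ => unseen poly k (γ τ)) _ _ hK
    isPreconnected_Icc hU hUK
  have hsame : ∀ {p : Plane} {S : Set Plane} {x y : Plane}, IsShadow poly k p S → x ∈ S → y ∈ S →
      ConnIn (unseen poly k p) x y := by
    rintro p _ x y ⟨w, hw, rfl⟩ hx hy
    exact (ConnIn.of_mem_component hx).symm.trans (ConnIn.of_mem_component hy)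
  have heq : ∀ {p : Plane} {S T : Set Plane} {x y : Plane}, IsShadow poly k p S →
      IsShadow poly k p T → x ∈ S → y ∈ T → ConnIn (unseen poly k p) x y → S = T := by
    rintro p _ _ x y ⟨v, hv, rfl⟩ ⟨w, hw, rfl⟩ hx hy hxy
    exact connectedComponentIn_eq
      ((ConnIn.of_mem_component hx).trans (hxy.trans (ConnIn.of_mem_component hy).symm)).mem_component
  refine ⟨?_, ?_, ?_, ?_⟩
  · rintro ⟨_, ⟨x, hx, rfl⟩, h⟩
    obtain ⟨f, hf, hfx, hfU⟩ := exists_continuation_back hK hst hU hUK hx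
    exact h _ ⟨f s, hfU s hs, rfl⟩ ⟨f, hf, hfU, mem_connectedComponentIn (hfU s hs),
      hfx.mem_component⟩
  · rintro ⟨_, ⟨x, hx, rfl⟩, h⟩
    obtain ⟨f, hf, hfx, hfU⟩ := exists_continuation_of_mem hK hst hU hUK hx
    exact h _ ⟨f t, hfU t ht, rfl⟩ ⟨f, hf, hfU, hfx.mem_component,
      mem_connectedComponentIn (hfU t ht)⟩
  · rintro ⟨A₁, A₂, B, h1, h2, hne, hB, ⟨f, hf, hfU, hfA, hfB⟩, ⟨g, hg, hgU, hgA, hgB⟩⟩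
    exact hne (heq h1 h2 hfA hgA ((hconn hf hg hfU hgU hs ht).2 (hsame hB hfB hgB)))
  · rintro ⟨A, B₁, B₂, hA, h1, h2, hne, ⟨f, hf, hfU, hfA, hfB⟩, ⟨g, hg, hgU, hgA, hgB⟩⟩
    exact hne (heq h1 h2 hfB hgB ((hconn hf hg hfU hgU hs ht).1 (hsame hA hfA hgA)))

/-! ### Determinants, rays and segments in the plane -/

/-- The determinant of two vectors of the plane. -/
def cross (u v : Plane) : ℝ := u 0 * v 1 - u 1 * v 0

lemma cross_add_left (u v w : Plane) : cross (u + v) w = cross u w + cross v w := by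
  simp [cross]; ring

lemma cross_add_right (u v w : Plane) : cross u (v + w) = cross u v + cross u w := by
  simp [cross]; ring

lemma cross_sub_left (u v w : Plane) : cross (u - v) w = cross u w - cross v w := by
  simp [cross]; ring

lemma cross_sub_right (u v w : Plane) : cross u (v - w) = cross u v - cross u w := by
  simp [cross]; ring

lemma cross_smul_left (c : ℝ) (u v : Plane) : cross (c • u) v = c * cross u v := by
  simp [cross]; ring

lemma cross_smul_right (c : ℝ) (u v : Plane) : cross u (c • v) = c * cross u v := by
  simp [cross]; ring

lemma cross_neg_left (u v : Plane) : cross (-u) v = -cross u v := by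
  simp [cross]; ring

lemma cross_neg_right (u v : Plane) : cross u (-v) = -cross u v := by
  simp [cross]; ring

@[simp] lemma cross_self (u : Plane) : cross u u = 0 := by
  simp [cross]; ring

@[simp] lemma cross_zero_left (u : Plane) : cross 0 u = 0 := by
  simp [cross]

@[simp] lemma cross_zero_right (u : Plane) : cross u 0 = 0 := by
  simp [cross]

lemma cross_swap (u v : Plane) : cross u v = -cross v u := by
  simp [cross]; ring

@[fun_prop] lemma continuous_cross {X : Type*} [TopologicalSpace X] {f g : X → Plane}
    (hf : Continuous f) (hg : Continuous g) : Continuous fun x => cross (f x) (g x) := by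
  unfold cross
  fun_prop

lemma exists_smul_of_cross_eq_zero {u v : Plane} (hu : u ≠ 0) (h : cross u v = 0) :
    ∃ c : ℝ, v = c • u := by
  have hpos : u 0 ^ 2 + u 1 ^ 2 ≠ 0 := by
    intro h0
    apply hu
    ext i
    fin_cases i
    · show u 0 = 0
      nlinarith [sq_nonneg (u 0), sq_nonneg (u 1)]
    · show u 1 = 0
      nlinarith [sq_nonneg (u 0), sq_nonneg (u 1)]
  refine ⟨(u 0 * v 0 + u 1 * v 1) / (u 0 ^ 2 + u 1 ^ 2), ?_⟩
  unfold cross at h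
  ext i
  fin_cases i
  · show v 0 = _ * u 0
    field_simp
    linear_combination (-u 1) * h
  · show v 1 = _ * u 1
    field_simp
    linear_combination u 0 * h

/-- Expansion of a vector in a basis. -/
lemma cross_expand (u v w : Plane) : cross u v • w = cross w v • u + cross u w • v := by
  ext i
  fin_cases i
  · show cross u v * w 0 = cross w v * u 0 + cross u w * v 0
    unfold cross
    ring
  · show cross u v * w 1 = cross w v * u 1 + cross u w * v 1
    unfold cross
    ring

lemma cross_expand' {u v : Plane} (h : cross u v ≠ 0) (w : Plane) :
    w = (cross w v / cross u v) • u + (cross u w / cross u v) • v := by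
  have := congrArg (fun x => (cross u v)⁻¹ • x) (cross_expand u v w)
  simp only [smul_smul, smul_add, inv_mul_cancel₀ h, one_smul] at this
  rw [this]
  congr 2 <;> simp only [cross_add_left, cross_add_right, cross_smul_left, cross_smul_right,
    cross_self] <;> field_simp <;> ring

lemma exists_cross_pos {d : Plane} (hd : d ≠ 0) : ∃ n : Plane, 0 < cross d n := by
  refine ⟨!₂[-d 1, d 0], ?_⟩
  have : d 0 ≠ 0 ∨ d 1 ≠ 0 := by
    by_contra! h
    apply hd
    ext i
    fin_cases i
    · exact h.1
    · exact h.2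
  simp only [cross]
  simp
  rcases this with h | h <;> have := mul_self_pos.2 h
  · nlinarith [mul_self_nonneg (d 1)]
  · nlinarith [mul_self_nonneg (d 0)]

/-- The point `x` lies on the ray from `y` in direction `α`. -/
def OnRay (y α x : Plane) : Prop := ∃ s : ℝ, 0 ≤ s ∧ x = y + s • α

lemma OnRay.cross_eq_zero {y α x : Plane} (h : OnRay y α x) : cross (x - y) α = 0 := by
  obtain ⟨s, hs, rfl⟩ := h
  simp [cross_smul_left]

lemma isClosed_onRay (y : Plane) {α : Plane} (hα : α ≠ 0) : IsClosed {x | OnRay y α x} := by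
  have : {x | OnRay y α x} = {x | cross (x - y) α = 0 ∧ 0 ≤ inner ℝ (x - y) α} := by
    ext x
    constructor
    · rintro ⟨s, hs, rfl⟩
      simp only [mem_ofPred_eq, add_sub_cancel_left, cross_smul_left, cross_self, mul_zero, true_and,
        inner_smul_left]
      exact mul_nonneg hs (real_inner_self_nonneg)
    · rintro ⟨h1, h2⟩
      obtain ⟨c, hc⟩ := exists_smul_of_cross_eq_zero hα (by rw [cross_swap, h1, neg_zero] :
        cross α (x - y) = 0)
      refine ⟨c, ?_, by rw [← hc]; abel⟩
      rw [hc, inner_smul_left] at h2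
      have : 0 < inner ℝ α α := real_inner_self_pos.2 hα
      simp only [conj_trivial] at h2
      exact nonneg_of_mul_nonneg_left h2 this
  rw [this]
  have h1 : IsClosed {x : Plane | cross (x - y) α = 0} :=
    isClosed_eq (by fun_prop) continuous_const
  have h2 : IsClosed {x : Plane | 0 ≤ inner ℝ (x - y) α} :=
    isClosed_le continuous_const (by fun_prop)
  exact h1.inter h2

/-- The segment between two points without its endpoints. -/
def openSeg (p q : Plane) : Set Plane := {x | ∃ t : ℝ, 0 < t ∧ t < 1 ∧ x = p + t • (q - p)}

lemma openSeg_symm (p q : Plane) : openSeg p q = openSeg q p := by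
  have : ∀ p q : Plane, openSeg p q ⊆ openSeg q p := by
    rintro p q x ⟨t, h0, h1, rfl⟩
    exact ⟨1 - t, by linarith, by linarith, by module⟩
  exact (this p q).antisymm (this q p)

lemma left_notMem_openSeg {p q : Plane} (h : p ≠ q) : p ∉ openSeg p q := by
  rintro ⟨t, h0, h1, h2⟩
  have : t • (q - p) = 0 := by
    have := congrArg (fun x => x - p) h2
    simpa using this.symm
  rcases smul_eq_zero.1 this with h' | h'
  · exact h0.ne' h'
  · exact h (sub_eq_zero.1 h').symm

lemma right_notMem_openSeg {p q : Plane} (h : p ≠ q) : q ∉ openSeg p q := by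
  rw [openSeg_symm]
  exact left_notMem_openSeg h.symm

lemma mem_segment_iff {p q x : Plane} :
    x ∈ segment ℝ p q ↔ ∃ t : ℝ, 0 ≤ t ∧ t ≤ 1 ∧ x = p + t • (q - p) := by
  rw [segment_eq_image']
  constructor
  · rintro ⟨t, ht, rfl⟩
    exact ⟨t, ht.1, ht.2, rfl⟩
  · rintro ⟨t, h0, h1, rfl⟩
    exact ⟨t, ⟨h0, h1⟩, rfl⟩

lemma openSeg_subset_segment (p q : Plane) : openSeg p q ⊆ segment ℝ p q := by
  rintro x ⟨t, h0, h1, rfl⟩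
  exact mem_segment_iff.2 ⟨t, h0.le, h1.le, rfl⟩

lemma segment_sdiff {p q : Plane} (h : p ≠ q) : segment ℝ p q \ {p, q} = openSeg p q := by
  ext x
  constructor
  · rintro ⟨hx, hne⟩
    obtain ⟨t, h0, h1, rfl⟩ := mem_segment_iff.1 hx
    refine ⟨t, h0.lt_of_ne ?_, h1.lt_of_ne ?_, rfl⟩
    · rintro rfl
      simp at hne
    · rintro rfl
      simp at hne
  · intro hx
    refine ⟨openSeg_subset_segment p q hx, ?_⟩
    rintro (rfl | h')
    · exact left_notMem_openSeg h hx
    · rw [mem_singleton_iff] at h'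
      subst h'
      exact right_notMem_openSeg h hx

lemma eventually_segment_left {a b : Plane} (hab : a ≠ b) :
    ∀ᶠ x in 𝓝 a, (x ∈ segment ℝ a b ↔ OnRay a (b - a) x) := by
  have hpos : 0 < ‖b - a‖ := norm_pos_iff.2 (sub_ne_zero.2 hab.symm)
  filter_upwards [Metric.ball_mem_nhds a hpos] with _ hx
  rw [mem_segment_iff]
  constructor
  · rintro ⟨t, h0, h1, rfl⟩
    exact ⟨t, h0, rfl⟩
  · rintro ⟨t, h0, rfl⟩
    refine ⟨t, h0, ?_, rfl⟩
    rw [Metric.mem_ball, dist_eq_norm, add_sub_cancel_left, norm_smul, Real.norm_of_nonneg h0] at hx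
    by_contra! h
    nlinarith

lemma eventually_segment_mid {a b y : Plane} (hab : a ≠ b) (hy : y ∈ openSeg a b) :
    ∀ᶠ x in 𝓝 y, (x ∈ segment ℝ a b ↔ OnRay y (b - a) x ∨ OnRay y (-(b - a)) x) := by
  have hpos : 0 < ‖b - a‖ := norm_pos_iff.2 (sub_ne_zero.2 hab.symm)
  obtain ⟨t, h0, h1, rfl⟩ := hy
  have hr : 0 < min t (1 - t) * ‖b - a‖ := mul_pos (lt_min h0 (by linarith)) hpos
  filter_upwards [Metric.ball_mem_nhds _ hr] with x hx
  rw [Metric.mem_ball, dist_eq_norm] at hx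
  rw [mem_segment_iff]
  constructor
  · rintro ⟨u, hu0, hu1, rfl⟩
    rcases le_total t u with h | h
    · exact Or.inl ⟨u - t, by linarith, by module⟩
    · exact Or.inr ⟨t - u, by linarith, by module⟩
  · rintro (⟨s, hs, rfl⟩ | ⟨s, hs, rfl⟩)
    · rw [add_sub_cancel_left, norm_smul, Real.norm_of_nonneg hs] at hx
      have := (mul_lt_mul_iff_left₀ hpos).1 hx
      exact ⟨t + s, by linarith, by linarith [this.trans_le (min_le_right _ _)], by module⟩
    · rw [add_sub_cancel_left, norm_smul, norm_neg, Real.norm_of_nonneg hs] at hx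
      have := (mul_lt_mul_iff_left₀ hpos).1 hx
      exact ⟨t - s, by linarith [this.trans_le (min_le_left _ _)], by linarith, by module⟩

/-- Near `y`, the set `F` consists of two rays that start at `y`. -/
def Arms (F : Set Plane) (y α β : Plane) : Prop :=
  α ≠ 0 ∧ β ≠ 0 ∧ ∀ᶠ x in 𝓝 y, (x ∈ F ↔ OnRay y α x ∨ OnRay y β x)

lemma Arms.symm {F : Set Plane} {y α β : Plane} (h : Arms F y α β) : Arms F y β α :=
  ⟨h.2.1, h.1, h.2.2.mono fun _ hx => hx.trans or_comm⟩

lemma Arms.congr {F F' : Set Plane} {y α β : Plane} (h : Arms F y α β)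
    (hF : ∀ᶠ x in 𝓝 y, (x ∈ F ↔ x ∈ F')) : Arms F' y α β :=
  ⟨h.1, h.2.1, by filter_upwards [h.2.2, hF] with x h1 h2 using h2.symm.trans h1⟩

lemma Arms.mem {F : Set Plane} {y α β : Plane} (h : Arms F y α β) : y ∈ F :=
  h.2.2.self_of_nhds.2 (Or.inl ⟨0, le_rfl, by simp⟩)

/-! ### The boundary near each of its points -/

section Polygon

variable {n : ℕ} {poly : Polygon Plane n}

lemma edgeSet_eq (poly : Polygon Plane n) (i : Fin n) :
    poly.edgeSet ℝ i = segment ℝ (poly i) (poly (finRotate n i)) :=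
  affineSegment_eq_segment ℝ _ _

lemma mem_boundary {x : Plane} :
    x ∈ poly.boundary ℝ ↔ ∃ i, x ∈ segment ℝ (poly i) (poly (finRotate n i)) := by
  simp [Polygon.boundary, edgeSet_eq]

lemma vertex_mem_boundary (i : Fin n) : poly i ∈ poly.boundary ℝ :=
  mem_boundary.2 ⟨i, left_mem_segment ℝ _ _⟩

lemma isCompact_segment (a b : Plane) : IsCompact (segment ℝ a b) := by
  rw [segment_eq_image']
  exact isCompact_Icc.image (by fun_prop)

lemma isCompact_boundary (poly : Polygon Plane n) : IsCompact (poly.boundary ℝ) := by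
  simp only [Polygon.boundary, edgeSet_eq]
  exact isCompact_iUnion fun i => isCompact_segment _ _

lemma isClosed_boundary (poly : Polygon Plane n) : IsClosed (poly.boundary ℝ) :=
  (isCompact_boundary poly).isClosed

namespace IsSimple

lemma finRotate_ne (hP : IsSimple poly) (i : Fin n) : finRotate n i ≠ i := by
  obtain ⟨m, rfl⟩ : ∃ m, n = m + 2 := ⟨n - 2, by have := hP.three_le; omega⟩
  rw [finRotate_apply]
  simp

lemma edge_ne (hP : IsSimple poly) (i : Fin n) : poly i ≠ poly (finRotate n i) :=
  fun h => hP.finRotate_ne i (hP.vertices_injective h).symm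

lemma eq_of_mem_openSeg (hP : IsSimple poly) {i j : Fin n} {y : Plane}
    (hy : y ∈ openSeg (poly i) (poly (finRotate n i)))
    (hj : y ∈ segment ℝ (poly j) (poly (finRotate n j))) : j = i := by
  by_contra hne
  rcases hP.edges_inter i j (Ne.symm hne) y
    ⟨by rw [edgeSet_eq]; exact openSeg_subset_segment _ _ hy, by rwa [edgeSet_eq]⟩ with h | h
  · rw [h.1] at h
    rw [h.2] at hy
    exact right_notMem_openSeg (hP.edge_ne i) hy
  · rw [h.2] at hy
    exact left_notMem_openSeg (hP.edge_ne i) hy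

lemma eq_or_eq_of_mem (hP : IsSimple poly) {i j : Fin n}
    (hj : poly i ∈ segment ℝ (poly j) (poly (finRotate n j))) : j = i ∨ finRotate n j = i := by
  by_cases hne : j = i
  · exact Or.inl hne
  rcases hP.edges_inter i j (Ne.symm hne) (poly i)
    ⟨by rw [edgeSet_eq]; exact left_mem_segment ℝ _ _, by rwa [edgeSet_eq]⟩ with h | h
  · exact absurd (hP.vertices_injective h.2).symm hne
  · exact Or.inr h.1.symm

end IsSimple

/-- The part of the boundary that is made up of the edges satisfying `Q`. -/
def edgesOf (poly : Polygon Plane n) (Q : Fin n → Prop) : Set Plane :=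
  {x | ∃ i, Q i ∧ x ∈ segment ℝ (poly i) (poly (finRotate n i))}

lemma isClosed_edgesOf (poly : Polygon Plane n) (Q : Fin n → Prop) : IsClosed (edgesOf poly Q) := by
  have : edgesOf poly Q = ⋃ i ∈ {i | Q i}, segment ℝ (poly i) (poly (finRotate n i)) := by
    ext x
    simp [edgesOf]
  rw [this]
  exact (Set.toFinite _).isClosed_biUnion fun i _ => (isCompact_segment _ _).isClosed

lemma boundary_eq_edgesOf (poly : Polygon Plane n) :
    poly.boundary ℝ = edgesOf poly fun _ => True := by
  ext x
  simp [mem_boundary, edgesOf]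

/-- The finitely many edges that avoid `y` are closed, hence avoid a neighborhood of `y`. -/
lemma eventually_mem_edgesOf (Q : Fin n → Prop) (y : Plane) :
    ∀ᶠ x in 𝓝 y, (x ∈ edgesOf poly Q ↔
      ∃ i, Q i ∧ y ∈ segment ℝ (poly i) (poly (finRotate n i)) ∧
        x ∈ segment ℝ (poly i) (poly (finRotate n i))) := by
  have : ∀ᶠ x in 𝓝 y, ∀ i, y ∉ segment ℝ (poly i) (poly (finRotate n i)) →
      x ∉ segment ℝ (poly i) (poly (finRotate n i)) := by
    rw [Filter.eventually_all]
    intro i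
    rw [Filter.eventually_imp_distrib_left]
    intro h
    exact (isCompact_segment _ _).isClosed.isOpen_compl.mem_nhds h
  filter_upwards [this] with x hx
  constructor
  · rintro ⟨i, hQ, hi⟩
    refine ⟨i, hQ, ?_, hi⟩
    by_contra h
    exact hx i h hi
  · rintro ⟨i, hQ, -, hi⟩
    exact ⟨i, hQ, hi⟩

lemma IsSimple.arms_edge (hP : IsSimple poly) {i : Fin n} {y : Plane}
    (hy : y ∈ openSeg (poly i) (poly (finRotate n i))) :
    Arms (poly.boundary ℝ) y (poly (finRotate n i) - poly i) (-(poly (finRotate n i) - poly i)) := by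
  have hne : poly (finRotate n i) - poly i ≠ 0 := sub_ne_zero.2 (hP.edge_ne i).symm
  refine ⟨hne, neg_ne_zero.2 hne, ?_⟩
  rw [boundary_eq_edgesOf]
  filter_upwards [eventually_mem_edgesOf (poly := poly) (fun _ => True) y,
    eventually_segment_mid (hP.edge_ne i) hy] with x h1 h2
  rw [h1, ← h2]
  constructor
  · rintro ⟨j, -, hj, hx⟩
    rwa [hP.eq_of_mem_openSeg hy hj] at hx
  · intro hx
    exact ⟨i, trivial, openSeg_subset_segment _ _ hy, hx⟩

/-- At a vertex, the boundary consists of the two edges that meet there. -/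
lemma IsSimple.arms_vertex (hP : IsSimple poly) (i : Fin n) :
    Arms (poly.boundary ℝ) (poly (finRotate n i))
      (poly (finRotate n (finRotate n i)) - poly (finRotate n i))
      (poly i - poly (finRotate n i)) := by
  refine ⟨sub_ne_zero.2 (hP.edge_ne _).symm, sub_ne_zero.2 (hP.edge_ne i), ?_⟩
  rw [boundary_eq_edgesOf]
  filter_upwards [eventually_mem_edgesOf (poly := poly) (fun _ => True) (poly (finRotate n i)),
    eventually_segment_left (hP.edge_ne (finRotate n i)),
    eventually_segment_left (hP.edge_ne i).symm] with x h1 h2 h3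
  rw [h1, ← h2, ← h3]
  constructor
  · rintro ⟨j, -, hj, hx⟩
    rcases hP.eq_or_eq_of_mem hj with rfl | h
    · exact Or.inl hx
    · rw [(finRotate n).injective h, segment_symm] at hx
      exact Or.inr hx
  · rintro (hx | hx)
    · exact ⟨_, trivial, left_mem_segment ℝ _ _, hx⟩
    · exact ⟨i, trivial, right_mem_segment ℝ _ _, by rwa [segment_symm]⟩

/-- The two edges at a vertex do not overlap. -/
lemma IsSimple.not_smul (hP : IsSimple poly) (i : Fin n) {c : ℝ} (hc : 0 < c) :
    poly i - poly (finRotate n i) ≠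
      c • (poly (finRotate n (finRotate n i)) - poly (finRotate n i)) := by
  intro h
  set v := poly (finRotate n i)
  set w := poly (finRotate n (finRotate n i))
  have hm : 0 < max 1 c := lt_max_of_lt_left one_pos
  -- If the edges at `v` overlapped, this point would be on both: its parameters `1 / max 1 c` and
  -- `c / max 1 c` along the two edges are at most 1.
  have hx1 : v + (1 / max 1 c) • (poly i - v) ∈ openSeg v (poly i) ∪ {poly i} := by
    rcases lt_or_ge 1 c with h' | h'
    · exact Or.inl ⟨1 / max 1 c, by positivity, by
        rw [max_eq_right h'.le, div_lt_one (by linarith)]; exact h', rfl⟩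
    · right
      simp [max_eq_left h']
  have hx2 : v + (1 / max 1 c) • (poly i - v) ∈ segment ℝ v w := by
    refine mem_segment_iff.2 ⟨c / max 1 c, by positivity, ?_, ?_⟩
    · rw [div_le_one hm]
      exact le_max_right _ _
    · rw [h, smul_smul]
      congr 2
      field_simp
  rcases hx1 with hx1 | hx1
  · rw [openSeg_symm] at hx1
    exact hP.finRotate_ne i (hP.eq_of_mem_openSeg hx1 hx2)
  · rw [mem_singleton_iff.1 hx1] at hx2
    rcases hP.eq_or_eq_of_mem hx2 with h' | h'
    · exact hP.finRotate_ne i h'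
    -- Here the vertex two places after `poly i` is `poly i` itself, which is impossible with at
    -- least three vertices.
    · have h3 := hP.three_le
      obtain ⟨m, rfl⟩ : ∃ m, n = m + 3 := ⟨n - 3, by omega⟩
      simp only [finRotate_apply, add_assoc] at h'
      rw [add_eq_left] at h'
      have := congrArg Fin.val h'
      rw [show (1 + 1 : Fin (m + 3)) = ⟨2, by omega⟩ from by
        ext; simp [Fin.val_add]] at this
      simp at this

lemma boundary_cases {y : Plane} (hy : y ∈ poly.boundary ℝ) :
    (∃ i, y ∈ openSeg (poly i) (poly (finRotate n i))) ∨ ∃ i, y = poly (finRotate n i) := by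
  obtain ⟨i, hi⟩ := mem_boundary.1 hy
  obtain ⟨t, h0, h1, rfl⟩ := mem_segment_iff.1 hi
  rcases h0.eq_or_lt with rfl | h0
  · exact Or.inr ⟨(finRotate n).symm i, by rw [Equiv.apply_symm_apply]; simp⟩
  rcases h1.eq_or_lt with rfl | h1
  · exact Or.inr ⟨i, by simp⟩
  · exact Or.inl ⟨i, t, h0, h1, rfl⟩

/-- At every boundary point, the boundary consists of two arms that do not overlap. -/
lemma IsSimple.exists_arms (hP : IsSimple poly) {y : Plane} (hy : y ∈ poly.boundary ℝ) :
    ∃ α β, Arms (poly.boundary ℝ) y α β ∧ (cross α β ≠ 0 ∨ ∃ c : ℝ, 0 < c ∧ β = -(c • α)) := by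
  rcases boundary_cases hy with ⟨i, hi⟩ | ⟨i, rfl⟩
  · exact ⟨_, _, hP.arms_edge hi, Or.inr ⟨1, one_pos, by simp⟩⟩
  · refine ⟨_, _, hP.arms_vertex i, ?_⟩
    by_contra! h
    obtain ⟨c, hc⟩ := exists_smul_of_cross_eq_zero (hP.arms_vertex i).1 h.1
    rcases lt_trichotomy c 0 with hc0 | rfl | hc0
    · refine h.2 (-c) (by linarith) ?_
      rw [hc]
      module
    · rw [zero_smul] at hc
      exact (hP.arms_vertex i).2.1 hc
    · exact hP.not_smul i hc0 hc

end Polygon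

/-! ### Generic directions and the parity of crossings of two rays with a segment -/

section RayParity

/-- General position is always reached by a small perturbation: a nonzero polynomial in `ε` has no
zero in some interval to the right of 0. -/
lemma eventually_linear_ne {A B : ℝ} (h : A ≠ 0 ∨ B ≠ 0) : ∀ᶠ ε in 𝓝[>] (0 : ℝ), A + ε * B ≠ 0 := by
  by_cases hA : A = 0
  · filter_upwards [self_mem_nhdsWithin] with ε hε
    have hB := h.resolve_left (not_not.2 hA)
    rw [hA, zero_add]
    exact mul_ne_zero (ne_of_gt hε) hB
  · have hc : Continuous fun ε : ℝ => A + ε * B := by fun_prop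
    exact (hc.continuousAt.eventually_ne (by simpa using hA)).filter_mono nhdsWithin_le_nhds

lemma eventually_quadratic_ne {A B C : ℝ} (h : A ≠ 0 ∨ B ≠ 0 ∨ C ≠ 0) :
    ∀ᶠ ε in 𝓝[>] (0 : ℝ), A + ε * B + ε ^ 2 * C ≠ 0 := by
  by_cases hA : A = 0
  · filter_upwards [eventually_linear_ne (h.resolve_left (not_not.2 hA)), self_mem_nhdsWithin]
      with ε h hε
    have : A + ε * B + ε ^ 2 * C = ε * (B + ε * C) := by rw [hA]; ring
    rw [this]
    exact mul_ne_zero (ne_of_gt hε) h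
  · have hc : Continuous fun ε : ℝ => A + ε * B + ε ^ 2 * C := by fun_prop
    exact (hc.continuousAt.eventually_ne (by simpa using hA)).filter_mono nhdsWithin_le_nhds

/-- Some direction is parallel to none of finitely many nonzero vectors. -/
lemma exists_direction {ι : Type*} [Finite ι] (w : ι → Plane) (hw : ∀ i, w i ≠ 0) :
    ∃ d : Plane, d ≠ 0 ∧ ∀ i, cross d (w i) ≠ 0 := by
  have : ∀ᶠ ε in 𝓝[>] (0 : ℝ), ∀ i, w i 1 + ε * (-w i 0) ≠ 0 := by
    rw [Filter.eventually_all]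
    intro i
    refine eventually_linear_ne ?_
    by_contra! h
    apply hw i
    ext j
    fin_cases j
    · exact neg_eq_zero.1 h.2
    · exact h.1
  obtain ⟨ε, hε⟩ := this.exists
  refine ⟨!₂[1, ε], fun h => ?_, fun i => ?_⟩
  · have := congrArg (fun v : Plane => v 0) h
    simp at this
  · convert hε i using 1
    simp [cross]
    ring

/-- In coordinates: the number of positive coordinate half-axes that a segment crosses is odd if and
only if exactly one endpoint of the segment lies in the open positive quadrant. -/
lemma crossing_parity {a₁ a₂ b₁ b₂ : ℝ} (ha : a₂ = 0 → a₁ < 0) (hb : b₂ = 0 → b₁ < 0)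
    (ha' : a₁ = 0 → a₂ < 0) (hb' : b₁ = 0 → b₂ < 0)
    (h : ∀ u : ℝ, 0 ≤ u → u ≤ 1 → a₁ + u * (b₁ - a₁) = 0 → a₂ + u * (b₂ - a₂) = 0 → False) :
    ((¬(0 ≤ a₂ ↔ 0 ≤ b₂) ∧ 0 < (a₁ * b₂ - a₂ * b₁) * (b₂ - a₂)) ↔
      (¬(0 ≤ a₁ ↔ 0 ≤ b₁) ∧ 0 < (a₂ * b₁ - a₁ * b₂) * (b₁ - a₁))) ↔
    ((0 < a₁ ∧ 0 < a₂) ↔ (0 < b₁ ∧ 0 < b₂)) := by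
  -- If both coordinates change sign and the determinant vanishes, the segment passes through the
  -- origin, which `h` forbids.
  have hdet : (0 ≤ a₁ ∧ b₁ < 0 ∨ a₁ < 0 ∧ 0 ≤ b₁) → (0 ≤ a₂ ∧ b₂ < 0 ∨ a₂ < 0 ∧ 0 ≤ b₂) →
      a₁ * b₂ - a₂ * b₁ ≠ 0 := by
    intro h1 h2 h0
    have hne : b₁ - a₁ ≠ 0 := by rcases h1 with h1 | h1 <;> intro h3 <;> linarith
    refine h (-a₁ / (b₁ - a₁)) ?_ ?_ (by field_simp; ring) (by field_simp; linarith)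
    · rcases h1 with h1 | h1
      · exact div_nonneg_of_nonpos (by linarith) (by linarith)
      · exact div_nonneg (by linarith) (by linarith)
    · rcases h1 with h1 | h1
      · rw [div_le_one_of_neg (by linarith)]; linarith
      · rw [div_le_one (by linarith)]; linarith
  generalize hD : a₁ * b₂ - a₂ * b₁ = D at *
  have hD' : a₂ * b₁ - a₁ * b₂ = -D := by rw [← hD]; ring
  rw [hD']
  clear h
  have e2p : a₂ < 0 → 0 ≤ b₂ → (0 < D * (b₂ - a₂) ↔ 0 < D) := fun h h' =>
    mul_pos_iff_of_pos_right (by linarith)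
  have e2n : 0 ≤ a₂ → b₂ < 0 → (0 < D * (b₂ - a₂) ↔ D < 0) := fun h h' => by
    rw [← neg_mul_neg, mul_pos_iff_of_pos_right (by linarith), neg_pos]
  have e1p : a₁ < 0 → 0 ≤ b₁ → (0 < -D * (b₁ - a₁) ↔ D < 0) := fun h h' => by
    rw [mul_pos_iff_of_pos_right (by linarith), neg_pos]
  have e1n : 0 ≤ a₁ → b₁ < 0 → (0 < -D * (b₁ - a₁) ↔ 0 < D) := fun h h' => by
    rw [← neg_mul_neg, mul_pos_iff_of_pos_right (by linarith), neg_neg]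
  have qa : 0 ≤ a₁ → 0 ≤ a₂ → 0 < a₁ ∧ 0 < a₂ := fun h h' =>
    ⟨h.lt_of_ne fun h0 => (ha' h0.symm).not_ge h', h'.lt_of_ne fun h0 => (ha h0.symm).not_ge h⟩
  have qb : 0 ≤ b₁ → 0 ≤ b₂ → 0 < b₁ ∧ 0 < b₂ := fun h h' =>
    ⟨h.lt_of_ne fun h0 => (hb' h0.symm).not_ge h', h'.lt_of_ne fun h0 => (hb h0.symm).not_ge h⟩
  rcases lt_or_ge a₁ 0 with h1 | h1 <;> rcases lt_or_ge a₂ 0 with h2 | h2 <;>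
  rcases lt_or_ge b₁ 0 with h3 | h3 <;> rcases lt_or_ge b₂ 0 with h4 | h4 <;>
  simp only [h1, h2, h3, h4, e2p, e2n, e1p, e1n, qa, qb, not_le.2, and_true, true_and,
    false_and, and_false, iff_true, iff_false, false_iff, not_true, not_false_iff,
    h1.not_gt, h2.not_gt, h3.not_gt, h4.not_gt, not_lt]
  all_goals clear e2p e2n e1p e1n
  · nlinarith [mul_nonneg_of_nonpos_of_nonpos h2.le h3.le, mul_nonpos_of_nonpos_of_nonneg h1.le h4]
  · nlinarith [mul_nonneg_of_nonpos_of_nonpos h1.le h4.le, mul_nonpos_of_nonpos_of_nonneg h2.le h3]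
  · rcases lt_or_gt_of_ne (hdet (Or.inr ⟨h1, h3⟩) (Or.inr ⟨h2, h4⟩)) with h | h <;>
      simp [h, h.not_gt]
  · nlinarith [mul_nonneg_of_nonpos_of_nonpos h1.le h4.le, mul_nonpos_of_nonneg_of_nonpos h2 h3.le]
  · nlinarith [mul_neg_of_neg_of_pos h1 (qb h3 h4).2, mul_nonneg h2 h3]
  · nlinarith [mul_nonneg_of_nonpos_of_nonpos h2.le h3.le, mul_nonpos_of_nonneg_of_nonpos h1 h4.le]
  · nlinarith [mul_neg_of_neg_of_pos h2 (qb h3 h4).1, mul_nonneg h1 h4]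
  · rcases lt_or_gt_of_ne (hdet (Or.inl ⟨h1, h3⟩) (Or.inl ⟨h2, h4⟩)) with h | h <;>
      simp [h, h.not_gt]
  · nlinarith [mul_neg_of_pos_of_neg (qa h1 h2).2 h3, mul_nonneg h1 h4]
  · nlinarith [mul_neg_of_pos_of_neg (qa h1 h2).1 h4, mul_nonneg h2 h3]

end RayParity

/-! ### Counting the edges hit by a generic ray -/

section RayCount

variable {n : ℕ} {poly : Polygon Plane n}

/-- The ray from `x` in direction `d` passes through no vertex. -/
def RayGeneric (poly : Polygon Plane n) (x d : Plane) : Prop :=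
  d ≠ 0 ∧ ∀ (i : Fin n) (t : ℝ), 0 ≤ t → x + t • d ≠ poly i

/-- The ray from `x` in direction `d` meets the edge with index `i`. -/
def RayHits (poly : Polygon Plane n) (x d : Plane) (i : Fin n) : Prop :=
  ∃ t : ℝ, 0 ≤ t ∧ x + t • d ∈ segment ℝ (poly i) (poly (finRotate n i))

/-- The parameters at which the ray from `x` in direction `d` meets the boundary. -/
def rayTimes (poly : Polygon Plane n) (x d : Plane) : Set ℝ :=
  {t : ℝ | 0 ≤ t ∧ x + t • d ∈ poly.boundary ℝ}

lemma RayGeneric.of_cross (hP : IsSimple poly) {x d : Plane}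
    (h : ∀ i, cross d (poly i - x) ≠ 0) : RayGeneric poly x d := by
  refine ⟨?_, fun i t ht hxt => ?_⟩
  · rintro rfl
    exact h ⟨0, by have := hP.three_le; omega⟩ (by simp)
  · apply h i
    rw [← hxt]
    simp [cross_smul_right]

/-- Two hits force the edge to be parallel to `d`; continuing from the later hit along the ray, one
then reaches an endpoint of the edge, contrary to genericity. -/
lemma RayGeneric.unique_time {x d : Plane} (h : RayGeneric poly x d) {i : Fin n} {t t' : ℝ}
    (ht : 0 ≤ t) (htt : t < t')
    (h1 : x + t • d ∈ segment ℝ (poly i) (poly (finRotate n i)))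
    (h2 : x + t' • d ∈ segment ℝ (poly i) (poly (finRotate n i))) : False := by
  obtain ⟨u, hu0, hu1, hu⟩ := mem_segment_iff.1 h1
  obtain ⟨u', hu0', hu1', hu'⟩ := mem_segment_iff.1 h2
  set a := poly i
  set b := poly (finRotate n i)
  have hd : (t' - t) • d = (u' - u) • (b - a) := by
    have := congrArg₂ (fun y z => z - y) hu hu'
    simp only [add_sub_add_left_eq_sub] at this
    rw [sub_smul, this, sub_smul]
  have hne : u' - u ≠ 0 := by
    intro h0
    rw [h0, zero_smul] at hd
    rcases smul_eq_zero.1 hd with h' | h'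
    · linarith
    · exact h.1 h'
  have hba : b - a = ((t' - t) / (u' - u)) • d := by
    rw [div_eq_inv_mul, mul_smul, hd, smul_smul, inv_mul_cancel₀ hne, one_smul]
  rcases lt_or_gt_of_ne hne with hneg | hpos
  · refine h.2 i (t' + (u' * ((t' - t) / (u - u')))) ?_ ?_
    · have : 0 ≤ u' * ((t' - t) / (u - u')) :=
        mul_nonneg hu0' (div_nonneg (by linarith) (by linarith))
      linarith
    · have : x + t' • d - u' • (b - a) = a := by rw [hu']; module
      rw [← show poly i = a from rfl] at *
      rw [← this, hba, show (t' - t) / (u' - u) = -((t' - t) / (u - u')) by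
        rw [← neg_sub u u', div_neg]]
      module
  · refine h.2 (finRotate n i) (t' + ((1 - u') * ((t' - t) / (u' - u)))) ?_ ?_
    · have : 0 ≤ (1 - u') * ((t' - t) / (u' - u)) :=
        mul_nonneg (by linarith) (div_nonneg (by linarith) (by linarith))
      linarith
    · have : x + t' • d + (1 - u') • (b - a) = b := by rw [hu']; module
      show _ = b
      rw [← this, hba]
      module

lemma IsSimple.edge_unique (hP : IsSimple poly) {i j : Fin n} {y : Plane} (hy : ∀ k, y ≠ poly k)
    (hi : y ∈ segment ℝ (poly i) (poly (finRotate n i)))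
    (hj : y ∈ segment ℝ (poly j) (poly (finRotate n j))) : i = j := by
  by_contra hne
  rcases hP.edges_inter i j hne y ⟨by rwa [edgeSet_eq], by rwa [edgeSet_eq]⟩ with h | h
  · exact hy _ h.2
  · exact hy _ h.2

/-- Times and edges correspond bijectively: an edge is hit at one time only, and one time belongs to
one edge only, because different edges share no points but vertices. -/
lemma rayTimes_finite_ncard (hP : IsSimple poly) {x d : Plane} (h : RayGeneric poly x d) :
    (rayTimes poly x d).Finite ∧ (rayTimes poly x d).ncard = {i | RayHits poly x d i}.ncard := by
  have hch : ∀ i : {i // RayHits poly x d i}, ∃ t : ℝ, 0 ≤ t ∧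
      x + t • d ∈ segment ℝ (poly i) (poly (finRotate n i)) := fun i => i.2
  choose τ hτ0 hτ using hch
  have hrange : rayTimes poly x d = range τ := by
    ext t
    constructor
    · rintro ⟨ht, hx⟩
      obtain ⟨i, hi⟩ := mem_boundary.1 hx
      refine ⟨⟨i, t, ht, hi⟩, ?_⟩
      by_contra hne
      rcases lt_or_gt_of_ne hne with hlt | hlt
      · exact h.unique_time (hτ0 _) hlt (hτ _) hi
      · exact h.unique_time ht hlt hi (hτ ⟨i, t, ht, hi⟩)
    · rintro ⟨i, rfl⟩
      exact ⟨hτ0 i, mem_boundary.2 ⟨i, hτ i⟩⟩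
  have hinj : Function.Injective τ := by
    intro i j hij
    have hj := hτ j
    rw [← hij] at hj
    exact Subtype.ext (hP.edge_unique (fun k => h.2 k _ (hτ0 i)) (hτ i) hj)
  rw [hrange]
  refine ⟨finite_range τ, ?_⟩
  rw [← image_univ, ncard_image_of_injective _ hinj, ncard_univ]
  rfl

/-- In the coordinates `X`, `Y` of the basis `d`, `d'` with origin `x` the ray is the nonnegative
`X`-axis. The edge meets that axis when `Y` changes sign and the intersection abscissa, determinant
over difference of the `Y`, is positive. `X` and `Y` are variables so that their roles can be
exchanged for the ray in direction `d'`. -/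
lemma rayHits_iff {x d d' : Plane} (hx : x ∉ poly.boundary ℝ)
    (h : RayGeneric poly x d) (hD : cross d d' ≠ 0) (i : Fin n) (X Y : Plane → ℝ)
    (hX : ∀ v, X v = cross (v - x) d' / cross d d') (hY : ∀ v, Y v = cross d (v - x) / cross d d') :
    RayHits poly x d i ↔
      (¬(0 ≤ Y (poly i) ↔ 0 ≤ Y (poly (finRotate n i))) ∧
        0 < (X (poly i) * Y (poly (finRotate n i)) - Y (poly i) * X (poly (finRotate n i))) *
          (Y (poly (finRotate n i)) - Y (poly i))) := by
  have hexp : ∀ v, v = x + (X v • d + Y v • d') := by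
    intro v
    rw [hX, hY, ← cross_expand' hD]
    abel
  have hneg : ∀ j, Y (poly j) = 0 → X (poly j) < 0 := by
    intro j hj
    by_contra! hpos
    refine h.2 j _ hpos ?_
    conv_rhs => rw [hexp (poly j), hj]
    simp
  have hlin : ∀ a b : Plane, ∀ u : ℝ, X (a + u • (b - a)) = X a + u * (X b - X a) ∧
      Y (a + u • (b - a)) = Y a + u * (Y b - Y a) := by
    intro a b u
    simp only [hX, hY, cross_sub_left, cross_add_left, cross_sub_right, cross_add_right,
      cross_smul_left, cross_smul_right]
    constructor <;> ring
  have hray : ∀ t : ℝ, X (x + t • d) = t ∧ Y (x + t • d) = 0 := by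
    intro t
    simp only [hX, hY, add_sub_cancel_left, cross_smul_left, cross_smul_right, cross_self]
    constructor
    · field_simp
    · simp
  have ha := hneg i
  have hb := hneg (finRotate n i)
  set a := poly i
  set b := poly (finRotate n i)
  constructor
  · rintro ⟨t, ht, hseg⟩
    have ht' : 0 < t := by
      refine ht.lt_of_ne ?_
      rintro rfl
      rw [zero_smul, add_zero] at hseg
      exact hx (mem_boundary.2 ⟨i, hseg⟩)
    obtain ⟨u, hu0, hu1, hu⟩ := mem_segment_iff.1 hseg
    have h1 := (hray t).1
    have h2 := (hray t).2
    rw [hu, (hlin a b u).1] at h1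
    rw [hu, (hlin a b u).2] at h2
    have hda : Y a ≠ 0 := by
      intro h0
      rw [h0, zero_add, sub_zero] at h2
      rcases mul_eq_zero.1 h2 with rfl | h3
      · have := ha h0
        linarith
      · have := ha h0
        have := hb h3
        nlinarith
    have hdb : Y b ≠ 0 := by
      intro h0
      have h3 : (1 - u) * Y a = 0 := by rw [h0] at h2; linarith
      have hu' : u = 1 := by
        have := (mul_eq_zero.1 h3).resolve_right hda
        linarith
      have := hb h0
      rw [hu'] at h1
      linarith
    have hba : Y b - Y a ≠ 0 := by
      intro h0
      rw [h0] at h2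
      apply hda
      linarith
    have hdet : X a * Y b - Y a * X b = t * (Y b - Y a) := by
      linear_combination (Y b - Y a) * h1 - (X b - X a) * h2
    rw [hdet]
    refine ⟨fun hiff => ?_, ?_⟩
    · rcases lt_or_gt_of_ne hda with h3 | h3
      · have h4 : Y b < 0 := by
          by_contra! h4
          exact absurd (hiff.2 h4) (not_le.2 h3)
        nlinarith [mul_nonneg hu0 (neg_nonneg.2 h4.le), mul_nonneg (sub_nonneg.2 hu1) (neg_nonneg.2 h3.le)]
      · have h4 : 0 < Y b := (hiff.1 h3.le).lt_of_ne (Ne.symm hdb)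
        nlinarith [mul_nonneg hu0 h4.le, mul_nonneg (sub_nonneg.2 hu1) h3.le]
    · have := mul_pos ht' (mul_self_pos.2 hba)
      linarith
  · rintro ⟨h1, h2⟩
    have hba : Y b - Y a ≠ 0 := by
      intro h0
      rw [h0, mul_zero] at h2
      exact lt_irrefl _ h2
    have hsgn : (0 ≤ Y a ∧ Y b < 0) ∨ (Y a < 0 ∧ 0 ≤ Y b) := by
      rcases lt_or_ge (Y a) 0 with h3 | h3 <;> rcases lt_or_ge (Y b) 0 with h4 | h4
      · exact absurd (iff_of_false (not_le.2 h3) (not_le.2 h4)) h1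
      · exact Or.inr ⟨h3, h4⟩
      · exact Or.inl ⟨h3, h4⟩
      · exact absurd (iff_of_true h3 h4) h1
    refine ⟨(X a * Y b - Y a * X b) / (Y b - Y a), ?_, mem_segment_iff.2
      ⟨-Y a / (Y b - Y a), ?_, ?_, ?_⟩⟩
    · rw [div_nonneg_iff]
      rcases pos_and_pos_or_neg_and_neg_of_mul_pos h2 with h3 | h3
      · exact Or.inl ⟨h3.1.le, h3.2.le⟩
      · exact Or.inr ⟨h3.1.le, h3.2.le⟩
    · rcases hsgn with h3 | h3
      · exact div_nonneg_of_nonpos (by linarith) (by linarith)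
      · exact div_nonneg (by linarith) (by linarith)
    · rcases hsgn with h3 | h3
      · rw [div_le_one_of_neg (by linarith)]
        linarith
      · rw [div_le_one (by linarith)]
        linarith
    · rw [hexp (a + _), (hlin a b _).1, (hlin a b _).2]
      have e1 : Y a + -Y a / (Y b - Y a) * (Y b - Y a) = 0 := by field_simp; ring
      have e2 : X a + -Y a / (Y b - Y a) * (X b - X a) = (X a * Y b - Y a * X b) / (Y b - Y a) := by
        field_simp
        ring
      rw [e1, e2, zero_smul, add_zero]

end RayCount

/-! ### The even-odd rule; the region is compact -/

section Inside

variable {n : ℕ} {poly : Polygon Plane n}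

/-- By `crossing_parity` an edge contributes oddly to the two rays together exactly when one of its
endpoints is in the open quadrant between them. Around the closed polygon such changes are even in
number. -/
lemma odd_ncard_rayTimes_iff_of_cross (hP : IsSimple poly) {x d d' : Plane}
    (hx : x ∉ poly.boundary ℝ) (h : RayGeneric poly x d) (h' : RayGeneric poly x d')
    (hD : cross d d' ≠ 0) :
    Odd (rayTimes poly x d).ncard ↔ Odd (rayTimes poly x d').ncard := by
  classical
  rw [(rayTimes_finite_ncard hP h).2, (rayTimes_finite_ncard hP h').2]
  set X : Plane → ℝ := fun v => cross (v - x) d' / cross d d' with hX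
  set Y : Plane → ℝ := fun v => cross d (v - x) / cross d d' with hY
  have hD' : cross d' d ≠ 0 := by rwa [cross_swap, neg_ne_zero]
  have hX' : ∀ v, Y v = cross (v - x) d / cross d' d := by
    intro v
    rw [hY, cross_swap d' d, cross_swap (v - x) d, neg_div_neg_eq]
  have hY' : ∀ v, X v = cross d' (v - x) / cross d' d := by
    intro v
    rw [hX, cross_swap d' d, cross_swap d' (v - x), neg_div_neg_eq]
  have hexp : ∀ v, v = x + (X v • d + Y v • d') := by
    intro v
    rw [hX, hY, ← cross_expand' hD]
    abel
  have hlin : ∀ a b : Plane, ∀ u : ℝ, X (a + u • (b - a)) = X a + u * (X b - X a) ∧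
      Y (a + u • (b - a)) = Y a + u * (Y b - Y a) := by
    intro a b u
    simp only [hX, hY, cross_sub_left, cross_add_left, cross_sub_right, cross_add_right,
      cross_smul_left, cross_smul_right]
    constructor <;> ring
  -- The indicator of the open quadrant; in the cyclic sum every vertex occurs twice, so `g` cancels
  -- modulo 2.
  let g : Fin n → ZMod 2 := fun i => if 0 < X (poly i) ∧ 0 < Y (poly i) then 1 else 0
  have hedge : ∀ i, ((if RayHits poly x d i then 1 else 0 : ZMod 2) +
      (if RayHits poly x d' i then 1 else 0)) = g i + g (finRotate n i) := by
    intro i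
    have hn1 : ∀ j, Y (poly j) = 0 → X (poly j) < 0 := by
      intro j hj
      by_contra! hpos
      refine h.2 j _ hpos ?_
      conv_rhs => rw [hexp (poly j), hj]
      simp
    have hn2 : ∀ j, X (poly j) = 0 → Y (poly j) < 0 := by
      intro j hj
      by_contra! hpos
      refine h'.2 j _ hpos ?_
      conv_rhs => rw [hexp (poly j), hj]
      simp
    have key := crossing_parity (hn1 i) (hn1 (finRotate n i)) (hn2 i) (hn2 (finRotate n i))
      fun u hu0 hu1 e1 e2 => by
        refine hx (mem_boundary.2 ⟨i, mem_segment_iff.2 ⟨u, hu0, hu1, ?_⟩⟩)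
        rw [hexp (poly i + _), (hlin _ _ u).1, (hlin _ _ u).2, e1, e2]
        simp
    rw [← rayHits_iff hx h hD i X Y (fun _ => rfl) (fun _ => rfl),
      ← rayHits_iff hx h' hD' i Y X hX' hY'] at key
    simp only [g]
    by_cases h1 : RayHits poly x d i <;> by_cases h2 : RayHits poly x d' i <;>
    by_cases h3 : 0 < X (poly i) ∧ 0 < Y (poly i) <;>
    by_cases h4 : 0 < X (poly (finRotate n i)) ∧ 0 < Y (poly (finRotate n i)) <;>
    simp only [h1, h2, h3, h4, and_self, if_true, if_false] at key ⊢ <;>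
    first | decide | simp at key
  have hsum := Finset.sum_congr (rfl : (Finset.univ : Finset (Fin n)) = _) fun i _ => hedge i
  rw [Finset.sum_add_distrib, Finset.sum_add_distrib, Equiv.sum_comp (finRotate n) g,
    CharTwo.add_self_eq_zero, ← Finset.natCast_card_filter, ← Finset.natCast_card_filter] at hsum
  have hcard : ∀ e, {i | RayHits poly x e i}.ncard =
      (Finset.univ.filter fun i => RayHits poly x e i).card := by
    intro e
    rw [← ncard_coe_finset]
    simp
  rw [hcard, hcard, ← ZMod.natCast_eq_one_iff_odd, ← ZMod.natCast_eq_one_iff_odd,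
    CharTwo.add_eq_zero.1 hsum]

/-- Parallel directions are not covered by `odd_ncard_rayTimes_iff_of_cross`, so both rays are
compared with a third one, in a direction `e` parallel to neither. -/
lemma odd_ncard_rayTimes_iff (hP : IsSimple poly) {x d d' : Plane}
    (hx : x ∉ poly.boundary ℝ) (h : RayGeneric poly x d) (h' : RayGeneric poly x d') :
    Odd (rayTimes poly x d).ncard ↔ Odd (rayTimes poly x d').ncard := by
  have hv : ∀ i, poly i - x ≠ 0 := fun i h0 => hx (sub_eq_zero.1 h0 ▸ vertex_mem_boundary i)
  obtain ⟨e, he, hcr⟩ := exists_direction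
    (Sum.elim (fun i : Fin n => poly i - x) (Sum.elim (fun _ : Unit => d) fun _ : Unit => d'))
    (by rintro (i | i | i) <;> simp [hv, h.1, h'.1])
  have he : RayGeneric poly x e := .of_cross hP fun i => hcr (Sum.inl i)
  exact (odd_ncard_rayTimes_iff_of_cross hP hx he h (hcr (Sum.inr (Sum.inl ())))).symm.trans
    (odd_ncard_rayTimes_iff_of_cross hP hx he h' (hcr (Sum.inr (Sum.inr ()))))

/-- Whether a point is enclosed can be decided with a single ray. -/
lemma mem_inside_iff (hP : IsSimple poly) {x d : Plane} (hx : x ∉ poly.boundary ℝ)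
    (h : RayGeneric poly x d) : x ∈ inside poly ↔ Odd (rayTimes poly x d).ncard :=
  ⟨fun hin => hin.2 d h.1 h.2, fun hodd => ⟨hx, fun _ h1 h2 =>
    (odd_ncard_rayTimes_iff hP hx h ⟨h1, h2⟩).1 hodd⟩⟩

/-- A segment in general position has its endpoints on the same side of the boundary if and only if
it crosses the boundary an even number of times. -/
lemma inside_iff_inside_iff_even (hP : IsSimple poly) {p q : Plane} (hp : p ∉ poly.boundary ℝ)
    (hq : q ∉ poly.boundary ℝ) (h : ∀ i, cross (q - p) (poly i - p) ≠ 0) :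
    (p ∈ inside poly ↔ q ∈ inside poly) ↔ Even (poly.boundary ℝ ∩ openSeg p q).ncard := by
  have hgp : RayGeneric poly p (q - p) := .of_cross hP h
  have hgq : RayGeneric poly q (q - p) := .of_cross hP fun i => by
    rw [show poly i - q = (poly i - p) - (q - p) by abel, cross_sub_right, cross_self, sub_zero]
    exact h i
  rw [mem_inside_iff hP hp hgp, mem_inside_iff hP hq hgq]
  have hfin := (rayTimes_finite_ncard hP hgp).1
  have hd : q - p ≠ 0 := hgp.1
  -- The ray from `p` through `q` is the segment followed by the ray from `q`, whose parameters are
  -- shifted by 1.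
  have hsplit : rayTimes poly p (q - p) = {t : ℝ | 0 < t ∧ t < 1 ∧ p + t • (q - p) ∈ poly.boundary ℝ} ∪
      (fun t => 1 + t) '' rayTimes poly q (q - p) := by
    ext t
    constructor
    · rintro ⟨ht, hb⟩
      rcases lt_or_ge t 1 with h1 | h1
      · left
        refine ⟨ht.lt_of_ne ?_, h1, hb⟩
        rintro rfl
        simp at hb
        exact hp hb
      · right
        refine ⟨t - 1, ⟨by linarith, ?_⟩, by ring⟩
        convert hb using 1
        module
    · rintro (⟨h0, h1, hb⟩ | ⟨u, ⟨hu, hb⟩, rfl⟩)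
      · exact ⟨h0.le, hb⟩
      · refine ⟨by linarith, ?_⟩
        convert hb using 1
        module
  have hdisj : Disjoint {t : ℝ | 0 < t ∧ t < 1 ∧ p + t • (q - p) ∈ poly.boundary ℝ}
      ((fun t => 1 + t) '' rayTimes poly q (q - p)) := by
    rw [Set.disjoint_left]
    rintro t ⟨h0, h1, -⟩ ⟨u, ⟨hu, -⟩, rfl⟩
    simp only at h1
    linarith
  have himg : poly.boundary ℝ ∩ openSeg p q = (fun t : ℝ => p + t • (q - p)) ''
      {t : ℝ | 0 < t ∧ t < 1 ∧ p + t • (q - p) ∈ poly.boundary ℝ} := by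
    ext y
    constructor
    · rintro ⟨hb, t, h0, h1, rfl⟩
      exact ⟨t, ⟨h0, h1, hb⟩, rfl⟩
    · rintro ⟨t, ⟨h0, h1, hb⟩, rfl⟩
      exact ⟨hb, t, h0, h1, rfl⟩
  have hinj : Function.Injective fun t : ℝ => p + t • (q - p) := by
    intro t u htu
    simpa [hd] using htu
  rw [himg, ncard_image_of_injective _ hinj, hsplit, ncard_union_eq hdisj
    (hfin.subset (hsplit ▸ subset_union_left)) (hfin.subset (hsplit ▸ subset_union_right)),
    ncard_image_of_injective _ (add_right_injective 1)]
  rw [Nat.odd_add]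
  rcases Nat.even_or_odd (rayTimes poly q (q - p)).ncard with h1 | h1
  · simp [h1, Nat.not_odd_iff_even.2 h1]
  · simp [h1, Nat.not_even_iff_odd.2 h1, Nat.not_odd_iff_even]

/-- A segment inside the ball has no crossings, and zero is even. The parity lemma wants the line to
avoid all vertices, so `x` and `y` are both compared with one generic point of the ball. -/
lemma inside_iff_of_ball (hP : IsSimple poly) {x₀ : Plane} {r : ℝ}
    (hball : ∀ y ∈ Metric.ball x₀ r, y ∉ poly.boundary ℝ) {x y : Plane}
    (hx : x ∈ Metric.ball x₀ r) (hy : y ∈ Metric.ball x₀ r) :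
    x ∈ inside poly ↔ y ∈ inside poly := by
  have hseg : ∀ u ∈ Metric.ball x₀ r, ∀ v ∈ Metric.ball x₀ r,
      (∀ i, cross (v - u) (poly i - u) ≠ 0) → (u ∈ inside poly ↔ v ∈ inside poly) := by
    intro u hu v hv h
    rw [inside_iff_inside_iff_even hP (hball u hu) (hball v hv) h]
    have : poly.boundary ℝ ∩ openSeg u v = ∅ := by
      rw [← disjoint_iff_inter_eq_empty, Set.disjoint_right]
      intro w hw
      exact hball w ((convex_ball x₀ r).segment_subset hu hv (openSeg_subset_segment u v hw))
    simp [this]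
  -- The displacement `(ε, ε²)` lies on a curve that no line contains: the determinant is a
  -- polynomial in `ε` whose linear and quadratic coefficients are, up to sign, the coordinates of
  -- `poly i - u ≠ 0`.
  have hev : ∀ u : Plane, u ∉ poly.boundary ℝ → ∀ᶠ ε in 𝓝[>] (0 : ℝ), ∀ i,
      cross (x + ε • !₂[1, 0] + (ε ^ 2) • !₂[0, 1] - u) (poly i - u) ≠ 0 := by
    intro u hu
    rw [Filter.eventually_all]
    intro i
    have := eventually_quadratic_ne (A := cross (x - u) (poly i - u)) (B := (poly i - u) 1)
      (C := -(poly i - u) 0) ?_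
    · filter_upwards [this] with ε h
      convert h using 1
      simp [cross]
      ring
    · by_contra! h
      apply hu
      rw [← (sub_eq_zero.1 (show poly i - u = 0 from ?_) : poly i = u)]
      · exact vertex_mem_boundary i
      · ext j
        fin_cases j
        · exact neg_eq_zero.1 h.2.2
        · exact h.2.1
  have htend : Tendsto (fun ε : ℝ => x + ε • !₂[1, 0] + (ε ^ 2) • !₂[0, 1]) (𝓝[>] (0 : ℝ)) (𝓝 x) := by
    have hc : Continuous fun ε : ℝ => x + ε • (!₂[1, 0] : Plane) + (ε ^ 2) • (!₂[0, 1] : Plane) := by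
      fun_prop
    have := hc.tendsto 0
    simp only [zero_smul, add_zero, ne_eq, OfNat.ofNat_ne_zero, not_false_eq_true, zero_pow] at this
    exact this.mono_left nhdsWithin_le_nhds
  obtain ⟨ε, h1, h2, h3⟩ := ((hev x (hball x hx)).and ((hev y (hball y hy)).and
    (htend.eventually (Metric.isOpen_ball.mem_nhds hx)))).exists
  exact (hseg x hx _ h3 h1).trans (hseg y hy _ h3 h2).symm

lemma isOpen_inside (hP : IsSimple poly) : IsOpen (inside poly) := by
  rw [Metric.isOpen_iff]
  intro x hx
  obtain ⟨r, hr, hball⟩ := Metric.isOpen_iff.1 (isClosed_boundary poly).isOpen_compl x hx.1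
  exact ⟨r, hr, fun y hy => (inside_iff_of_ball hP (fun z hz => hball hz)
    (Metric.mem_ball_self hr) hy).1 hx⟩

lemma notMem_region {x : Plane} :
    x ∉ region poly ↔ x ∉ poly.boundary ℝ ∧ x ∉ inside poly := by
  simp [region]

lemma isOpen_compl_region (hP : IsSimple poly) : IsOpen (region poly)ᶜ := by
  rw [Metric.isOpen_iff]
  intro x hx
  rw [mem_compl_iff, notMem_region] at hx
  obtain ⟨r, hr, hball⟩ := Metric.isOpen_iff.1 (isClosed_boundary poly).isOpen_compl x hx.1
  refine ⟨r, hr, fun y hy => ?_⟩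
  rw [mem_compl_iff, notMem_region]
  exact ⟨hball hy, fun h => hx.2 ((inside_iff_of_ball hP (fun z hz => hball hz)
    (Metric.mem_ball_self hr) hy).2 h)⟩

/-- A connected set that avoids the boundary is enclosed if one of its points is. -/
lemma inside_iff_of_isPreconnected (hP : IsSimple poly) {S : Set Plane} (hS : IsPreconnected S)
    (hSb : ∀ x ∈ S, x ∉ poly.boundary ℝ) {x y : Plane} (hx : x ∈ S) (hy : y ∈ S) :
    x ∈ inside poly ↔ y ∈ inside poly := by
  have key : ∀ x ∈ S, ∀ y ∈ S, x ∈ inside poly → y ∈ inside poly := by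
    intro x hx y hy hin
    by_contra hout
    obtain ⟨w, -, hw1, hw2⟩ := hS _ _ (isOpen_inside hP) (isOpen_compl_region hP)
      (fun w hw => by
        by_cases h : w ∈ inside poly
        · exact Or.inl h
        · exact Or.inr (notMem_region.2 ⟨hSb w hw, h⟩))
      ⟨x, hx, hin⟩ ⟨y, hy, notMem_region.2 ⟨hSb y hy, hout⟩⟩
    exact (notMem_region.1 hw2).2 hw1
  exact ⟨key x hx y hy, key y hy x hx⟩

/-- From a point outside a disk that contains the boundary, the ray pointing away from the center
crosses nothing, and zero is not odd. -/
lemma isBounded_region (hP : IsSimple poly) : Bornology.IsBounded (region poly) := by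
  obtain ⟨R, hR⟩ := (isCompact_boundary poly).isBounded.subset_closedBall 0
  refine (Metric.isBounded_closedBall (x := (0 : Plane)) (r := R)).subset ?_
  rintro x (hx | hx)
  · exact hR hx
  by_contra hxR
  rw [mem_closedBall_zero_iff, not_le] at hxR
  have hpos : 0 < ‖x‖ := by
    have h0 : 0 < n := by have := hP.three_le; omega
    have := hR (vertex_mem_boundary (poly := poly) ⟨0, h0⟩)
    rw [mem_closedBall_zero_iff] at this
    linarith [norm_nonneg (poly ⟨0, h0⟩)]
  have hfar : ∀ t : ℝ, 0 ≤ t → x + t • x ∉ poly.boundary ℝ := by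
    intro t ht hb
    have h1 := hR hb
    rw [mem_closedBall_zero_iff, show x + t • x = (1 + t) • x by module, norm_smul,
      Real.norm_of_nonneg (by linarith)] at h1
    nlinarith
  have hodd := hx.2 x (norm_pos_iff.1 hpos) fun i t ht h => hfar t ht (h ▸ vertex_mem_boundary i)
  have : {t : ℝ | 0 ≤ t ∧ x + t • x ∈ poly.boundary ℝ} = ∅ := by
    ext t
    simpa using hfar t
  rw [this] at hodd
  simp at hodd

lemma isCompact_region (hP : IsSimple poly) : IsCompact (region poly) :=
  Metric.isCompact_of_isClosed_isBounded ⟨isOpen_compl_region hP⟩ (isBounded_region hP)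

end Inside

/-! ### Nearby segments and the two arms at a boundary point -/

section Hits

/-- At `y`, the two arms of `F` lie strictly on opposite sides of the line with direction `d`. -/
def Trans (F : Set Plane) (y d : Plane) : Prop :=
  ∃ α β, Arms F y α β ∧ 0 < cross d α ∧ cross d β < 0

/-- At `y`, the two arms of `F` lie strictly on the same side of the line with direction `d`. -/
def Tang (F : Set Plane) (y d : Plane) : Prop :=
  ∃ α β, Arms F y α β ∧ 0 < cross d α * cross d β ∧ cross α β ≠ 0

/-- The intersection of the line through `e` in direction `α` with the line through `p` and `q`. -/
noncomputable def hit (e α p q : Plane) : Plane := e - (cross (q - p) (e - p) / cross (q - p) α) • α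

/-- The intersection has parameter `-(o / c)` on the ray and `1 - cross (q - e) α / c` on the
segment. The two inequalities say that the former is nonnegative and the latter below 1; `hlt` says
that the latter is positive. -/
lemma onRay_and_mem_openSeg_iff {e α p q x : Plane} (hc : cross (q - p) α ≠ 0)
    (hlt : cross (q - e) α / cross (q - p) α < 1) :
    (OnRay e α x ∧ x ∈ openSeg p q) ↔ (x = hit e α p q ∧ cross (q - p) (e - p) * cross (q - p) α ≤ 0 ∧
      0 < cross (q - p) α * cross (q - e) α) := by
  set c := cross (q - p) α with hcdef
  set o := cross (q - p) (e - p) with hodef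
  have hc2 : 0 < c * c := mul_self_pos.2 hc
  constructor
  · rintro ⟨⟨s, hs, rfl⟩, t, h0, h1, ht⟩
    have h2 : o + s * c = 0 := by
      have := congrArg (fun v => cross (q - p) (v - p)) ht
      simp only [add_sub_cancel_left, cross_smul_right, cross_self, mul_zero] at this
      rw [show e + s • α - p = (e - p) + s • α by abel, cross_add_right, cross_smul_right] at this
      exact this
    have h3 : cross (q - e) α = (1 - t) * c := by
      have : q - e = (1 - t) • (q - p) + s • α := by
        rw [show e = p + t • (q - p) - s • α by rw [← ht]; abel]
        module
      rw [this, cross_add_left, cross_smul_left, cross_smul_left, cross_self]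
      ring
    refine ⟨?_, ?_, ?_⟩
    · rw [hit, ← hodef, ← hcdef, show o / c = -s by field_simp; linarith]
      module
    · rw [show o = -(s * c) by linarith]
      nlinarith [mul_nonneg hs hc2.le]
    · rw [h3]
      nlinarith
  · rintro ⟨rfl, h1, h2⟩
    refine ⟨⟨-(o / c), ?_, by rw [hit]; module⟩, 1 - cross (q - e) α / c, by linarith, ?_, ?_⟩
    · rw [← neg_div, div_nonneg_iff]
      rcases lt_or_gt_of_ne hc with h | h
      · right
        constructor <;> nlinarith
      · left
        constructor <;> nlinarith
    · have : 0 < cross (q - e) α / c := by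
        rw [show cross (q - e) α / c = (c * cross (q - e) α) / (c * c) by field_simp]
        positivity
      linarith
    · have h3 := cross_expand' hc (e - p)
      rw [← hodef, ← hcdef] at h3
      have h4 : cross (e - p) α / c = 1 - cross (q - e) α / c := by
        rw [show e - p = (q - p) - (q - e) by abel, cross_sub_left, ← hcdef]
        field_simp
      rw [h4] at h3
      rw [hit, ← hodef, ← hcdef, ← sub_eq_iff_eq_add', ← sub_eq_zero]
      rw [show e - (o / c) • α - p = (e - p) - (o / c) • α by abel]
      nth_rewrite 1 [h3]
      abel

/-- Only `0 < t` is assumed, so `e` may be the endpoint `z`, near which segments end before or after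
an arm. If `t < 1`, `eventually_past` removes the last of the three conditions. -/
lemma eventually_hit {p z e α : Plane} {t : ℝ} (h0 : 0 < t) (he : e = p + t • (z - p))
    (hα : cross (z - p) α ≠ 0) {M : Set Plane} (hM : M ∈ 𝓝 e) :
    ∀ᶠ w : Plane × Plane in 𝓝 (p, z), 0 < cross (w.2 - w.1) α * cross (z - p) α ∧
      hit e α w.1 w.2 ∈ M ∧ ∀ x, (OnRay e α x ∧ x ∈ openSeg w.1 w.2) ↔ (x = hit e α w.1 w.2 ∧
        cross (w.2 - w.1) (e - w.1) * cross (w.2 - w.1) α ≤ 0 ∧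
        0 < cross (w.2 - w.1) α * cross (w.2 - e) α) := by
  have hc : Continuous fun w : Plane × Plane => cross (w.2 - w.1) α := by fun_prop
  have ho : Continuous fun w : Plane × Plane => cross (w.2 - w.1) (e - w.1) := by fun_prop
  have hq : Continuous fun w : Plane × Plane => cross (w.2 - e) α := by fun_prop
  have h1 : ∀ᶠ w : Plane × Plane in 𝓝 (p, z), 0 < cross (w.2 - w.1) α * cross (z - p) α :=
    (hc.mul continuous_const).continuousAt.eventually (lt_mem_nhds (mul_self_pos.2 hα))
  have h2 : ∀ᶠ w : Plane × Plane in 𝓝 (p, z), hit e α w.1 w.2 ∈ M := by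
    have : ContinuousAt (fun w : Plane × Plane => hit e α w.1 w.2) (p, z) :=
      continuousAt_const.sub ((ho.continuousAt.div hc.continuousAt hα).smul continuousAt_const)
    refine this.eventually_mem ?_
    convert hM using 2
    have : cross (z - p) (e - p) = 0 := by rw [he]; simp [cross_smul_right]
    simp [hit, this]
  have h3 : ∀ᶠ w : Plane × Plane in 𝓝 (p, z), cross (w.2 - e) α / cross (w.2 - w.1) α < 1 := by
    refine (hq.continuousAt.div hc.continuousAt hα).eventually (gt_mem_nhds ?_)
    show cross (z - e) α / cross (z - p) α < 1
    rw [he, show z - (p + t • (z - p)) = (1 - t) • (z - p) by module, cross_smul_left,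
      mul_div_cancel_right₀ _ hα]
    linarith
  filter_upwards [h1, h2, h3] with w h1 h2 h3
  exact ⟨h1, h2, fun x => onRay_and_mem_openSeg_iff (left_ne_zero_of_mul h1.ne') h3⟩

lemma eventually_past {p z e α : Plane} {t : ℝ} (h1 : t < 1) (he : e = p + t • (z - p))
    (hα : cross (z - p) α ≠ 0) :
    ∀ᶠ w : Plane × Plane in 𝓝 (p, z), 0 < cross (w.2 - w.1) α * cross (w.2 - e) α := by
  have hc : Continuous fun w : Plane × Plane => cross (w.2 - w.1) α * cross (w.2 - e) α := by fun_prop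
  refine hc.continuousAt.eventually (lt_mem_nhds ?_)
  show 0 < cross (z - p) α * cross (z - e) α
  rw [he, show z - (p + t • (z - p)) = (1 - t) • (z - p) by module, cross_smul_left]
  nlinarith [mul_self_pos.2 hα]

/-- Away from its apex, an arm is a line. -/
lemma Trans.of_onRay {F : Set Plane} {e α β x d : Plane} {M : Set Plane} (hM : IsOpen M)
    (hF : ∀ y ∈ M, (y ∈ F ↔ OnRay e α y ∨ OnRay e β y)) (hβ : β ≠ 0) (hx : OnRay e α x)
    (hxM : x ∈ M) (hxe : x ≠ e) (hxβ : ¬ OnRay e β x) (hd : cross d α ≠ 0) : Trans F x d := by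
  obtain ⟨s, hs, rfl⟩ := hx
  have hα : α ≠ 0 := by
    rintro rfl
    simp at hd
  have hs' : 0 < s := hs.lt_of_ne (by rintro rfl; simp at hxe)
  have hpos : 0 < s * ‖α‖ := mul_pos hs' (norm_pos_iff.2 hα)
  have harms : Arms F (e + s • α) α (-α) := by
    refine ⟨hα, neg_ne_zero.2 hα, ?_⟩
    filter_upwards [hM.mem_nhds hxM, (isClosed_onRay e hβ).isOpen_compl.mem_nhds hxβ,
      Metric.ball_mem_nhds _ hpos] with y h1 h2 h3
    rw [hF y h1]
    constructor
    · rintro (⟨u, hu, rfl⟩ | h)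
      · rcases le_total s u with h | h
        · exact Or.inl ⟨u - s, by linarith, by module⟩
        · exact Or.inr ⟨s - u, by linarith, by module⟩
      · exact absurd h h2
    · rintro (⟨u, hu, rfl⟩ | ⟨u, hu, rfl⟩)
      · exact Or.inl ⟨s + u, by linarith, by module⟩
      · rw [Metric.mem_ball, dist_eq_norm, add_sub_cancel_left, norm_smul, norm_neg,
          Real.norm_of_nonneg hu] at h3
        have := (mul_lt_mul_iff_left₀ (norm_pos_iff.2 hα)).1 h3
        exact Or.inl ⟨s - u, by linarith, by module⟩
  rcases lt_or_gt_of_ne hd with h | h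
  · exact ⟨_, _, harms.symm, by rw [cross_neg_right]; linarith, h⟩
  · exact ⟨_, _, harms, h, by rw [cross_neg_right]; linarith⟩

lemma Arms.eventually_radius {F : Set Plane} {e α β : Plane} (h : Arms F e α β) :
    ∀ᶠ r in 𝓝[>] (0 : ℝ), ∀ y ∈ Metric.ball e r, (y ∈ F ↔ OnRay e α y ∨ OnRay e β y) := by
  obtain ⟨ρ, hρ, hball⟩ := Metric.eventually_nhds_iff_ball.1 h.2.2
  filter_upwards [Ioo_mem_nhdsGT hρ] with r hr y hy
  exact hball y (Metric.ball_subset_ball hr.2.le hy)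

/-- A segment close to one that crosses `F` transversally at `y` crosses `F` exactly once near `y`. -/
lemma Trans.eventually_hit {F : Set Plane} {p z y : Plane} (hy : y ∈ openSeg p z)
    (h : Trans F y (z - p)) :
    ∀ᶠ r in 𝓝[>] (0 : ℝ), ∀ᶠ w : Plane × Plane in 𝓝 (p, z), ∃ x,
      F ∩ openSeg w.1 w.2 ∩ Metric.ball y r = {x} ∧ Trans F x (w.2 - w.1) := by
  obtain ⟨t, h0, h1, ht⟩ := hy
  obtain ⟨α, β, harms, hα, hβ⟩ := h
  filter_upwards [harms.eventually_radius, self_mem_nhdsWithin] with r hr hr0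
  have hball := Metric.ball_mem_nhds y (show 0 < r from hr0)
  filter_upwards [KModem.eventually_hit h0 ht hα.ne' hball, KModem.eventually_hit h0 ht hβ.ne hball,
    eventually_past h1 ht hα.ne', eventually_past h1 ht hβ.ne] with w ⟨ha1, ha2, ha3⟩ ⟨hb1, hb2, hb3⟩ ha4 hb4
  have hca : 0 < cross (w.2 - w.1) α := pos_of_mul_pos_left ha1 hα.le
  have hcb : cross (w.2 - w.1) β < 0 := by
    by_contra! h
    nlinarith
  simp only [ha4, and_true, hb4] at ha3 hb3
  have hmem : ∀ x, x ∈ F ∩ openSeg w.1 w.2 ∩ Metric.ball y r ↔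
      ((x = hit y α w.1 w.2 ∧ cross (w.2 - w.1) (y - w.1) ≤ 0) ∨
        (x = hit y β w.1 w.2 ∧ 0 ≤ cross (w.2 - w.1) (y - w.1))) := by
    intro x
    have e1 : cross (w.2 - w.1) (y - w.1) * cross (w.2 - w.1) α ≤ 0 ↔
      cross (w.2 - w.1) (y - w.1) ≤ 0 := ⟨fun h => by by_contra! h'; nlinarith, fun h => by nlinarith⟩
    have e2 : cross (w.2 - w.1) (y - w.1) * cross (w.2 - w.1) β ≤ 0 ↔
      0 ≤ cross (w.2 - w.1) (y - w.1) := ⟨fun h => by by_contra! h'; nlinarith, fun h => by nlinarith⟩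
    rw [e1] at ha3
    rw [e2] at hb3
    rw [← ha3, ← hb3]
    constructor
    · rintro ⟨⟨h1, h2⟩, h3⟩
      rcases (hr x h3).1 h1 with h | h
      · exact Or.inl ⟨h, h2⟩
      · exact Or.inr ⟨h, h2⟩
    · rintro (h | h)
      · have h3 : x ∈ Metric.ball y r := ((ha3 x).1 h).1 ▸ ha2
        exact ⟨⟨(hr x h3).2 (Or.inl h.1), h.2⟩, h3⟩
      · have h3 : x ∈ Metric.ball y r := ((hb3 x).1 h).1 ▸ hb2
        exact ⟨⟨(hr x h3).2 (Or.inr h.1), h.2⟩, h3⟩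
  have hdisj : ∀ x, OnRay y α x → OnRay y β x → x = y := by
    rintro x ⟨s, hs, rfl⟩ ⟨u, hu, h⟩
    have h' : s • α = u • β := add_left_cancel h
    have := congrArg (cross (w.2 - w.1)) h'
    rw [cross_smul_right, cross_smul_right] at this
    have hs0 : s = 0 := by nlinarith [mul_nonneg hs hca.le, mul_nonneg hu (neg_nonneg.2 hcb.le)]
    simp [hs0]
  -- The side of the line on which the apex `y` lies decides which arm is hit; if `y` is on the
  -- line, the crossing is `y` itself.
  rcases lt_trichotomy (cross (w.2 - w.1) (y - w.1)) 0 with ho | ho | ho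
  · refine ⟨hit y α w.1 w.2, ?_, ?_⟩
    · ext x
      rw [hmem, mem_singleton_iff]
      constructor
      · rintro (h | h)
        · exact h.1
        · linarith [h.2]
      · intro h
        exact Or.inl ⟨h, ho.le⟩
    · have hon : OnRay y α (hit y α w.1 w.2) := ((ha3 _).2 ⟨rfl, by nlinarith⟩).1
      have hne : hit y α w.1 w.2 ≠ y := by
        have hα0 : α ≠ 0 := harms.1
        simp [hit, ho.ne, hca.ne', hα0]
      exact Trans.of_onRay Metric.isOpen_ball hr harms.2.1 hon ha2 hne (fun h => hne (hdisj _ hon h))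
        hca.ne'
  · refine ⟨y, ?_, α, β, harms, hca, hcb⟩
    ext x
    rw [hmem, mem_singleton_iff]
    simp [hit, ho]
  · refine ⟨hit y β w.1 w.2, ?_, ?_⟩
    · ext x
      rw [hmem, mem_singleton_iff]
      constructor
      · rintro (h | h)
        · linarith [h.2]
        · exact h.1
      · intro h
        exact Or.inr ⟨h, ho.le⟩
    · have hon : OnRay y β (hit y β w.1 w.2) := ((hb3 _).2 ⟨rfl, by nlinarith⟩).1
      have hne : hit y β w.1 w.2 ≠ y := by
        have hβ0 : β ≠ 0 := harms.2.1
        simp [hit, ho.ne', hcb.ne, hβ0]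
      exact Trans.of_onRay Metric.isOpen_ball (fun v hv => (hr v hv).trans or_comm) harms.1 hon hb2 hne
        (fun h => hne (hdisj _ h hon)) hcb.ne

end Hits

/-! ### Counting the crossings of nearby segments -/

section Count

/-- The points at which a segment close to `p z` meets two arms that start at a point of `p z`. -/
lemma Arms.eventually_mem_iff {F : Set Plane} {p z e α β : Plane} (harms : Arms F e α β) {t : ℝ}
    (h0 : 0 < t) (he : e = p + t • (z - p)) (hα : cross (z - p) α ≠ 0) (hβ : cross (z - p) β ≠ 0) :
    ∀ᶠ r in 𝓝[>] (0 : ℝ), ∀ᶠ w : Plane × Plane in 𝓝 (p, z),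
      0 < cross (w.2 - w.1) α * cross (z - p) α ∧ 0 < cross (w.2 - w.1) β * cross (z - p) β ∧
      hit e α w.1 w.2 ∈ Metric.ball e r ∧ hit e β w.1 w.2 ∈ Metric.ball e r ∧
      ∀ x, x ∈ F ∩ openSeg w.1 w.2 ∩ Metric.ball e r ↔
        ((x = hit e α w.1 w.2 ∧ cross (w.2 - w.1) (e - w.1) * cross (w.2 - w.1) α ≤ 0 ∧
          0 < cross (w.2 - w.1) α * cross (w.2 - e) α) ∨
        (x = hit e β w.1 w.2 ∧ cross (w.2 - w.1) (e - w.1) * cross (w.2 - w.1) β ≤ 0 ∧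
          0 < cross (w.2 - w.1) β * cross (w.2 - e) β)) := by
  filter_upwards [harms.eventually_radius, self_mem_nhdsWithin] with r hr hr0
  have hball := Metric.ball_mem_nhds e (show 0 < r from hr0)
  filter_upwards [eventually_hit h0 he hα hball, eventually_hit h0 he hβ hball] with w
    ⟨ha1, ha2, ha3⟩ ⟨hb1, hb2, hb3⟩
  refine ⟨ha1, hb1, ha2, hb2, fun x => ?_⟩
  rw [← ha3, ← hb3]
  constructor
  · rintro ⟨⟨h1, h2⟩, h3⟩
    rcases (hr x h3).1 h1 with h | h
    · exact Or.inl ⟨h, h2⟩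
    · exact Or.inr ⟨h, h2⟩
  · rintro (h | h)
    · have h3 : x ∈ Metric.ball e r := ((ha3 x).1 h).1 ▸ ha2
      exact ⟨⟨(hr x h3).2 (Or.inl h.1), h.2⟩, h3⟩
    · have h3 : x ∈ Metric.ball e r := ((hb3 x).1 h).1 ▸ hb2
      exact ⟨⟨(hr x h3).2 (Or.inr h.1), h.2⟩, h3⟩

lemma hit_sub (e α p q : Plane) :
    hit e α p q - e = -(cross (q - p) (e - p) / cross (q - p) α) • α := by
  rw [hit]
  module

/-- A point near `e` at which a segment meets one of two arms, but not their apex, is a transversal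
crossing. -/
lemma Arms.eventually_trans {F : Set Plane} {p z e α β : Plane} (harms : Arms F e α β)
    (hα : cross (z - p) α ≠ 0) (hβ : cross (z - p) β ≠ 0) (hαβ : cross α β ≠ 0) :
    ∀ᶠ r in 𝓝[>] (0 : ℝ), ∀ᶠ w : Plane × Plane in 𝓝 (p, z),
      ∀ x ∈ F ∩ openSeg w.1 w.2 ∩ Metric.ball e r, x ≠ e → Trans F x (w.2 - w.1) := by
  have hc : ∀ γ, cross (z - p) γ ≠ 0 → ∀ᶠ w : Plane × Plane in 𝓝 (p, z), cross (w.2 - w.1) γ ≠ 0 := by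
    intro γ hγ
    have : Continuous fun w : Plane × Plane => cross (w.2 - w.1) γ := by fun_prop
    exact this.continuousAt.eventually_ne hγ
  filter_upwards [harms.eventually_radius] with r hr
  filter_upwards [hc α hα, hc β hβ] with w hcα hcβ
  rintro x ⟨⟨hxF, -⟩, hxb⟩ hxe
  have hdisj : ∀ x, OnRay e α x → OnRay e β x → x = e := by
    rintro x ⟨s, hs, rfl⟩ ⟨u, hu, h⟩
    have := congrArg (fun v => cross v β) (add_left_cancel h : s • α = u • β)
    simp only [cross_smul_left, cross_self, mul_zero] at this
    have hs0 : s = 0 := (mul_eq_zero.1 this).resolve_right hαβ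
    simp [hs0]
  rcases (hr x hxb).1 hxF with h | h
  · exact Trans.of_onRay Metric.isOpen_ball hr harms.2.1 h hxb hxe (fun h' => hxe (hdisj x h h')) hcα
  · exact Trans.of_onRay Metric.isOpen_ball (fun v hv => (hr v hv).trans or_comm) harms.1 h hxb hxe
      (fun h' => hxe (hdisj x h' h)) hcβ

/-- The crossings near a point at which a segment touches `F` tangentially. -/
lemma Tang.eventually_hit {F : Set Plane} {p z y : Plane} (hy : y ∈ openSeg p z)
    (h : Tang F y (z - p)) : ∃ κ : ℝ, κ ≠ 0 ∧
    ∀ᶠ r in 𝓝[>] (0 : ℝ), ∀ᶠ w : Plane × Plane in 𝓝 (p, z),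
      (0 < κ * cross (w.2 - w.1) (y - w.1) → F ∩ openSeg w.1 w.2 ∩ Metric.ball y r = ∅) ∧
      (cross (w.2 - w.1) (y - w.1) = 0 → F ∩ openSeg w.1 w.2 ∩ Metric.ball y r = {y} ∧
        Tang F y (w.2 - w.1)) ∧
      (κ * cross (w.2 - w.1) (y - w.1) < 0 → (F ∩ openSeg w.1 w.2 ∩ Metric.ball y r).encard = 2 ∧
        ∀ x ∈ F ∩ openSeg w.1 w.2 ∩ Metric.ball y r, Trans F x (w.2 - w.1)) := by
  obtain ⟨t, h0, h1, ht⟩ := hy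
  obtain ⟨α, β, harms, hpos, hαβ⟩ := h
  have hα := left_ne_zero_of_mul hpos.ne'
  have hβ := right_ne_zero_of_mul hpos.ne'
  -- Both arms point to the side given by the sign of `κ`. If the apex already lies on that side of
  -- the moved segment, the arms lead away from it; if it lies on the other side, both arms are
  -- crossed.
  refine ⟨cross (z - p) α, hα, ?_⟩
  filter_upwards [harms.eventually_mem_iff h0 ht hα hβ, harms.eventually_trans hα hβ hαβ] with r h2 h3
  filter_upwards [h2, h3, eventually_past h1 ht hα, eventually_past h1 ht hβ] with w h2 h3 h4 h5
  obtain ⟨ha, hb, -, -, hmem⟩ := h2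
  simp only [h4, h5, and_true] at hmem
  set κ := cross (z - p) α
  set κ' := cross (z - p) β
  set o := cross (w.2 - w.1) (y - w.1) with hodef
  set c := cross (w.2 - w.1) α with hcdef
  set c' := cross (w.2 - w.1) β with hcdef'
  have hc0 : c ≠ 0 := left_ne_zero_of_mul ha.ne'
  have hc0' : c' ≠ 0 := left_ne_zero_of_mul hb.ne'
  have hcc : 0 < c * c' := by
    have : 0 < (c * c') * (κ * κ') := by nlinarith [mul_pos ha hb]
    exact pos_of_mul_pos_left this hpos.le
  have hck' : 0 < c' * κ := by
    have : 0 < (c' * κ) * (c * c) := by nlinarith [mul_pos ha hcc]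
    exact pos_of_mul_pos_left this (mul_self_nonneg c)
  have hsgn : ∀ e : ℝ, 0 < e * κ → (0 < κ * o → 0 < o * e) ∧ (κ * o < 0 → o * e < 0) := by
    intro e he
    constructor
    · intro h
      have : 0 < (o * e) * (κ * κ) := by nlinarith [mul_pos h he]
      exact pos_of_mul_pos_left this (mul_self_nonneg κ)
    · intro h
      have : 0 < (-(o * e)) * (κ * κ) := by nlinarith [mul_pos (neg_pos.2 h) he]
      have := pos_of_mul_pos_left this (mul_self_nonneg κ)
      linarith
  refine ⟨fun ho => ?_, fun ho => ?_, fun ho => ?_⟩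
  · ext x
    rw [hmem]
    have e1 := (hsgn c ha).1 ho
    have e2 := (hsgn c' hck').1 ho
    simp [not_le.2 e1, not_le.2 e2]
  · refine ⟨?_, α, β, harms, hcc, hαβ⟩
    ext x
    rw [hmem, mem_singleton_iff]
    simp [hit, ← hodef, ho]
  · have e1 := ((hsgn c ha).2 ho)
    have e2 := ((hsgn c' hck').2 ho)
    have ho0 : o ≠ 0 := left_ne_zero_of_mul e1.ne
    have hne : ∀ γ, γ ≠ 0 → cross (w.2 - w.1) γ ≠ 0 → hit y γ w.1 w.2 ≠ y := by
      intro γ hγ hcγ h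
      have := hit_sub y γ w.1 w.2
      rw [h, sub_self] at this
      simp [hγ, hcγ, ← hodef, ho0] at this
    have hset : F ∩ openSeg w.1 w.2 ∩ Metric.ball y r = {hit y α w.1 w.2, hit y β w.1 w.2} := by
      ext x
      rw [hmem]
      simp [e1.le, e2.le]
    constructor
    · rw [hset, encard_pair]
      intro h
      have g1 := hit_sub y α w.1 w.2
      rw [h, hit_sub y β w.1 w.2] at g1
      have g2 := congrArg (fun v => cross v β) g1
      simp only [cross_smul_left, cross_self, mul_zero, ← hodef, ← hcdef] at g2
      have : -(o / c) * cross α β ≠ 0 :=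
        mul_ne_zero (neg_ne_zero.2 (div_ne_zero ho0 hc0)) hαβ
      exact this g2.symm
    · intro x hx
      refine h3 x hx ?_
      rw [hset] at hx
      rcases hx with rfl | hx
      · exact hne α harms.1 hc0
      · rw [mem_singleton_iff] at hx
        rw [hx]
        exact hne β harms.2.1 hc0'

/-- A segment close to `p z` meets `F` only near the points at which `p z` does. -/
lemma eventually_near {F : Set Plane} (hF : IsClosed F) {p z : Plane} {T : Set Plane}
    (hT : ∀ y ∈ F, y ∈ segment ℝ p z → y ∈ T) {r : ℝ} (hr : 0 < r) :
    ∀ᶠ w : Plane × Plane in 𝓝 (p, z), ∀ x ∈ F ∩ openSeg w.1 w.2, ∃ y ∈ T, x ∈ Metric.ball y r := by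
  have key : ∀ᶠ w : Plane × Plane in 𝓝 (p, z), ∀ t ∈ Icc (0 : ℝ) 1,
      w.1 + t • (w.2 - w.1) ∈ F → ∃ y ∈ T, w.1 + t • (w.2 - w.1) ∈ Metric.ball y r := by
    refine isCompact_Icc.eventually_forall_of_forall_eventually fun t ht => ?_
    have hc : Continuous fun a : (Plane × Plane) × ℝ => a.1.1 + a.2 • (a.1.2 - a.1.1) := by fun_prop
    by_cases h : p + t • (z - p) ∈ F
    · have hy := hT _ h (mem_segment_iff.2 ⟨t, ht.1, ht.2, rfl⟩)
      filter_upwards [hc.continuousAt.eventually_mem (x := ((p, z), t)) (Metric.ball_mem_nhds _ hr)]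
        with a ha _
      exact ⟨_, hy, ha⟩
    · filter_upwards [hc.continuousAt.eventually_mem (x := ((p, z), t)) (hF.isOpen_compl.mem_nhds h)]
        with a ha ha'
      exact absurd ha' ha
  filter_upwards [key] with w hw
  rintro x ⟨hx, t, h0, h1, rfl⟩
  exact hw t ⟨h0.le, h1.le⟩ hx

/-- The radius is always quantified by `∀ᶠ r` outside `∀ᶠ w`, so finitely many local counts hold for
one common radius; with disjoint balls they add up. -/
lemma eventually_disjoint_balls (T : Finset Plane) :
    ∀ᶠ r in 𝓝[>] (0 : ℝ), ∀ x ∈ T, ∀ y ∈ T, x ≠ y → Disjoint (Metric.ball x r) (Metric.ball y r) := by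
  rw [Filter.eventually_all_finset]
  intro x _
  rw [Filter.eventually_all_finset]
  intro y _
  rw [Filter.eventually_imp_distrib_left]
  intro hne
  filter_upwards [Ioo_mem_nhdsGT (half_pos (dist_pos.2 hne))] with r hr
  exact Metric.ball_disjoint_ball (by linarith [hr.2])

/-- A segment close to one with transversal crossings has as many transversal crossings. -/
lemma eventually_exists_crossings {F : Set Plane} {p z : Plane} (S : Finset Plane)
    (hS : ∀ y ∈ S, y ∈ openSeg p z ∧ Trans F y (z - p)) :
    ∀ᶠ r in 𝓝[>] (0 : ℝ), ∀ᶠ w : Plane × Plane in 𝓝 (p, z),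
      (F ∩ openSeg w.1 w.2 ∩ ⋃ y ∈ S, Metric.ball y r).encard = S.card ∧
      ∀ x ∈ F ∩ openSeg w.1 w.2 ∩ ⋃ y ∈ S, Metric.ball y r, Trans F x (w.2 - w.1) := by
  have h1 : ∀ᶠ r in 𝓝[>] (0 : ℝ), ∀ y ∈ S, ∀ᶠ w : Plane × Plane in 𝓝 (p, z), ∃ x,
      F ∩ openSeg w.1 w.2 ∩ Metric.ball y r = {x} ∧ Trans F x (w.2 - w.1) := by
    rw [Filter.eventually_all_finset]
    exact fun y hy => (hS y hy).2.eventually_hit (hS y hy).1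
  filter_upwards [h1, eventually_disjoint_balls S] with r h1 hdisj
  have h2 : ∀ᶠ w : Plane × Plane in 𝓝 (p, z), ∀ y ∈ S, ∃ x,
      F ∩ openSeg w.1 w.2 ∩ Metric.ball y r = {x} ∧ Trans F x (w.2 - w.1) := by
    rw [Filter.eventually_all_finset]
    exact h1
  filter_upwards [h2] with w h2
  have h2' : ∀ y, ∃ x, y ∈ S → F ∩ openSeg w.1 w.2 ∩ Metric.ball y r = {x} ∧ Trans F x (w.2 - w.1) := by
    intro y
    by_cases hy : y ∈ S
    · obtain ⟨x, hx⟩ := h2 y hy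
      exact ⟨x, fun _ => hx⟩
    · exact ⟨0, fun h => absurd h hy⟩
  choose f hf using h2'
  have hfb : ∀ y ∈ S, f y ∈ F ∩ openSeg w.1 w.2 ∩ Metric.ball y r := fun y hy => by
    rw [(hf y hy).1]
    rfl
  have himg : F ∩ openSeg w.1 w.2 ∩ ⋃ y ∈ S, Metric.ball y r = f '' (S : Set Plane) := by
    ext x
    simp only [mem_inter_iff, mem_iUnion, exists_prop, mem_image, SetLike.mem_coe]
    constructor
    · rintro ⟨h3, y, hy, hxy⟩
      refine ⟨y, hy, ?_⟩
      have : x ∈ F ∩ openSeg w.1 w.2 ∩ Metric.ball y r := ⟨h3, hxy⟩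
      rw [(hf y hy).1] at this
      exact (mem_singleton_iff.1 this).symm
    · rintro ⟨y, hy, rfl⟩
      exact ⟨(hfb y hy).1, y, hy, (hfb y hy).2⟩
  rw [himg]
  constructor
  · rw [InjOn.encard_image, encard_coe_eq_coe_finsetCard]
    intro x hx y hy hxy
    by_contra hne
    have h3 := (hfb y hy).2
    rw [← hxy] at h3
    exact Set.disjoint_left.1 (hdisj x hx y hy hne) (hfb x hx).2 h3
  · rintro _ ⟨y, hy, rfl⟩
    exact (hf y hy).2

/-- The crossings of a segment close to `p z`, if all crossings of `p z` are transversal, except at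
finitely many exceptional points. -/
lemma eventually_count {F : Set Plane} (hF : IsClosed F) {p z : Plane} (S E : Finset Plane)
    (hS : ∀ y ∈ S, y ∈ openSeg p z ∧ Trans F y (z - p)) (hSE : ∀ y ∈ S, y ∉ E)
    (hT : ∀ y ∈ F, y ∈ segment ℝ p z → y ∈ S ∨ y ∈ E) :
    ∀ᶠ r in 𝓝[>] (0 : ℝ), ∀ᶠ w : Plane × Plane in 𝓝 (p, z),
      (F ∩ openSeg w.1 w.2).encard =
        S.card + (F ∩ openSeg w.1 w.2 ∩ ⋃ y ∈ E, Metric.ball y r).encard ∧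
      ∀ x ∈ F ∩ openSeg w.1 w.2, (∀ y ∈ E, x ∉ Metric.ball y r) → Trans F x (w.2 - w.1) := by
  classical
  filter_upwards [eventually_exists_crossings S hS, eventually_disjoint_balls (S ∪ E),
    self_mem_nhdsWithin] with r h1 hdisj hr
  filter_upwards [h1, eventually_near hF (T := {y | y ∈ S ∨ y ∈ E}) hT hr] with w h1 h2
  have hun : F ∩ openSeg w.1 w.2 = (F ∩ openSeg w.1 w.2 ∩ ⋃ y ∈ S, Metric.ball y r) ∪
      (F ∩ openSeg w.1 w.2 ∩ ⋃ y ∈ E, Metric.ball y r) := by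
    rw [← inter_union_distrib_left, eq_comm, inter_eq_left]
    intro x hx
    obtain ⟨y, hy | hy, hxy⟩ := h2 x hx
    · exact Or.inl (mem_biUnion (show y ∈ (S : Set Plane) from hy) hxy)
    · exact Or.inr (mem_biUnion (show y ∈ (E : Set Plane) from hy) hxy)
  have hd : Disjoint (F ∩ openSeg w.1 w.2 ∩ ⋃ y ∈ S, Metric.ball y r)
      (F ∩ openSeg w.1 w.2 ∩ ⋃ y ∈ E, Metric.ball y r) := by
    rw [Set.disjoint_left]
    rintro x ⟨-, hx⟩ ⟨-, hx'⟩
    simp only [mem_iUnion, exists_prop] at hx hx'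
    obtain ⟨y, hy, hxy⟩ := hx
    obtain ⟨y', hy', hxy'⟩ := hx'
    refine Set.disjoint_left.1 (hdisj y (Finset.mem_union_left _ hy) y'
      (Finset.mem_union_right _ hy') ?_) hxy hxy'
    rintro rfl
    exact hSE y hy hy'
  constructor
  · rw [← h1.1, ← encard_union_eq hd, ← hun]
  · intro x hx hxE
    rw [hun] at hx
    rcases hx with hx | hx
    · exact h1.2 x hx
    · obtain ⟨-, hx⟩ := hx
      simp only [mem_iUnion, exists_prop] at hx
      obtain ⟨y, hy, hxy⟩ := hx
      exact absurd hxy (hxE y hy)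

/-- If `p` lies on no arm at `z`, then segments from points near `p` to `z` meet no arm near `z`. -/
lemma Arms.eventually_end {F : Set Plane} {p z α β : Plane} (harms : Arms F z α β)
    (hα : ¬ OnRay z α p) (hβ : ¬ OnRay z β p) :
    ∀ᶠ r in 𝓝[>] (0 : ℝ), ∀ᶠ p' in 𝓝 p, F ∩ openSeg p' z ∩ Metric.ball z r = ∅ := by
  filter_upwards [harms.eventually_radius] with r hr
  filter_upwards [(isClosed_onRay z harms.1).isOpen_compl.mem_nhds hα,
    (isClosed_onRay z harms.2.1).isOpen_compl.mem_nhds hβ] with p' h1 h2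
  rw [eq_empty_iff_forall_notMem]
  rintro x ⟨⟨hxF, t, h0, h1', rfl⟩, hxb⟩
  -- A ray from `z` that contains a point of the open segment from `p'` to `z` contains `p'`.
  have key : ∀ γ, OnRay z γ (p' + t • (z - p')) → OnRay z γ p' := by
    rintro γ ⟨s, hs, h⟩
    have h1t : (1 - t) ≠ 0 := by linarith
    refine ⟨(1 - t)⁻¹ * s, mul_nonneg (inv_nonneg.2 (by linarith)) hs, ?_⟩
    have : (1 - t) • (p' - z) = s • γ := by
      rw [show s • γ = z + s • γ - z by abel, ← h]
      module
    rw [mul_smul, ← this, smul_smul, inv_mul_cancel₀ h1t, one_smul]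
    abel
  rcases (hr _ hxb).1 hxF with h | h
  · exact h1 (key _ h)
  · exact h2 (key _ h)

end Count

/-! ### The polygon near a boundary point -/

section Sectors

variable {n : ℕ} {poly : Polygon Plane n}

lemma tendsto_add_smul (q v : Plane) : Tendsto (fun ε : ℝ => q + ε • v) (𝓝[>] 0) (𝓝 q) := by
  have hc : Continuous fun ε : ℝ => q + ε • v := by fun_prop
  have := hc.tendsto 0
  simp only [zero_smul, add_zero] at this
  exact this.mono_left nhdsWithin_le_nhds

lemma eventually_inside_iff (hP : IsSimple poly) {q : Plane} (hq : q ∉ poly.boundary ℝ) :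
    ∀ᶠ x in 𝓝 q, x ∉ poly.boundary ℝ ∧ (x ∈ inside poly ↔ q ∈ inside poly) := by
  by_cases h : q ∈ inside poly
  · filter_upwards [(isClosed_boundary poly).isOpen_compl.mem_nhds hq,
      (isOpen_inside hP).mem_nhds h] with x h1 h2
    exact ⟨h1, iff_of_true h2 h⟩
  · filter_upwards [(isOpen_compl_region hP).mem_nhds (notMem_region.2 ⟨hq, h⟩)] with x h1
    exact ⟨(notMem_region.1 h1).1, iff_of_false (notMem_region.1 h1).2 h⟩

/-- A segment that crosses the boundary transversally, up to one tangency, has its endpoints on the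
same side of the boundary if and only if the number of crossings is even. -/
lemma inside_iff_inside_iff_even_card (hP : IsSimple poly) {p q : Plane}
    (hp : p ∉ poly.boundary ℝ) (hq : q ∉ poly.boundary ℝ) (hpq : p ≠ q) (S R : Finset Plane)
    (hS : ∀ y ∈ S, y ∈ openSeg p q ∧ Trans (poly.boundary ℝ) y (q - p))
    (hR : ∀ y ∈ R, y ∈ openSeg p q ∧ Tang (poly.boundary ℝ) y (q - p))
    (hR1 : (R : Set Plane).Subsingleton) (hSR : ∀ y ∈ S, y ∉ R)
    (hT : ∀ y ∈ poly.boundary ℝ, y ∈ openSeg p q → y ∈ S ∨ y ∈ R) :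
    (p ∈ inside poly ↔ q ∈ inside poly) ↔ Even S.card := by
  have hd : q - p ≠ 0 := sub_ne_zero.2 hpq.symm
  obtain ⟨m, hm⟩ := exists_cross_pos hd
  have hT' : ∀ y ∈ poly.boundary ℝ, y ∈ segment ℝ p q → y ∈ S ∨ y ∈ R := by
    intro y hy hys
    refine hT y hy ?_
    rw [← segment_sdiff hpq]
    refine ⟨hys, ?_⟩
    rintro (rfl | h)
    · exact hp hy
    · rw [mem_singleton_iff] at h
      exact hq (h ▸ hy)
  -- Move the endpoint `q` to the side on which the tangency disappears, so that only the
  -- transversal crossings in `S` survive. `v` is not parallel to the segment, which gives general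
  -- position in `hgen`.
  have hclear : ∃ v : Plane, cross (q - p) v ≠ 0 ∧ ∀ᶠ r in 𝓝[>] (0 : ℝ), ∀ᶠ ε in 𝓝[>] (0 : ℝ),
      poly.boundary ℝ ∩ openSeg p (q + ε • v) ∩ ⋃ y ∈ R, Metric.ball y r = ∅ := by
    rcases R.eq_empty_or_nonempty with rfl | ⟨w, hw⟩
    · exact ⟨m, hm.ne', by simp⟩
    · have hRw : R = {w} := by
        ext y
        rw [Finset.mem_singleton]
        exact ⟨fun hy => hR1 hy hw, fun h => h ▸ hw⟩
      obtain ⟨⟨t, h0, h1, ht⟩, htang⟩ := hR w hw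
      obtain ⟨κ, hκ, hev⟩ := htang.eventually_hit (hR w hw).1
      refine ⟨-κ • m, ?_, ?_⟩
      · rw [cross_smul_right]
        exact mul_ne_zero (neg_ne_zero.2 hκ) hm.ne'
      · filter_upwards [hev] with r hr
        have htend : Tendsto (fun ε : ℝ => (p, q + ε • (-κ • m))) (𝓝[>] 0) (𝓝 (p, q)) :=
          tendsto_const_nhds.prodMk_nhds (tendsto_add_smul _ _)
        filter_upwards [htend.eventually hr, self_mem_nhdsWithin] with ε hε hpos
        have hpos : 0 < ε := hpos
        simp only [hRw, Finset.mem_singleton, iUnion_iUnion_eq_left]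
        refine hε.1 ?_
        have : cross (q + ε • (-κ • m) - p) (w - p) = t * (ε * (κ * cross (q - p) m)) := by
          rw [ht, add_sub_cancel_left, cross_smul_right, show q + ε • (-κ • m) - p =
            (q - p) + (-(ε * κ)) • m by module, cross_add_left, cross_self, cross_smul_left,
            cross_swap m]
          ring
        show 0 < κ * cross (q + ε • (-κ • m) - p) (w - p)
        rw [this]
        have : 0 < t * (ε * ((κ * κ) * cross (q - p) m)) :=
          mul_pos h0 (mul_pos hpos (mul_pos (mul_self_pos.2 hκ) hm))
        linarith
  obtain ⟨v, hv, hclear⟩ := hclear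
  obtain ⟨r, hr1, hr2⟩ := (hclear.and (eventually_count (isClosed_boundary poly) S R hS hSR hT')).exists
  have htend : Tendsto (fun ε : ℝ => (p, q + ε • v)) (𝓝[>] 0) (𝓝 (p, q)) :=
    tendsto_const_nhds.prodMk_nhds (tendsto_add_smul _ _)
  -- A vertex on the line through `p` and `q` leaves it as soon as the line turns about `p`; it
  -- cannot be `p`, which is off the boundary.
  have hgen : ∀ᶠ ε in 𝓝[>] (0 : ℝ), ∀ i, cross (q + ε • v - p) (poly i - p) ≠ 0 := by
    rw [Filter.eventually_all]
    intro i
    have := eventually_linear_ne (A := cross (q - p) (poly i - p)) (B := cross v (poly i - p)) ?_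
    · filter_upwards [this] with ε h
      rwa [show q + ε • v - p = (q - p) + ε • v by abel, cross_add_left, cross_smul_left]
    · by_contra! h
      obtain ⟨c, hc⟩ := exists_smul_of_cross_eq_zero hd h.1
      have h2 := h.2
      rw [hc, cross_smul_right, cross_swap, mul_neg, neg_eq_zero, mul_eq_zero,
        or_iff_left hv] at h2
      rw [h2, zero_smul, sub_eq_zero] at hc
      exact hp (hc ▸ vertex_mem_boundary i)
  obtain ⟨ε, h1, h2, h3, h4⟩ := (hr1.and ((htend.eventually hr2).and (hgen.and
    ((tendsto_add_smul q v).eventually (eventually_inside_iff hP hq))))).exists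
  rw [← h4.2, inside_iff_inside_iff_even hP hp h4.1 h3]
  have h2 := h2.1
  simp only [h1, encard_empty, add_zero] at h2
  rw [Set.ncard, h2]
  simp

lemma not_inside_iff_inside_of_trans (hP : IsSimple poly) {p q y : Plane}
    (hp : p ∉ poly.boundary ℝ) (hq : q ∉ poly.boundary ℝ) (hpq : p ≠ q)
    (hy : y ∈ openSeg p q) (hT : Trans (poly.boundary ℝ) y (q - p))
    (h : ∀ x ∈ poly.boundary ℝ, x ∈ openSeg p q → x = y) :
    ¬ (p ∈ inside poly ↔ q ∈ inside poly) := by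
  rw [inside_iff_inside_iff_even_card hP hp hq hpq {y} ∅ (by simpa using ⟨hy, hT⟩) (by simp)
    (by simp) (by simp) (by simpa using h)]
  simp

/-- The common part of the straight case and the corner case: the boundary cuts `B` into two
connected pieces on different sides, so the enclosed part of `B` is exactly one of them. The other
piece accumulates at `z`, which is therefore not interior. -/
lemma sector_of_parts (hP : IsSimple poly) {B S₁ S₂ : Set Plane} {z p₁ p₂ : Plane} (hz : z ∈ B)
    (hzb : z ∈ poly.boundary ℝ) (hB : ∀ x ∈ B, x ∈ poly.boundary ℝ ∨ x ∈ S₁ ∨ x ∈ S₂)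
    (h₁ : ∀ x ∈ S₁, x ∈ B ∧ x ∉ poly.boundary ℝ) (h₂ : ∀ x ∈ S₂, x ∈ B ∧ x ∉ poly.boundary ℝ)
    (hc₁ : IsPreconnected S₁) (hc₂ : IsPreconnected S₂) (hp₁ : p₁ ∈ S₁) (hp₂ : p₂ ∈ S₂)
    (hne : ¬ (p₁ ∈ inside poly ↔ p₂ ∈ inside poly))
    (hcl₁ : B ∩ poly.boundary ℝ ⊆ closure S₁) (hcl₂ : B ∩ poly.boundary ℝ ⊆ closure S₂) :
    (B ∩ inside poly = S₁ ∨ B ∩ inside poly = S₂) ∧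
    IsPreconnected (B ∩ inside poly) ∧ (B ∩ inside poly).Nonempty ∧
      B ∩ region poly ⊆ closure (B ∩ inside poly) ∧ z ∉ interior (region poly) := by
  have key : ∀ S₁ S₂ : Set Plane, ∀ p₁ p₂ : Plane,
      (∀ x ∈ B, x ∈ poly.boundary ℝ ∨ x ∈ S₁ ∨ x ∈ S₂) →
      (∀ x ∈ S₁, x ∈ B ∧ x ∉ poly.boundary ℝ) → (∀ x ∈ S₂, x ∈ B ∧ x ∉ poly.boundary ℝ) →
      IsPreconnected S₁ → IsPreconnected S₂ → p₁ ∈ S₁ → p₂ ∈ S₂ → p₁ ∈ inside poly →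
      p₂ ∉ inside poly → B ∩ poly.boundary ℝ ⊆ closure S₁ → B ∩ poly.boundary ℝ ⊆ closure S₂ →
      B ∩ inside poly = S₁ ∧
    IsPreconnected (B ∩ inside poly) ∧ (B ∩ inside poly).Nonempty ∧
      B ∩ region poly ⊆ closure (B ∩ inside poly) ∧ z ∉ interior (region poly) := by
    intro S₁ S₂ p₁ p₂ hB h₁ h₂ hc₁ hc₂ hp₁ hp₂ hin₁ hin₂ hcl₁ hcl₂
    have hS₁ : ∀ x ∈ S₁, x ∈ inside poly := fun x hx =>
      (inside_iff_of_isPreconnected hP hc₁ (fun y hy => (h₁ y hy).2) hp₁ hx).1 hin₁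
    have hS₂ : ∀ x ∈ S₂, x ∉ inside poly := fun x hx h => hin₂
      ((inside_iff_of_isPreconnected hP hc₂ (fun y hy => (h₂ y hy).2) hp₂ hx).2 h)
    have heq : B ∩ inside poly = S₁ := by
      ext x
      constructor
      · rintro ⟨hxB, hx⟩
        rcases hB x hxB with h | h | h
        · exact absurd h hx.1
        · exact h
        · exact absurd hx (hS₂ x h)
      · intro hx
        exact ⟨(h₁ x hx).1, hS₁ x hx⟩
    rw [heq]
    refine ⟨rfl, hc₁, ⟨p₁, hp₁⟩, ?_, ?_⟩
    · rintro x ⟨hxB, hx | hx⟩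
      · exact hcl₁ ⟨hxB, hx⟩
      · exact subset_closure (heq ▸ ⟨hxB, hx⟩)
    · intro h
      obtain ⟨y, hy1, hy2⟩ := mem_closure_iff.1 (hcl₂ ⟨hz, hzb⟩) _ isOpen_interior h
      rcases interior_subset hy1 with h | h
      · exact (h₂ y hy2).2 h
      · exact hS₂ y hy2 h
  by_cases hin : p₁ ∈ inside poly
  · obtain ⟨h1, h⟩ := key S₁ S₂ p₁ p₂ hB h₁ h₂ hc₁ hc₂ hp₁ hp₂ hin (fun h => hne (iff_of_true hin h)) hcl₁ hcl₂
    exact ⟨Or.inl h1, h⟩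
  · obtain ⟨h1, h⟩ := key S₂ S₁ p₂ p₁ (fun x hx => (hB x hx).imp_right Or.symm) h₂ h₁ hc₂ hc₁ hp₂ hp₁
      (by by_contra h; exact hne (iff_of_false hin h)) hin hcl₂ hcl₁
    exact ⟨Or.inr h1, h⟩

lemma mem_closure_of_eventually {S : Set Plane} {x v : Plane}
    (h : ∀ᶠ ε in 𝓝[>] (0 : ℝ), x + ε • v ∈ S) : x ∈ closure S :=
  mem_closure_of_tendsto (tendsto_add_smul x v) h

/-- Near a point at which the boundary is straight, the polygon is a half-disk. -/
lemma sector_of_straight (hP : IsSimple poly) {z α : Plane} {c : ℝ} (hc : 0 < c)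
    (harms : Arms (poly.boundary ℝ) z α (-(c • α))) : ∃ σ : ℝ, σ ≠ 0 ∧ ∀ᶠ r in 𝓝[>] (0 : ℝ),
      (∀ x ∈ Metric.ball z r, (x ∈ inside poly ↔ 0 < σ * cross (x - z) α) ∧
        (x ∈ poly.boundary ℝ ↔ cross (x - z) α = 0)) ∧
      IsPreconnected (Metric.ball z r ∩ inside poly) ∧ (Metric.ball z r ∩ inside poly).Nonempty ∧
      Metric.ball z r ∩ region poly ⊆ closure (Metric.ball z r ∩ inside poly) ∧
      z ∉ interior (region poly) := by
  have hb : ∀ᶠ r in 𝓝[>] (0 : ℝ), ∀ x ∈ Metric.ball z r,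
      (x ∈ poly.boundary ℝ ↔ cross (x - z) α = 0) := by
    filter_upwards [harms.eventually_radius] with r hr x hx
    rw [hr x hx]
    constructor
    · rintro (h | ⟨s, hs, rfl⟩)
      · exact h.cross_eq_zero
      · rw [add_sub_cancel_left, cross_smul_left, cross_neg_left, cross_smul_left]
        simp
    · intro h
      obtain ⟨s, hs⟩ := exists_smul_of_cross_eq_zero harms.1 (by rw [cross_swap, h, neg_zero] :
        cross α (x - z) = 0)
      rcases le_total 0 s with h0 | h0
      · exact Or.inl ⟨s, h0, by rw [← hs]; abel⟩
      · refine Or.inr ⟨-s / c, div_nonneg (by linarith) hc.le, ?_⟩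
        rw [smul_neg, smul_smul, show -s / c * c = -s by field_simp, neg_smul, neg_neg, ← hs]
        abel
  obtain ⟨v, hv⟩ : ∃ v, 0 < cross v α := by
    obtain ⟨v, hv⟩ := exists_cross_pos harms.1
    exact ⟨-v, by rwa [cross_neg_left, cross_swap v, neg_neg]⟩
  have hvpos : ∀ ε : ℝ, 0 < ε → 0 < cross (z + ε • v - z) α := by
    intro ε hε
    rw [add_sub_cancel_left, cross_smul_left]
    positivity
  have hvneg : ∀ ε : ℝ, 0 < ε → cross (z + ε • (-v) - z) α < 0 := by
    intro ε hε
    rw [add_sub_cancel_left, cross_smul_left, cross_neg_left]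
    nlinarith
  have key : ∀ᶠ r in 𝓝[>] (0 : ℝ),
      (Metric.ball z r ∩ inside poly = Metric.ball z r ∩ {x | 0 < cross (x - z) α} ∨
      Metric.ball z r ∩ inside poly = Metric.ball z r ∩ {x | cross (x - z) α < 0}) ∧
      IsPreconnected (Metric.ball z r ∩ inside poly) ∧ (Metric.ball z r ∩ inside poly).Nonempty ∧
      Metric.ball z r ∩ region poly ⊆ closure (Metric.ball z r ∩ inside poly) ∧
      z ∉ interior (region poly) := by
    filter_upwards [hb, self_mem_nhdsWithin] with r hb hr0
    have hr0 : 0 < r := hr0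
    have hlin : IsLinearMap ℝ fun x : Plane => cross x α :=
      ⟨fun x y => cross_add_left x y α, fun c x => cross_smul_left c x α⟩
    have hconv1 : Convex ℝ {x : Plane | 0 < cross (x - z) α} := by
      have : {x : Plane | 0 < cross (x - z) α} = {x | cross z α < cross x α} := by
        ext x; simp [cross_sub_left]
      rw [this]
      exact convex_halfSpace_gt hlin _
    have hconv2 : Convex ℝ {x : Plane | cross (x - z) α < 0} := by
      have : {x : Plane | cross (x - z) α < 0} = {x | cross x α < cross z α} := by
        ext x; simp [cross_sub_left]
      rw [this]
      exact convex_halfSpace_lt hlin _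
    have hmem : ∀ u : Plane, ∀ x ∈ Metric.ball z r, ∀ᶠ ε in 𝓝[>] (0 : ℝ), x + ε • u ∈ Metric.ball z r :=
      fun u x hx => (tendsto_add_smul x u).eventually (Metric.isOpen_ball.mem_nhds hx)
    have hz := Metric.mem_ball_self (x := z) hr0
    obtain ⟨ε, h1, h2, hε⟩ := ((hmem v z hz).and ((hmem (-v) z hz).and self_mem_nhdsWithin)).exists
    have hε : 0 < ε := hε
    have hsub : z + ε • (-v) - (z + ε • v) = (-(2 * ε)) • v := by module
    refine sector_of_parts hP (p₁ := z + ε • v) (p₂ := z + ε • (-v)) hz harms.mem ?_ ?_ ?_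
      ((convex_ball z r).inter hconv1).isPreconnected ((convex_ball z r).inter hconv2).isPreconnected
      ⟨h1, hvpos ε hε⟩ ⟨h2, hvneg ε hε⟩ ?_ ?_ ?_
    · intro x hx
      rw [hb x hx]
      rcases lt_trichotomy (cross (x - z) α) 0 with h | h | h
      · exact Or.inr (Or.inr ⟨hx, h⟩)
      · exact Or.inl h
      · exact Or.inr (Or.inl ⟨hx, h⟩)
    · rintro x ⟨hx, h⟩
      exact ⟨hx, fun h' => (h.ne' ((hb x hx).1 h'))⟩
    · rintro x ⟨hx, h⟩
      exact ⟨hx, fun h' => (h.ne ((hb x hx).1 h'))⟩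
    · refine not_inside_iff_inside_of_trans hP (y := z) (fun h' => (hvpos ε hε).ne' ((hb _ h1).1 h'))
        (fun h' => (hvneg ε hε).ne ((hb _ h2).1 h')) ?_ ?_ ?_ ?_
      · intro h
        have g1 := hvpos ε hε
        rw [h] at g1
        exact g1.not_gt (hvneg ε hε)
      · exact ⟨1 / 2, by norm_num, by norm_num, by rw [hsub]; module⟩
      · refine ⟨_, _, harms.symm, ?_, ?_⟩
        · rw [hsub]
          simp only [cross_smul_left, cross_neg_right, cross_smul_right]
          have : 0 < (2 * ε) * (c * cross v α) := by positivity
          linarith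
        · rw [hsub]
          simp only [cross_smul_left]
          nlinarith
      · rintro x hx ⟨t, h0, h1', rfl⟩
        have hxb := (convex_ball z r).segment_subset h1 h2
          (openSeg_subset_segment _ _ ⟨t, h0, h1', rfl⟩)
        have := (hb _ hxb).1 hx
        rw [hsub, show z + ε • v + t • (-(2 * ε)) • v - z = (ε * (1 - 2 * t)) • v by module,
          cross_smul_left, mul_eq_zero, or_iff_left hv.ne', mul_eq_zero, or_iff_right hε.ne'] at this
        rw [show t = 1 / 2 by linarith, hsub]
        module
    · rintro x ⟨hx, hxb⟩
      refine mem_closure_of_eventually (v := v) ?_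
      filter_upwards [hmem v x hx, self_mem_nhdsWithin] with ε h1 h2
      refine ⟨h1, ?_⟩
      have h2 : 0 < ε := h2
      rw [mem_ofPred_eq, show x + ε • v - z = (x - z) + ε • v by abel, cross_add_left,
        (hb x hx).1 hxb, cross_smul_left]
      have := mul_pos h2 hv
      linarith
    · rintro x ⟨hx, hxb⟩
      refine mem_closure_of_eventually (v := -v) ?_
      filter_upwards [hmem (-v) x hx, self_mem_nhdsWithin] with ε h1 h2
      refine ⟨h1, ?_⟩
      have h2 : 0 < ε := h2
      rw [mem_ofPred_eq, show x + ε • (-v) - z = (x - z) + ε • (-v) by abel, cross_add_left,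
        (hb x hx).1 hxb, cross_smul_left, cross_neg_left]
      nlinarith
  obtain ⟨r₀, hr₀, hkey⟩ := (eventually_nhdsWithin_iff.1 (hb.and key)) |> Metric.eventually_nhds_iff_ball.1
  have hall : ∀ r, 0 < r → r < r₀ → _ := fun r h h' => hkey r (by
    rw [Metric.mem_ball, Real.dist_0_eq_abs, abs_of_pos h]; exact h') h
  have hhalf := hall (r₀ / 2) (by linarith) (by linarith)
  -- The sign `σ` must not depend on the radius: it is read off on one ball and inherited by all
  -- smaller ones.
  have hmain : ∀ σ : ℝ, σ ≠ 0 → (∀ x ∈ Metric.ball z (r₀ / 2), x ∈ inside poly ↔ 0 < σ * cross (x - z) α) →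
      ∃ σ : ℝ, σ ≠ 0 ∧ ∀ᶠ r in 𝓝[>] (0 : ℝ),
      (∀ x ∈ Metric.ball z r, (x ∈ inside poly ↔ 0 < σ * cross (x - z) α) ∧
        (x ∈ poly.boundary ℝ ↔ cross (x - z) α = 0)) ∧
      IsPreconnected (Metric.ball z r ∩ inside poly) ∧ (Metric.ball z r ∩ inside poly).Nonempty ∧
      Metric.ball z r ∩ region poly ⊆ closure (Metric.ball z r ∩ inside poly) ∧
      z ∉ interior (region poly) := by
    intro σ hσ h
    refine ⟨σ, hσ, ?_⟩
    filter_upwards [Ioo_mem_nhdsGT (half_pos hr₀)] with r hr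
    have := hall r hr.1 (by linarith [hr.2])
    exact ⟨fun x hx => ⟨h x (Metric.ball_subset_ball hr.2.le hx), this.1 x hx⟩, this.2.2⟩
  rcases hhalf.2.1 with h | h
  · refine hmain 1 one_ne_zero fun x hx => ?_
    rw [one_mul]
    exact ⟨fun hin => (h.subset ⟨hx, hin⟩).2, fun hin => (h.superset ⟨hx, hin⟩).2⟩
  · refine hmain (-1) (by norm_num) fun x hx => ?_
    rw [neg_one_mul, neg_pos]
    exact ⟨fun hin => (h.subset ⟨hx, hin⟩).2, fun hin => (h.superset ⟨hx, hin⟩).2⟩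

/-- Near every boundary point, the interior of the polygon is connected. -/
lemma exists_sector (hP : IsSimple poly) {z : Plane} (hz : z ∈ poly.boundary ℝ) {G : Set Plane}
    (hG : IsOpen G) (hzG : z ∈ G) : ∃ B, IsOpen B ∧ z ∈ B ∧ B ⊆ G ∧
      IsPreconnected (B ∩ inside poly) ∧ (B ∩ inside poly).Nonempty ∧
      B ∩ region poly ⊆ closure (B ∩ inside poly) ∧ z ∉ interior (region poly) := by
  obtain ⟨ρ, hρ, hρG⟩ := Metric.isOpen_iff.1 hG z hzG
  obtain ⟨α, β, harms, hD | ⟨c, hc, rfl⟩⟩ := hP.exists_arms hz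
  swap
  · obtain ⟨σ, -, h⟩ := sector_of_straight hP hc harms
    obtain ⟨r, h1, h2⟩ := (h.and (Ioo_mem_nhdsGT hρ)).exists
    exact ⟨_, Metric.isOpen_ball, Metric.mem_ball_self h2.1,
      (Metric.ball_subset_ball h2.2.le).trans hρG, h1.2⟩
  obtain ⟨r, hr, hrρ⟩ := (harms.eventually_radius.and (Ioo_mem_nhdsGT hρ)).exists
  set X : Plane → ℝ := fun x => cross (x - z) β / cross α β with hX
  set Y : Plane → ℝ := fun x => cross α (x - z) / cross α β with hY
  have hXc : Continuous X := by rw [hX]; fun_prop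
  have hYc : Continuous Y := by rw [hY]; fun_prop
  have hexp : ∀ x, x = z + (X x • α + Y x • β) := by
    intro x
    rw [hX, hY, ← cross_expand' hD]
    abel
  have hco : ∀ a b : ℝ, X (z + (a • α + b • β)) = a ∧ Y (z + (a • α + b • β)) = b := by
    intro a b
    simp only [hX, hY, add_sub_cancel_left, cross_add_left, cross_add_right, cross_smul_left,
      cross_smul_right, cross_self]
    constructor <;> field_simp <;> ring
  obtain ⟨η, hη, hηr⟩ : ∃ η : ℝ, 0 < η ∧ η * (‖α‖ + ‖β‖) < r := by
    have hpos : 0 < ‖α‖ + ‖β‖ := add_pos_of_pos_of_nonneg (norm_pos_iff.2 harms.1) (norm_nonneg _)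
    refine ⟨r / (‖α‖ + ‖β‖) / 2, by have := hrρ.1; positivity, ?_⟩
    rw [div_mul_eq_mul_div, div_mul_cancel₀ _ hpos.ne']
    linarith [hrρ.1]
  -- At a corner, `B` is a parallelogram in the oblique coordinates along the two arms, which become
  -- the nonnegative half-axes.
  set B : Set Plane := {x | |X x| < η} ∩ {x | |Y x| < η} with hBdef
  have hBo : IsOpen B := (isOpen_lt hXc.abs continuous_const).inter (isOpen_lt hYc.abs continuous_const)
  have hX0 : X z = 0 := by simp [hX]
  have hY0 : Y z = 0 := by simp [hY]
  have hzB : z ∈ B := by simp [hBdef, hX0, hY0, hη]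
  have hBr : B ⊆ Metric.ball z r := by
    rintro x ⟨hx1, hx2⟩
    rw [Metric.mem_ball, dist_eq_norm]
    nth_rewrite 1 [hexp x]
    rw [add_sub_cancel_left]
    refine (norm_add_le _ _).trans_lt (lt_of_le_of_lt ?_ hηr)
    rw [norm_smul, norm_smul, Real.norm_eq_abs, Real.norm_eq_abs, mul_add]
    exact add_le_add (mul_le_mul_of_nonneg_right hx1.le (norm_nonneg _))
      (mul_le_mul_of_nonneg_right hx2.le (norm_nonneg _))
  have hBG : B ⊆ G := hBr.trans ((Metric.ball_subset_ball hrρ.2.le).trans hρG)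
  have hb : ∀ x ∈ B, x ∈ poly.boundary ℝ ↔ (0 ≤ X x ∧ Y x = 0) ∨ (X x = 0 ∧ 0 ≤ Y x) := by
    intro x hx
    rw [hr x (hBr hx)]
    constructor
    · rintro (⟨s, hs, h⟩ | ⟨s, hs, h⟩)
      · have := hco s 0
        rw [zero_smul, add_zero, ← h] at this
        exact Or.inl ⟨this.1.symm ▸ hs, this.2⟩
      · have := hco 0 s
        rw [zero_smul, zero_add, ← h] at this
        exact Or.inr ⟨this.1, this.2.symm ▸ hs⟩
    · rintro (⟨h1, h2⟩ | ⟨h1, h2⟩)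
      · refine Or.inl ⟨X x, h1, ?_⟩
        nth_rewrite 1 [hexp x]
        rw [h2, zero_smul, add_zero]
      · refine Or.inr ⟨Y x, h2, ?_⟩
        nth_rewrite 1 [hexp x]
        rw [h1, zero_smul, zero_add]
  have hlinX : ∀ x y : Plane, ∀ t : ℝ, X (x + t • (y - x)) = X x + t * (X y - X x) := by
    intro x y t
    simp only [hX, cross_sub_left, cross_add_left, cross_smul_left]
    ring
  have hlinY : ∀ x y : Plane, ∀ t : ℝ, Y (x + t • (y - x)) = Y x + t * (Y y - Y x) := by
    intro x y t
    simp only [hY, cross_sub_right, cross_add_right, cross_smul_right]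
    ring
  have hconv : ∀ f : Plane → ℝ, (∀ x y : Plane, ∀ t : ℝ, f (x + t • (y - x)) = f x + t * (f y - f x)) →
      ∀ a b : ℝ, Convex ℝ {x | a < f x ∧ f x < b} := by
    intro f hf a b x hx y hy s t hs ht hst
    have : s • x + t • y = x + t • (y - x) := by
      rw [show s = 1 - t by linarith]
      module
    rw [mem_ofPred_eq, this, hf, show f x + t * (f y - f x) = s * f x + t * f y by
      rw [show s = 1 - t by linarith]; ring]
    exact (convex_Ioo a b) hx hy hs ht hst
  have hBmem : ∀ x, x ∈ B ↔ (-η < X x ∧ X x < η) ∧ (-η < Y x ∧ Y x < η) := by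
    intro x
    simp [hBdef, abs_lt]
  have hdir : ∀ x : Plane, ∀ ε : ℝ, X (x + ε • (α + β)) = X x + ε ∧ Y (x + ε • (α + β)) = Y x + ε := by
    intro x ε
    have := hco (X x + ε) (Y x + ε)
    rwa [show z + ((X x + ε) • α + (Y x + ε) • β) = z + (X x • α + Y x • β) + ε • (α + β) by module,
      ← hexp x] at this
  -- The pieces are the open quadrant and its L-shaped complement, a union of two overlapping convex
  -- sets. The segment between the test points crosses the boundary only at `z + (η / 2) • α`. The
  -- directions `α + β` and `-(α + β)` lead from boundary points into the two pieces.
  refine ⟨B, hBo, hzB, hBG, (sector_of_parts hP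
    (S₁ := {x | 0 < X x ∧ X x < η} ∩ {x | 0 < Y x ∧ Y x < η})
    (S₂ := ({x | -η < X x ∧ X x < 0} ∩ {x | -η < Y x ∧ Y x < η}) ∪
      ({x | -η < X x ∧ X x < η} ∩ {x | -η < Y x ∧ Y x < 0}))
    (p₁ := z + ((η / 2) • α + (η / 2) • β)) (p₂ := z + ((η / 2) • α + (-(η / 2)) • β))
    hzB harms.mem ?_ ?_ ?_ ?_ ?_ ?_ ?_ ?_ ?_ ?_).2⟩
  · intro x hx
    have hx' := (hBmem x).1 hx
    rw [hb x hx]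
    rcases lt_trichotomy (X x) 0 with h1 | h1 | h1
    · exact Or.inr (Or.inr (Or.inl ⟨⟨hx'.1.1, h1⟩, hx'.2⟩))
    · rcases lt_or_ge (Y x) 0 with h2 | h2
      · exact Or.inr (Or.inr (Or.inr ⟨hx'.1, hx'.2.1, h2⟩))
      · exact Or.inl (Or.inr ⟨h1, h2⟩)
    · rcases lt_trichotomy (Y x) 0 with h2 | h2 | h2
      · exact Or.inr (Or.inr (Or.inr ⟨hx'.1, hx'.2.1, h2⟩))
      · exact Or.inl (Or.inl ⟨h1.le, h2⟩)
      · exact Or.inr (Or.inl ⟨⟨h1, hx'.1.2⟩, h2, hx'.2.2⟩)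
  · rintro x ⟨⟨h1, h2⟩, h3, h4⟩
    have hx : x ∈ B := (hBmem x).2 ⟨⟨by linarith, h2⟩, by linarith, h4⟩
    refine ⟨hx, fun h => ?_⟩
    rcases (hb x hx).1 h with h | h
    · exact h3.ne' h.2
    · exact h1.ne' h.1
  · rintro x (⟨⟨h1, h2⟩, h3, h4⟩ | ⟨⟨h1, h2⟩, h3, h4⟩)
    · have hx : x ∈ B := (hBmem x).2 ⟨⟨by linarith, by linarith⟩, by linarith, h4⟩
      refine ⟨hx, fun h => ?_⟩
      rcases (hb x hx).1 h with h | h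
      · exact h2.not_ge h.1
      · exact h2.ne h.1
    · have hx : x ∈ B := (hBmem x).2 ⟨⟨by linarith, by linarith⟩, by linarith, by linarith⟩
      refine ⟨hx, fun h => ?_⟩
      rcases (hb x hx).1 h with h | h
      · exact h4.ne h.2
      · exact h4.not_ge h.2
  · exact ((hconv X hlinX 0 η).inter (hconv Y hlinY 0 η)).isPreconnected
  · refine IsPreconnected.union (z + ((-(η / 2)) • α + (-(η / 2)) • β)) ?_ ?_
      ((hconv X hlinX (-η) 0).inter (hconv Y hlinY (-η) η)).isPreconnected
      ((hconv X hlinX (-η) η).inter (hconv Y hlinY (-η) 0)).isPreconnected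
    · refine ⟨⟨?_, ?_⟩, ?_, ?_⟩ <;> simp only [hco] <;> linarith
    · refine ⟨⟨?_, ?_⟩, ?_, ?_⟩ <;> simp only [hco] <;> linarith
  · refine ⟨⟨?_, ?_⟩, ?_, ?_⟩ <;> simp only [hco] <;> linarith
  · right
    refine ⟨⟨?_, ?_⟩, ?_, ?_⟩ <;> simp only [hco] <;> linarith
  · have h1 : z + ((η / 2) • α + (η / 2) • β) ∈ B := by
      rw [hBmem]
      simp only [hco]
      refine ⟨⟨?_, ?_⟩, ?_, ?_⟩ <;> linarith
    have h2 : z + ((η / 2) • α + (-(η / 2)) • β) ∈ B := by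
      rw [hBmem]
      simp only [hco]
      refine ⟨⟨?_, ?_⟩, ?_, ?_⟩ <;> linarith
    have h3 : z + (η / 2) • α ∈ B := by
      have := hco (η / 2) 0
      rw [zero_smul, add_zero] at this
      rw [hBmem, this.1, this.2]
      refine ⟨⟨?_, ?_⟩, ?_, ?_⟩ <;> linarith
    have hsub : z + ((η / 2) • α + (-(η / 2)) • β) - (z + ((η / 2) • α + (η / 2) • β)) = (-η) • β := by
      module
    refine not_inside_iff_inside_of_trans hP (y := z + (η / 2) • α) ?_ ?_ ?_ ?_ ?_ ?_
    · rw [hb _ h1]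
      simp only [hco]
      rintro (h | h) <;> linarith [h.1, h.2]
    · rw [hb _ h2]
      simp only [hco]
      rintro (h | h) <;> linarith [h.1, h.2]
    · intro h
      have := congrArg Y h
      simp only [hco] at this
      linarith
    · exact ⟨1 / 2, by norm_num, by norm_num, by rw [hsub]; module⟩
    · refine Trans.of_onRay Metric.isOpen_ball hr harms.2.1 ⟨η / 2, by linarith, rfl⟩ (hBr h3) ?_ ?_ ?_
      · simp [hη.ne', harms.1]
      · intro h
        have := h.cross_eq_zero
        rw [add_sub_cancel_left, cross_smul_left, mul_eq_zero, or_iff_left hD] at this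
        linarith
      · rw [hsub, cross_smul_left, cross_swap]
        exact mul_ne_zero (by linarith) (neg_ne_zero.2 hD)
    · rintro x hx ⟨t, h0, h1', hxt⟩
      have hx1 : X x = η / 2 := by
        rw [hxt, hlinX]
        simp only [hco]
        ring
      have hx2 : Y x = η / 2 - t * η := by
        rw [hxt, hlinY]
        simp only [hco]
        ring
      have hxB : x ∈ B := by
        rw [hBmem, hx1, hx2]
        refine ⟨⟨?_, ?_⟩, ?_, ?_⟩ <;> nlinarith
      rcases (hb x hxB).1 hx with h | h
      · rw [hexp x, h.2, hx1, zero_smul, add_zero]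
      · linarith [h.1]
  · rintro x ⟨hx, hxb⟩
    refine mem_closure_of_eventually (v := α + β) ?_
    filter_upwards [(tendsto_add_smul x (α + β)).eventually (hBo.mem_nhds hx), self_mem_nhdsWithin]
      with ε h1 h2
    have h2 : 0 < ε := h2
    have h1 : x + ε • (α + β) ∈ B := h1
    rw [hBmem, (hdir x ε).1, (hdir x ε).2] at h1
    have : 0 ≤ X x ∧ 0 ≤ Y x := by
      rcases (hb x hx).1 hxb with h | h
      · exact ⟨h.1, h.2.ge⟩
      · exact ⟨h.1.ge, h.2⟩
    refine ⟨⟨?_, ?_⟩, ?_, ?_⟩ <;> simp only [(hdir x ε).1, (hdir x ε).2] <;>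
      linarith [h1.1.2, h1.2.2]
  · rintro x ⟨hx, hxb⟩
    refine mem_closure_of_eventually (v := -(α + β)) ?_
    filter_upwards [(tendsto_add_smul x (-(α + β))).eventually (hBo.mem_nhds hx), self_mem_nhdsWithin]
      with ε h1 h2
    have h2 : 0 < ε := h2
    have hd := hdir x (-ε)
    rw [neg_smul, ← smul_neg] at hd
    have h1 : x + ε • (-(α + β)) ∈ B := h1
    rw [hBmem, hd.1, hd.2] at h1
    rcases (hb x hx).1 hxb with h | h
    · right
      refine ⟨⟨?_, ?_⟩, ?_, ?_⟩ <;> simp only [hd.1, hd.2] <;>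
        linarith [h1.1.1, h1.2.1, h1.1.2, h1.2.2, h.1, h.2]
    · left
      refine ⟨⟨?_, ?_⟩, ?_, ?_⟩ <;> simp only [hd.1, hd.2] <;>
        linarith [h1.1.1, h1.2.1, h1.1.2, h1.2.2, h.1, h.2]

end Sectors

/-! ### Positions that lie on a partition line -/

section PartitionLines

variable {n : ℕ} {poly : Polygon Plane n}

lemma visible_iff {m : ℕ} {p q : Plane} (h : p ≠ q) :
    Visible poly m p q ↔ (poly.boundary ℝ ∩ openSeg p q).encard ≤ m := by
  rw [Visible, segment_sdiff h, inter_comm]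

lemma visible_self (m : ℕ) (p : Plane) : Visible poly m p p := by
  rw [Visible]
  have : (segment ℝ p p \ {p, p}) ∩ poly.boundary ℝ = ∅ := by simp [segment_same]
  rw [this]
  simp

lemma visible_symm {m : ℕ} {p q : Plane} : Visible poly m p q ↔ Visible poly m q p := by
  rw [Visible, Visible, segment_symm, pair_comm]

lemma mem_partitionLines_of_closure {k m : ℕ} {p v : Plane} (hv : ∃ i, v = poly i) (hm : Even m)
    (hmk : m ≤ k) (h1 : p ∈ closure (visibilityPolygon poly m v))
    (h2 : p ∉ interior (visibilityPolygon poly m v)) : p ∈ partitionLines poly k := by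
  obtain ⟨i, rfl⟩ := hv
  exact ⟨i, m, hm, hmk, h1, h2⟩

/-- If an arm at `x` pointed at `p`, a whole piece of the segment next to `x` would belong to `F`.
-/
lemma OnRay.not_of_finite {F : Set Plane} {x α β p : Plane} (harms : Arms F x α β) (hpx : p ≠ x)
    (hfin : (F ∩ openSeg p x).Finite) : ¬ OnRay x α p := by
  rintro ⟨s, hs, hp⟩
  have hs0 : 0 < s := hs.lt_of_ne (by rintro rfl; simp at hp; exact hpx hp)
  have htend : Tendsto (fun ε : ℝ => x + ε • α) (𝓝[>] 0) (𝓝 x) := tendsto_add_smul x α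
  obtain ⟨ρ, hρ, hball⟩ := mem_nhdsGT_iff_exists_Ioo_subset.1
    ((htend.eventually harms.2.2).and (Ioo_mem_nhdsGT hs0))
  have hρ : 0 < ρ := hρ
  refine (Ioo_infinite hρ).not_finite ?_
  have hsub : (fun ε : ℝ => x + ε • α) '' Ioo 0 ρ ⊆ F ∩ openSeg p x := by
    rintro _ ⟨ε, hε, rfl⟩
    obtain ⟨h1, h2⟩ := hball hε
    refine ⟨h1.2 (Or.inl ⟨ε, hε.1.le, rfl⟩), ?_⟩
    rw [openSeg_symm]
    refine ⟨ε / s, div_pos hε.1 hs0, (div_lt_one hs0).2 h2.2, ?_⟩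
    rw [hp, add_sub_cancel_left, smul_smul, div_mul_cancel₀ _ hs0.ne']
  refine Finite.of_finite_image (hfin.subset hsub) ?_
  intro a _ b _ hab
  have : (a - b) • α = 0 := by
    have h := add_left_cancel hab
    rw [sub_smul, h, sub_self]
  rcases smul_eq_zero.1 this with h | h
  · exact sub_eq_zero.1 h
  · exact absurd h harms.1

/-- The boundary is the union of the edge `x w` and of the closed set `F`, which meets this edge
only at its endpoints; `β` is the direction of the other edge at `x`. -/
structure EdgeSplit (poly : Polygon Plane n) (x w : Plane) (F : Set Plane) (β : Plane) : Prop where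
  closed : IsClosed F
  ne : x ≠ w
  right_vertex : ∃ i, w = poly i
  union : ∀ y, y ∈ poly.boundary ℝ ↔ y ∈ F ∨ y ∈ segment ℝ x w
  disj : ∀ y ∈ F, y ∉ openSeg x w
  arms : Arms F x β β
  arms_boundary : Arms (poly.boundary ℝ) x (w - x) β
  not_onRay : ∀ c : ℝ, 0 < c → β ≠ c • (w - x)

/-- Splitting off an edge makes it possible to turn a line of sight away from an edge that it
contains. The remainder has a single arm at `x`, expressed by listing `β` twice in `Arms`. -/
lemma IsSimple.edgeSplit_next (hP : IsSimple poly) (i : Fin n) :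
    EdgeSplit poly (poly (finRotate n i)) (poly (finRotate n (finRotate n i)))
      (edgesOf poly fun l => l ≠ finRotate n i) (poly i - poly (finRotate n i)) where
  closed := isClosed_edgesOf _ _
  ne := hP.edge_ne _
  right_vertex := ⟨_, rfl⟩
  union y := by
    rw [mem_boundary]
    constructor
    · rintro ⟨l, hl⟩
      by_cases h : l = finRotate n i
      · exact Or.inr (h ▸ hl)
      · exact Or.inl ⟨l, h, hl⟩
    · rintro (⟨l, -, hl⟩ | h)
      · exact ⟨l, hl⟩
      · exact ⟨_, h⟩
  disj := by
    rintro y ⟨l, hl, hy⟩ h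
    exact hl (hP.eq_of_mem_openSeg h hy)
  arms := by
    refine ⟨sub_ne_zero.2 (hP.edge_ne i), sub_ne_zero.2 (hP.edge_ne i), ?_⟩
    filter_upwards [eventually_mem_edgesOf (poly := poly) (fun l => l ≠ finRotate n i)
      (poly (finRotate n i)), eventually_segment_left (hP.edge_ne i).symm] with x h1 h2
    rw [h1, or_self, ← h2]
    constructor
    · rintro ⟨j, hne, hj, hx⟩
      have h := (hP.eq_or_eq_of_mem hj).resolve_left hne
      rwa [(finRotate n).injective h, segment_symm] at hx
    · intro hx
      exact ⟨i, (hP.finRotate_ne i).symm, right_mem_segment ℝ _ _, by rwa [segment_symm]⟩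
  arms_boundary := hP.arms_vertex i
  not_onRay c hc := hP.not_smul i hc

lemma IsSimple.edgeSplit_prev (hP : IsSimple poly) (i : Fin n) :
    EdgeSplit poly (poly (finRotate n i)) (poly i)
      (edgesOf poly fun l => l ≠ i) (poly (finRotate n (finRotate n i)) - poly (finRotate n i)) where
  closed := isClosed_edgesOf _ _
  ne := (hP.edge_ne _).symm
  right_vertex := ⟨_, rfl⟩
  union y := by
    rw [mem_boundary]
    constructor
    · rintro ⟨l, hl⟩
      by_cases h : l = i
      · rw [segment_symm]
        exact Or.inr (h ▸ hl)
      · exact Or.inl ⟨l, h, hl⟩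
    · rintro (⟨l, -, hl⟩ | h)
      · exact ⟨l, hl⟩
      · rw [segment_symm] at h
        exact ⟨_, h⟩
  disj := by
    rintro y ⟨l, hl, hy⟩ h
    rw [openSeg_symm] at h
    exact hl (hP.eq_of_mem_openSeg h hy)
  arms := by
    refine ⟨sub_ne_zero.2 (hP.edge_ne _).symm, sub_ne_zero.2 (hP.edge_ne _).symm, ?_⟩
    filter_upwards [eventually_mem_edgesOf (poly := poly) (fun l => l ≠ i)
      (poly (finRotate n i)), eventually_segment_left (hP.edge_ne (finRotate n i))] with x h1 h2
    rw [h1, or_self, ← h2]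
    constructor
    · rintro ⟨j, hne, hj, hx⟩
      rcases hP.eq_or_eq_of_mem hj with rfl | h
      · exact hx
      · exact absurd ((finRotate n).injective h) hne
    · intro hx
      exact ⟨_, hP.finRotate_ne i, left_mem_segment ℝ _ _, hx⟩
  arms_boundary := (hP.arms_vertex i).symm
  not_onRay c hc h := by
    refine hP.not_smul i (inv_pos.2 hc) ?_
    rw [h, smul_smul, inv_mul_cancel₀ hc.ne', one_smul]

/-- Every edge at a vertex splits off at either endpoint, from the same remainder. -/
lemma IsSimple.exists_edgeSplit (hP : IsSimple poly) (i : Fin n) : ∃ F β₁ β₂,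
    EdgeSplit poly (poly i) (poly (finRotate n i)) F β₁ ∧
    EdgeSplit poly (poly (finRotate n i)) (poly i) F β₂ := by
  have h := hP.edgeSplit_next ((finRotate n).symm i)
  rw [Equiv.apply_symm_apply] at h
  exact ⟨_, _, _, h, hP.edgeSplit_prev i⟩

lemma EdgeSplit.not_onRay' {x w β : Plane} {F : Set Plane} (h : EdgeSplit poly x w F β) {c : ℝ}
    (hc : 0 < c) : ¬ OnRay x β (x + c • (w - x)) := by
  rintro ⟨s, hs, h1⟩
  have h1 : c • (w - x) = s • β := add_left_cancel h1
  have hs0 : s ≠ 0 := by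
    rintro rfl
    rw [zero_smul] at h1
    exact (smul_ne_zero hc.ne' (sub_ne_zero.2 h.ne.symm)) h1
  refine h.not_onRay (s⁻¹ * c) (mul_pos (inv_pos.2 (hs.lt_of_ne hs0.symm)) hc) ?_
  rw [mul_smul, h1, smul_smul, inv_mul_cancel₀ hs0, one_smul]

/-- The boundary of the polygon consists of partition lines. -/
lemma openSeg_subset_partitionLines (hP : IsSimple poly) (k : ℕ) {i : Fin n} {y : Plane}
    (hy : y ∈ openSeg (poly i) (poly (finRotate n i))) : y ∈ partitionLines poly k := by
  obtain ⟨F, β, -, hsp, -⟩ := hP.exists_edgeSplit i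
  set a := poly i with ha
  set b := poly (finRotate n i)
  have harms : Arms (poly.boundary ℝ) y (b - a) (-((1 : ℝ) • (b - a))) := by
    rw [one_smul]
    exact hP.arms_edge hy
  obtain ⟨σ, hσ, hsec⟩ := sector_of_straight hP one_pos harms
  obtain ⟨t, h0, h1, ht⟩ := hy
  have hyray : ¬ OnRay a β y := ht ▸ hsp.not_onRay' h0
  -- Points near `y` see the endpoint `a` of the edge without meeting any other edge.
  have hnb : ∀ᶠ p' in 𝓝 y, F ∩ openSeg p' a = ∅ := by
    have hT : ∀ x ∈ F, x ∈ segment ℝ y a → x ∈ (∅ : Finset Plane) ∨ x ∈ ({a} : Finset Plane) := by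
      intro x hx hxs
      right
      rw [Finset.mem_singleton]
      by_contra hne
      obtain ⟨s, hs0, hs1, rfl⟩ := mem_segment_iff.1 hxs
      have hs1 : s < 1 := hs1.lt_of_ne (by rintro rfl; simp at hne)
      refine hsp.disj _ hx ⟨(1 - s) * t, by nlinarith, by nlinarith, ?_⟩
      rw [ht]
      module
    obtain ⟨r, hr1, hr2⟩ := ((eventually_count hsp.closed ∅ {a} (by simp) (by simp) hT).and
      (hsp.arms.eventually_end hyray hyray)).exists
    have htend : Tendsto (fun p' : Plane => (p', a)) (𝓝 y) (𝓝 (y, a)) :=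
      tendsto_id.prodMk_nhds tendsto_const_nhds
    filter_upwards [htend.eventually hr1, hr2] with p' h1 h2
    have h1 := h1.1
    simp only [Finset.mem_singleton, iUnion_iUnion_eq_left, h2] at h1
    simpa using h1
  have hnint : y ∉ interior (region poly) := by
    obtain ⟨r, hr⟩ := hsec.exists
    exact hr.2.2.2.2
  -- Enclosed points near `y` are 0-visible from `a`, while `y` is not even interior to the region;
  -- so the case `m = 0` suffices.
  refine mem_partitionLines_of_closure (m := 0) ⟨i, rfl⟩ Even.zero (Nat.zero_le k) ?_
    fun h => hnint (interior_mono (fun x hx => hx.1) h)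
  rw [mem_closure_iff_nhds]
  intro G hG
  obtain ⟨ρ, hρ, hball⟩ := Metric.mem_nhds_iff.1 (Filter.inter_mem hG hnb)
  obtain ⟨r, hr, hrρ⟩ := (hsec.and (Ioo_mem_nhdsGT hρ)).exists
  obtain ⟨q, hq, hin⟩ := hr.2.2.1
  obtain ⟨hqG, hqF⟩ := hball (Metric.ball_subset_ball hrρ.2.le hq)
  refine ⟨q, hqG, Or.inr hin, ?_⟩
  have hqa : q ≠ a := by
    rintro rfl
    exact hin.1 (vertex_mem_boundary i)
  rw [← ha, visible_symm, visible_iff hqa]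
  have hcr : cross (q - y) (b - a) ≠ 0 := fun h => hin.1 (((hr.1 q hq).2).2 h)
  have : poly.boundary ℝ ∩ openSeg q a = ∅ := by
    rw [eq_empty_iff_forall_notMem]
    rintro x ⟨hx, hxs⟩
    rcases (hsp.union x).1 hx with h | h
    · exact (eq_empty_iff_forall_notMem.1 hqF x) ⟨h, hxs⟩
    -- The edge itself is not crossed either: `q` is off its line, and the segment reaches that line
    -- only at `a`.
    · obtain ⟨u, hu0, hu1, rfl⟩ := hxs
      obtain ⟨s, hs0, hs1, h⟩ := mem_segment_iff.1 h
      have h2 := congrArg (fun v => cross (v - a) (b - a)) h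
      simp only [add_sub_cancel_left, cross_smul_left, cross_self, mul_zero] at h2
      rw [show q + u • (a - q) - a = (1 - u) • ((q - y) + t • (b - a)) by rw [ht]; module,
        cross_smul_left, cross_add_left, cross_smul_left, cross_self, mul_zero, add_zero,
        mul_eq_zero, or_iff_left hcr] at h2
      linarith
  rw [this]
  simp

lemma isClosed_partitionLines (poly : Polygon Plane n) (k : ℕ) : IsClosed (partitionLines poly k) := by
  have : partitionLines poly k = ⋃ i : Fin n, ⋃ m ∈ {m | Even m ∧ m ≤ k},
      frontier (visibilityPolygon poly m (poly i)) := by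
    ext x
    simp only [partitionLines, mem_ofPred_eq, mem_iUnion, exists_prop, and_assoc]
  rw [this]
  refine isClosed_iUnion_of_finite fun i => ?_
  exact Set.Finite.isClosed_biUnion ((finite_Iic k).subset fun m hm => hm.2) fun m _ => isClosed_frontier

lemma boundary_subset_partitionLines (hP : IsSimple poly) (k : ℕ) :
    poly.boundary ℝ ⊆ partitionLines poly k := by
  intro y hy
  rcases boundary_cases hy with ⟨i, hi⟩ | ⟨i, rfl⟩
  · exact openSeg_subset_partitionLines hP k hi
  · rw [← (isClosed_partitionLines poly k).closure_eq]
    refine mem_closure_of_eventually (v := poly i - poly (finRotate n i)) ?_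
    filter_upwards [Ioo_mem_nhdsGT one_pos] with ε hε
    refine openSeg_subset_partitionLines hP k (i := i) ?_
    rw [openSeg_symm]
    exact ⟨ε, hε.1, hε.2, rfl⟩

lemma Trans.congr {F F' : Set Plane} {y d d' : Plane} (h : Trans F y d)
    (hF : ∀ᶠ x in 𝓝 y, (x ∈ F ↔ x ∈ F')) {c : ℝ} (hc : 0 < c) (hd : d' = c • d) : Trans F' y d' := by
  obtain ⟨α, β, h1, h2, h3⟩ := h
  refine ⟨α, β, h1.congr hF, ?_, ?_⟩ <;> rw [hd, cross_smul_left]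
  · positivity
  · nlinarith

/-- Seen from `p`, a vertex behind a tangency makes `p` a point of a partition line. -/
lemma mem_partitionLines_of_tang (hP : IsSimple poly) {k K : ℕ} (hK : Even K) (hKk : K ≤ k)
    {p x w : Plane} (hp : p ∈ inside poly) (hx : ∃ i, x = poly i) (S : Finset Plane)
    (hS : ∀ y ∈ S, y ∈ openSeg p x ∧ Trans (poly.boundary ℝ) y (x - p))
    (hw : w ∈ openSeg p x) (hwT : Tang (poly.boundary ℝ) w (x - p)) (hwS : w ∉ S)
    (hSw : ∀ y ∈ poly.boundary ℝ, y ∈ openSeg p x → y ∈ S ∨ y = w) (hcard : S.card ≤ K) :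
    p ∈ partitionLines poly k := by
  classical
  have hxb : x ∈ poly.boundary ℝ := by
    obtain ⟨i, rfl⟩ := hx
    exact vertex_mem_boundary i
  have hpx : p ≠ x := fun h => hp.1 (h ▸ hxb)
  have hd : x - p ≠ 0 := sub_ne_zero.2 hpx.symm
  have hxw : w ≠ x := fun h => right_notMem_openSeg hpx (h ▸ hw)
  have hfin : (poly.boundary ℝ ∩ openSeg p x).Finite := by
    refine (insert w S).finite_toSet.subset ?_
    rintro y ⟨h1, h2⟩
    rcases hSw y h1 h2 with h | h <;> simp [h]
  obtain ⟨α, β, harms, -⟩ := hP.exists_arms hxb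
  have hT : ∀ y ∈ poly.boundary ℝ, y ∈ segment ℝ p x → y ∈ S ∨ y ∈ ({w, x} : Finset Plane) := by
    intro y hy hys
    by_cases hyx : y = x
    · right; simp [hyx]
    · have : y ∈ openSeg p x := by
        rw [← segment_sdiff hpx]
        refine ⟨hys, ?_⟩
        rintro (rfl | h)
        · exact hp.1 hy
        · exact hyx h
      rcases hSw y hy this with h | h
      · exact Or.inl h
      · right; simp [h]
  have hSE : ∀ y ∈ S, y ∉ ({w, x} : Finset Plane) := by
    intro y hy h
    simp only [Finset.mem_insert, Finset.mem_singleton] at h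
    rcases h with rfl | rfl
    · exact hwS hy
    · exact right_notMem_openSeg hpx (hS _ hy).1
  obtain ⟨κ, hκ, hev⟩ := hwT.eventually_hit hw
  obtain ⟨r, ⟨hr1, hr2⟩, hr3⟩ := ((eventually_count (isClosed_boundary poly) S {w, x} hS hSE hT).and
    hev |>.and (harms.eventually_end (OnRay.not_of_finite harms hpx hfin)
      (OnRay.not_of_finite harms.symm hpx hfin))).exists
  obtain ⟨m, hm⟩ := exists_cross_pos hd
  have htend : ∀ v : Plane, Tendsto (fun ε : ℝ => (p + ε • v, x)) (𝓝[>] 0) (𝓝 (p, x)) :=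
    fun v => (tendsto_add_smul p v).prodMk_nhds tendsto_const_nhds
  obtain ⟨t, h0, h1, ht⟩ := hw
  have ho : ∀ (v : Plane) (ε : ℝ), cross (x - (p + ε • v)) (w - (p + ε • v)) =
      -((1 - t) * (ε * cross (x - p) v)) := by
    intro v ε
    rw [ht, show x - (p + ε • v) = (x - p) - ε • v by abel,
      show p + t • (x - p) - (p + ε • v) = t • (x - p) - ε • v by abel]
    generalize x - p = d
    simp only [cross_sub_left, cross_sub_right, cross_smul_left, cross_smul_right, cross_self]
    rw [cross_swap v]
    ring
  have hcount : ∀ v : Plane, ∀ᶠ ε in 𝓝[>] (0 : ℝ), p + ε • v ∈ inside poly ∧ p + ε • v ≠ x ∧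
      (poly.boundary ℝ ∩ openSeg (p + ε • v) x).encard = S.card +
        (poly.boundary ℝ ∩ openSeg (p + ε • v) x ∩ Metric.ball w r).encard := by
    intro v
    filter_upwards [(htend v).eventually hr1, (tendsto_add_smul p v).eventually hr3,
      (tendsto_add_smul p v).eventually ((isOpen_inside hP).mem_nhds hp)] with ε h1 h2 h3
    have h3 : p + ε • v ∈ inside poly := h3
    refine ⟨h3, fun h => h3.1 (h ▸ hxb), ?_⟩
    rw [h1.1]
    congr 2
    simp only [Finset.mem_insert, Finset.mem_singleton, iUnion_iUnion_eq_or_left,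
      iUnion_iUnion_eq_left, inter_union_distrib_left, h2, union_empty]
  -- `M` is the even one of `S.card` and `S.card + 1`; since `K` is even it does not exceed `K`.
  obtain ⟨M, hM, hMK, hSM, hMS⟩ : ∃ M : ℕ, Even M ∧ M ≤ K ∧ S.card ≤ M ∧ M < S.card + 2 := by
    rcases Nat.even_or_odd S.card with h | h
    · exact ⟨S.card, h, hcard, le_rfl, by omega⟩
    · refine ⟨S.card + 1, h.add_one, ?_, by omega, by omega⟩
      obtain ⟨a, ha⟩ := h
      obtain ⟨b, hb⟩ := hK
      omega
  have hcm : 0 < (1 - t) * ((κ * κ) * cross (x - p) m) :=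
    mul_pos (by linarith) (mul_pos (mul_self_pos.2 hκ) hm)
  -- Moving `p` to one side clears the tangency and leaves `S.card ≤ M` crossings; moving it to the
  -- other side gives `S.card + 2 > M`. So `p` is on the boundary of the `M`-visibility polygon of
  -- `x`.
  refine mem_partitionLines_of_closure (m := M) hx hM (hMK.trans hKk) ?_ ?_
  · refine mem_closure_of_eventually (v := -κ • m) ?_
    filter_upwards [hcount (-κ • m), (htend (-κ • m)).eventually hr2, self_mem_nhdsWithin]
      with ε h1 h2 h3
    have h3 : 0 < ε := h3
    refine ⟨Or.inr h1.1, ?_⟩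
    rw [visible_symm, visible_iff h1.2.1, h1.2.2, h2.1]
    · simpa using hSM
    · simp only [ho, cross_smul_right]
      nlinarith [mul_pos h3 hcm]
  · intro hint
    have h4 := (tendsto_add_smul p (κ • m)).eventually (isOpen_interior.mem_nhds hint)
    obtain ⟨ε, ⟨h1, h2⟩, h3, h4⟩ := ((hcount (κ • m)).and ((htend (κ • m)).eventually hr2) |>.and
      (eventually_mem_nhdsWithin.and h4)).exists
    have h3 : 0 < ε := h3
    have h4 : p + ε • κ • m ∈ interior (visibilityPolygon poly M x) := h4
    have h5 := (interior_subset h4).2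
    rw [visible_symm, visible_iff h1.2.1, h1.2.2, (h2.2.2 _).1] at h5
    · have : S.card + 2 ≤ M := by exact_mod_cast h5
      omega
    · simp only [ho, cross_smul_right]
      nlinarith [mul_pos h3 hcm]

/-- Seen from `p`, an edge on the line of sight makes `p` a point of a partition line. -/
lemma mem_partitionLines_of_edgeSplit (hP : IsSimple poly) {k K : ℕ} (hK : Even K) (hKk : K ≤ k)
    {p x w β β' : Plane} {F : Set Plane} (hsp : EdgeSplit poly x w F β) (hsp' : EdgeSplit poly w x F β')
    (hp : p ∈ inside poly) (S : Finset Plane)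
    (hS : ∀ y ∈ S, y ∈ openSeg p x ∧ Trans (poly.boundary ℝ) y (x - p))
    (hSw : ∀ y ∈ poly.boundary ℝ, y ∈ openSeg p x → y ∈ S) (hcard : S.card ≤ K)
    (hcr : cross (x - p) (w - x) = 0) : p ∈ partitionLines poly k := by
  classical
  have hxb : x ∈ poly.boundary ℝ := hsp.arms_boundary.mem
  have hwb : w ∈ poly.boundary ℝ := hsp'.arms_boundary.mem
  have hpx : p ≠ x := fun h => hp.1 (h ▸ hxb)
  have hpw : p ≠ w := fun h => hp.1 (h ▸ hwb)
  have hd : x - p ≠ 0 := sub_ne_zero.2 hpx.symm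
  have hfin : (poly.boundary ℝ ∩ openSeg p x).Finite := by
    refine S.finite_toSet.subset ?_
    rintro y ⟨h1, h2⟩
    exact hSw y h1 h2
  obtain ⟨c, hc⟩ := exists_smul_of_cross_eq_zero hd hcr
  have hc0 : c ≠ 0 := by
    rintro rfl
    rw [zero_smul, sub_eq_zero] at hc
    exact hsp.ne hc.symm
  -- The edge leads away from `p`: otherwise it would share a whole piece with the segment from `p`
  -- to `x`.
  have hcpos : 0 < c := by
    by_contra! h
    refine OnRay.not_of_finite hsp.arms_boundary hpx hfin ⟨-c⁻¹, by simpa using h, ?_⟩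
    rw [hc, smul_smul, neg_mul, inv_mul_cancel₀ hc0]
    module
  have hwp : w - p = (1 + c) • (x - p) := by
    rw [show w - p = (w - x) + (x - p) by abel, hc]
    module
  have hxw : x = p + (1 / (1 + c)) • (w - p) := by
    rw [hwp, smul_smul, one_div, inv_mul_cancel₀ (by linarith)]
    module
  have hpb : ¬ OnRay w β' p := by
    have : p = w + ((1 + c) / c) • (x - w) := by
      rw [show x - w = -(w - x) by abel, hc, smul_neg, smul_smul, div_mul_cancel₀ _ hc0, ← hwp]
      abel
    rw [this]
    exact hsp'.not_onRay' (by positivity)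
  have hβ : cross (x - p) β ≠ 0 := by
    intro h
    obtain ⟨e, he⟩ := exists_smul_of_cross_eq_zero hd h
    rcases lt_trichotomy e 0 with h0 | rfl | h0
    · refine OnRay.not_of_finite hsp.arms_boundary.symm hpx hfin ⟨-e⁻¹, by
        rw [← inv_neg]; exact inv_nonneg.2 (by linarith), ?_⟩
      rw [he, smul_smul, neg_mul, inv_mul_cancel₀ h0.ne]
      module
    · rw [zero_smul] at he
      exact hsp.arms.1 he
    · refine hsp.not_onRay (e / c) (div_pos h0 hcpos) ?_
      rw [he, hc, smul_smul, div_mul_cancel₀ _ hc0]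
  have hT : ∀ y ∈ F, y ∈ segment ℝ p w → y ∈ S ∨ y ∈ ({x, w} : Finset Plane) := by
    intro y hy hys
    have hyb := (hsp.union y).2 (Or.inl hy)
    obtain ⟨t, h0, h1, rfl⟩ := mem_segment_iff.1 hys
    rw [Finset.mem_insert, Finset.mem_singleton]
    rcases h0.eq_or_lt with rfl | h0
    · simp at hyb
      exact absurd hyb hp.1
    rcases lt_trichotomy (t * (1 + c)) 1 with h | h | h
    · left
      refine hSw _ hyb ⟨t * (1 + c), by positivity, h, ?_⟩
      rw [hwp, smul_smul]
    · right; left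
      rw [hwp, smul_smul, h]
      module
    · right; right
      by_contra hne
      have h1 : t < 1 := h1.lt_of_ne (by rintro rfl; simp at hne)
      refine hsp.disj _ hy ⟨(t * (1 + c) - 1) / c, div_pos (by linarith) hcpos, ?_, ?_⟩
      · rw [div_lt_one hcpos]
        nlinarith
      · rw [hc, smul_smul, div_mul_cancel₀ _ hc0, hwp]
        module
  have hline : ∀ y ∈ segment ℝ x w, ∃ s : ℝ, 0 ≤ s ∧ y = x + s • (x - p) := by
    intro y hy
    obtain ⟨s, hs, -, rfl⟩ := mem_segment_iff.1 hy
    exact ⟨s * c, by positivity, by rw [hc, smul_smul]⟩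
  have hSp : ∀ y ∈ S, y ∈ openSeg p w ∧ Trans F y (w - p) := by
    intro y hy
    obtain ⟨⟨t, h0, h1, ht⟩, htr⟩ := hS y hy
    refine ⟨⟨t / (1 + c), by positivity, by rw [div_lt_one] <;> linarith, ?_⟩, ?_⟩
    · rw [hwp, smul_smul, div_mul_cancel₀ _ (by linarith), ht]
    · refine htr.congr ?_ (by linarith : 0 < 1 + c) hwp
      have hyn : y ∉ segment ℝ x w := by
        intro hys
        obtain ⟨s, hs, h⟩ := hline y hys
        have : (1 - t + s) • (x - p) = 0 := by
          rw [show (1 - t + s) • (x - p) = (x + s • (x - p)) - (p + t • (x - p)) by module, ← ht, ← h,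
            sub_self]
        rcases smul_eq_zero.1 this with h' | h'
        · linarith
        · exact hd h'
      filter_upwards [(isCompact_segment x w).isClosed.isOpen_compl.mem_nhds hyn] with v hv
      rw [hsp.union]
      exact or_iff_left hv
  have hSE : ∀ y ∈ S, y ∉ ({x, w} : Finset Plane) := by
    intro y hy h
    simp only [Finset.mem_insert, Finset.mem_singleton] at h
    rcases h with rfl | rfl
    · exact right_notMem_openSeg hpx (hS _ hy).1
    · exact right_notMem_openSeg hpw (hSp _ hy).1
  have hβ' : cross (w - p) β ≠ 0 := by
    rw [hwp, cross_smul_left]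
    exact mul_ne_zero (by linarith) hβ
  obtain ⟨r, ⟨hr1, hr2⟩, hr3⟩ := ((eventually_count hsp.closed S {x, w} hSp hSE hT).and
    (hsp.arms.eventually_mem_iff (by positivity) hxw hβ' hβ') |>.and
    (hsp'.arms.eventually_end hpb hpb)).exists
  obtain ⟨m, hm⟩ := exists_cross_pos hd
  -- The sign of `v` makes the moved segment to `w` pass `x` on the side opposite to the other edge
  -- at `x`, so nothing is crossed near `x`.
  set v : Plane := (-cross (w - p) β) • m with hv
  have htend : Tendsto (fun ε : ℝ => (p + ε • v, w)) (𝓝[>] 0) (𝓝 (p, w)) :=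
    (tendsto_add_smul p v).prodMk_nhds tendsto_const_nhds
  -- The far endpoint `w` does not see `p`, since the segment contains the whole edge. It does see
  -- the moved points, with `S.card ≤ K` crossings.
  have hpn : p ∉ visibilityPolygon poly K w := by
    rintro ⟨-, h⟩
    rw [visible_symm, visible_iff hpw] at h
    have hinf : (openSeg x w).Infinite := by
      have : openSeg x w = (fun t : ℝ => x + t • (w - x)) '' Ioo 0 1 := by
        ext y
        constructor
        · rintro ⟨t, h0, h1, rfl⟩
          exact ⟨t, ⟨h0, h1⟩, rfl⟩
        · rintro ⟨t, ⟨h0, h1⟩, rfl⟩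
          exact ⟨t, h0, h1, rfl⟩
      rw [this]
      refine (Ioo_infinite one_pos).image fun a _ b _ hab => ?_
      have : (a - b) • (w - x) = 0 := by rw [sub_smul, add_left_cancel hab, sub_self]
      exact sub_eq_zero.1 ((smul_eq_zero.1 this).resolve_right (sub_ne_zero.2 hsp.ne.symm))
    have hsub : openSeg x w ⊆ poly.boundary ℝ ∩ openSeg p w := by
      intro y hy
      refine ⟨(hsp.union y).2 (Or.inr (openSeg_subset_segment _ _ hy)), ?_⟩
      obtain ⟨t, h0, h1, rfl⟩ := hy
      refine ⟨(1 + t * c) / (1 + c), by positivity, ?_, ?_⟩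
      · rw [div_lt_one (by linarith)]
        nlinarith
      · rw [hwp, smul_smul, div_mul_cancel₀ _ (by linarith), hc]
        module
    exact (hinf.mono hsub) (finite_of_encard_le_coe h)
  refine mem_partitionLines_of_closure (m := K) hsp.right_vertex hK hKk ?_
    fun h => hpn (interior_subset h)
  refine mem_closure_of_eventually (v := v) ?_
  filter_upwards [htend.eventually hr1, htend.eventually hr2, (tendsto_add_smul p v).eventually hr3,
    (tendsto_add_smul p v).eventually ((isOpen_inside hP).mem_nhds hp), self_mem_nhdsWithin]
    with ε h1 h2 h3 h4 hε
  have hε : 0 < ε := hε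
  have h4 : p + ε • v ∈ inside poly := h4
  have hne : p + ε • v ≠ w := fun h => h4.1 (h ▸ hwb)
  refine ⟨Or.inr h4, ?_⟩
  rw [visible_symm, visible_iff hne]
  have hob : 0 < cross (w - (p + ε • v)) (x - (p + ε • v)) * cross (w - (p + ε • v)) β := by
    have e1 : cross (w - (p + ε • v)) (x - (p + ε • v)) =
        ε * (c * (cross (x - p) m * cross (w - p) β)) := by
      rw [show w - (p + ε • v) = (1 + c) • (x - p) - ε • v by rw [← hwp]; abel,
        show x - (p + ε • v) = (x - p) - ε • v by abel, hv]
      generalize cross (w - p) β = b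
      generalize x - p = d
      simp only [cross_sub_left, cross_sub_right, cross_smul_left, cross_smul_right, cross_self]
      rw [cross_swap m]
      ring
    rw [e1]
    have h5 := h2.1
    have : 0 < ε * (c * cross (x - p) m) := by positivity
    nlinarith [mul_pos this h5]
  have hx0 : F ∩ openSeg (p + ε • v) w ∩ Metric.ball x r = ∅ := by
    rw [eq_empty_iff_forall_notMem]
    intro y hy
    rcases (h2.2.2.2.2 y).1 hy with h | h
    · exact absurd h.2.1 (not_le.2 hob)
    · exact absurd h.2.1 (not_le.2 hob)
  have heq : poly.boundary ℝ ∩ openSeg (p + ε • v) w = F ∩ openSeg (p + ε • v) w := by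
    ext y
    simp only [mem_inter_iff, hsp.union, and_congr_left_iff, or_iff_left_iff_imp]
    rintro ⟨u, hu0, hu1, rfl⟩ hys
    obtain ⟨s, hs, h⟩ := hline _ hys
    have h6 := congrArg (fun y => cross (x - p) (y - p)) h
    rw [show p + ε • v + u • (w - (p + ε • v)) - p = ((1 - u) * ε) • v + u • (w - p) by module,
      show x + s • (x - p) - p = (1 + s) • (x - p) by module, hwp, hv] at h6
    simp only [cross_add_right, cross_smul_right, cross_self, mul_zero, add_zero] at h6
    exact absurd h6 (mul_ne_zero (mul_ne_zero (by linarith) hε.ne')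
      (mul_ne_zero (neg_ne_zero.2 hβ') hm.ne'))
  rw [heq, h1.1]
  have : (F ∩ openSeg (p + ε • v) w ∩ ⋃ y ∈ ({x, w} : Finset Plane), Metric.ball y r) = ∅ := by
    simp only [Finset.mem_insert, Finset.mem_singleton, iUnion_iUnion_eq_or_left,
      iUnion_iUnion_eq_left, inter_union_distrib_left, hx0, empty_union]
    exact h3
  rw [this]
  simpa using hcard

end PartitionLines

/-! ### Lines of sight from a point off the partition lines -/

section LineOfSight

variable {n : ℕ} {poly : Polygon Plane n}

lemma Arms.onRay_or {F : Set Plane} {y α β α' β' : Plane} (h : Arms F y α β) (h' : Arms F y α' β') :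
    ∃ ε : ℝ, 0 < ε ∧ (OnRay y α' (y + ε • α) ∨ OnRay y β' (y + ε • α)) := by
  obtain ⟨ε, ⟨h1, h2⟩, hε⟩ := (((tendsto_add_smul y α).eventually (h.2.2.and h'.2.2)).and
    eventually_mem_nhdsWithin).exists
  exact ⟨ε, hε, h2.1 (h1.2 (Or.inl ⟨ε, le_of_lt hε, rfl⟩))⟩

/-- Two pairs of arms of `F` at `y` describe the same set near `y`, so `α` is parallel to `α'` or
`β'`; transversality thus does not depend on the chosen arms. -/
lemma Arms.cross_ne_zero {F : Set Plane} {y α β α' β' d : Plane} (h : Arms F y α β)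
    (h' : Arms F y α' β') (hα : cross d α' ≠ 0) (hβ : cross d β' ≠ 0) : cross d α ≠ 0 := by
  intro h0
  have hd : d ≠ 0 := by
    rintro rfl
    simp at hα
  obtain ⟨c, hc⟩ := exists_smul_of_cross_eq_zero hd h0
  have hc0 : c ≠ 0 := by
    rintro rfl
    rw [zero_smul] at hc
    exact h.1 hc
  obtain ⟨ε, hε, h1⟩ := h.onRay_or h'
  have key : ∀ γ, cross d γ ≠ 0 → ¬ OnRay y γ (y + ε • α) := by
    intro γ hγ hray
    have := hray.cross_eq_zero
    rw [add_sub_cancel_left, cross_smul_left, hc, cross_smul_left] at this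
    exact mul_ne_zero hε.ne' (mul_ne_zero hc0 hγ) this
  exact h1.elim (key α' hα) (key β' hβ)

lemma Trans.cross_ne_zero {F : Set Plane} {y α β d : Plane} (h : Trans F y d) (h' : Arms F y α β) :
    cross d α ≠ 0 := by
  obtain ⟨α', β', h1, h2, h3⟩ := h
  exact h'.cross_ne_zero h1 h2.ne' h3.ne

lemma Arms.trans_or_tang {F : Set Plane} {y α β d : Plane} (h : Arms F y α β)
    (hαβ : cross α β ≠ 0 ∨ ∃ c : ℝ, 0 < c ∧ β = -(c • α)) (hα : cross d α ≠ 0) (hβ : cross d β ≠ 0) :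
    Trans F y d ∨ Tang F y d := by
  rcases lt_or_gt_of_ne hα with h1 | h1 <;> rcases lt_or_gt_of_ne hβ with h2 | h2
  · refine Or.inr ⟨α, β, h, mul_pos_of_neg_of_neg h1 h2, ?_⟩
    refine hαβ.resolve_right ?_
    rintro ⟨c, hc, rfl⟩
    rw [cross_neg_right, cross_smul_right] at h2
    nlinarith
  · exact Or.inl ⟨β, α, h.symm, h2, h1⟩
  · exact Or.inl ⟨α, β, h, h1, h2⟩
  · refine Or.inr ⟨α, β, h, mul_pos h1 h2, ?_⟩
    refine hαβ.resolve_right ?_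
    rintro ⟨c, hc, rfl⟩
    rw [cross_neg_right, cross_smul_right] at h2
    nlinarith

/-- Some edge at `x` has the direction `d`. -/
def HasEdgeAlong (poly : Polygon Plane n) (x d : Plane) : Prop :=
  ∃ w F β β', EdgeSplit poly x w F β ∧ EdgeSplit poly w x F β' ∧ cross d (w - x) = 0

lemma vertex_cases (hP : IsSimple poly) {x d : Plane} (hx : ∃ i, x = poly i) :
    HasEdgeAlong poly x d ∨ Trans (poly.boundary ℝ) x d ∨ Tang (poly.boundary ℝ) x d := by
  obtain ⟨j, rfl⟩ := hx
  obtain ⟨i, rfl⟩ : ∃ i, j = finRotate n i := ⟨(finRotate n).symm j, (Equiv.apply_symm_apply _ _).symm⟩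
  obtain ⟨F₁, β₁, β₁', h1, h1'⟩ := hP.exists_edgeSplit i
  obtain ⟨F₂, β₂, β₂', h2, h2'⟩ := hP.exists_edgeSplit (finRotate n i)
  by_cases hα : cross d (poly (finRotate n (finRotate n i)) - poly (finRotate n i)) = 0
  · exact Or.inl ⟨_, _, _, _, h2, h2', hα⟩
  by_cases hβ : cross d (poly i - poly (finRotate n i)) = 0
  · exact Or.inl ⟨_, _, _, _, h1', h1, hβ⟩
  obtain ⟨α, β, harms, hαβ⟩ := hP.exists_arms (vertex_mem_boundary (finRotate n i))
  have hv := hP.arms_vertex i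
  exact Or.inr (harms.trans_or_tang hαβ (harms.cross_ne_zero hv hα hβ) (harms.symm.cross_ne_zero hv hα hβ))

lemma HasEdgeAlong.not_trans {x d : Plane} (h : HasEdgeAlong poly x d) :
    ¬ Trans (poly.boundary ℝ) x d := by
  obtain ⟨w, F, β, β', h1, -, h2⟩ := h
  exact fun h => h.cross_ne_zero h1.arms_boundary h2

lemma HasEdgeAlong.smul {x d : Plane} (h : HasEdgeAlong poly x d) (c : ℝ) :
    HasEdgeAlong poly x (c • d) := by
  obtain ⟨w, F, β, β', h1, h2, h3⟩ := h
  exact ⟨w, F, β, β', h1, h2, by rw [cross_smul_left, h3, mul_zero]⟩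

/-- A point at which the line of sight does not cross the boundary transversally is a vertex or has a
vertex before it. -/
lemma vertex_or_hasEdgeAlong (hP : IsSimple poly) {p z y : Plane} (hp : p ∉ poly.boundary ℝ)
    (hpz : p ≠ z) (hy : y ∈ poly.boundary ℝ) (hys : y ∈ openSeg p z)
    (hT : ¬ Trans (poly.boundary ℝ) y (z - p)) :
    (∃ i, y = poly i) ∨ ∃ e, (∃ i, e = poly i) ∧ e ∈ openSeg p y ∧ HasEdgeAlong poly e (z - p) := by
  rcases boundary_cases hy with ⟨i, hi⟩ | ⟨i, rfl⟩
  swap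
  · exact Or.inl ⟨_, rfl⟩
  right
  obtain ⟨F, β, β', h1, h2⟩ := hP.exists_edgeSplit i
  have hcr : cross (z - p) (poly (finRotate n i) - poly i) = 0 := by
    by_contra h
    have harms := hP.arms_edge hi
    rcases lt_or_gt_of_ne h with h | h
    · exact hT ⟨_, _, harms.symm, by rw [cross_neg_right]; linarith, h⟩
    · exact hT ⟨_, _, harms, h, by rw [cross_neg_right]; linarith⟩
  obtain ⟨t, ht0, ht1, ht⟩ := hys
  -- Here `y` is inside an edge parallel to the line of sight. Its endpoint nearer to `p` comes
  -- strictly after `p`, because otherwise `p` would be on the edge.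
  have key : ∀ e w β β', EdgeSplit poly e w F β → EdgeSplit poly w e F β' → y ∈ openSeg e w → ∀ c : ℝ, 0 < c →
      w - e = c • (z - p) → (∃ i, e = poly i) →
      ∃ e, (∃ i, e = poly i) ∧ e ∈ openSeg p y ∧ HasEdgeAlong poly e (z - p) := by
    rintro e w β β' h1 h2 ⟨s, hs0, hs1, hs⟩ c hc hwe he
    refine ⟨e, he, ?_, w, F, β, β', h1, h2, by rw [hwe, cross_smul_right, cross_self, mul_zero]⟩
    have he' : e = p + (t - s * c) • (z - p) := by
      rw [show e = y - s • (w - e) by rw [hs]; abel, ht, hwe]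
      module
    have hpos : 0 < t - s * c := by
      by_contra! h
      refine hp ((h1.union p).2 (Or.inr (mem_segment_iff.2 ⟨(s * c - t) / c, ?_, ?_, ?_⟩)))
      · exact div_nonneg (by linarith) hc.le
      · rw [div_le_one hc]
        nlinarith
      · rw [hwe, smul_smul, div_mul_cancel₀ _ hc.ne', he']
        module
    refine ⟨(t - s * c) / t, div_pos hpos ht0, ?_, ?_⟩
    · rw [div_lt_one ht0]
      nlinarith
    · rw [he', ht, add_sub_cancel_left, smul_smul, div_mul_cancel₀ _ ht0.ne']
  obtain ⟨c, hc⟩ := exists_smul_of_cross_eq_zero (sub_ne_zero.2 hpz.symm) hcr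
  rcases lt_trichotomy c 0 with h0 | rfl | h0
  · refine key _ _ _ _ h2 h1 (by rwa [openSeg_symm]) (-c) (by linarith) ?_ ⟨_, rfl⟩
    rw [neg_smul, ← hc]
    abel
  · rw [zero_smul, sub_eq_zero] at hc
    exact absurd hc.symm h1.ne
  · exact key _ _ _ _ h1 h2 hi c h0 hc ⟨_, rfl⟩

lemma openSeg_subset_openSeg {p x z : Plane} (hx : x ∈ openSeg p z) : openSeg p x ⊆ openSeg p z := by
  obtain ⟨t, h0, h1, rfl⟩ := hx
  rintro y ⟨s, hs0, hs1, rfl⟩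
  refine ⟨s * t, by positivity, by nlinarith, ?_⟩
  module

/-- From a point off the partition lines, every line of sight either crosses the boundary transversally
more than `K` times, or crosses it at most `K` times and touches it at most once. -/
lemma crossings_cases (hP : IsSimple poly) {k K : ℕ} (hK : Even K) (hKk : K ≤ k) {p z : Plane}
    (hp : p ∈ inside poly) (hpn : p ∉ partitionLines poly k) (hpz : p ≠ z) :
    (∃ S : Finset Plane, S.card = K + 1 ∧
      ∀ y ∈ S, y ∈ openSeg p z ∧ Trans (poly.boundary ℝ) y (z - p)) ∨
    ∃ S : Finset Plane, S.card ≤ K ∧ (∀ y ∈ S, y ∈ openSeg p z ∧ Trans (poly.boundary ℝ) y (z - p)) ∧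
      (((∀ y ∈ poly.boundary ℝ, y ∈ openSeg p z → y ∈ S) ∧
        ((∃ i, z = poly i) → Trans (poly.boundary ℝ) z (z - p) ∨ Tang (poly.boundary ℝ) z (z - p))) ∨
      ∃ w, w ∈ openSeg p z ∧ Tang (poly.boundary ℝ) w (z - p) ∧ w ∉ S ∧
        (∀ y ∈ poly.boundary ℝ, y ∈ openSeg p z → y ∈ S ∨ y = w) ∧ ¬ ∃ i, z = poly i) := by
  classical
  set T : Set Plane := {y | y ∈ openSeg p z ∧ Trans (poly.boundary ℝ) y (z - p)} with hTdef
  by_cases hT : (K + 1 : ℕ∞) ≤ T.encard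
  · left
    obtain ⟨S, hST, hS⟩ := exists_subset_encard_eq hT
    have hfin : S.Finite := finite_of_encard_eq_coe (k := K + 1) (by rw [hS]; rfl)
    refine ⟨hfin.toFinset, ?_, fun y hy => hST (hfin.mem_toFinset.1 hy)⟩
    have := hfin.encard_eq_coe_toFinset_card
    rw [hS] at this
    exact_mod_cast this.symm
  right
  have hT' : T.encard ≤ K := by
    rw [not_le] at hT
    exact ENat.lt_add_one_iff (ENat.natCast_ne_top K) |>.1 hT
  have hfin : T.Finite := finite_of_encard_le_coe hT'
  set S := hfin.toFinset with hSdef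
  have hSmem : ∀ y, y ∈ S ↔ y ∈ openSeg p z ∧ Trans (poly.boundary ℝ) y (z - p) := by
    intro y
    rw [hSdef, hfin.mem_toFinset, hTdef, mem_ofPred_eq]
  have hcard : S.card ≤ K := by
    rw [hfin.encard_eq_coe_toFinset_card] at hT'
    exact_mod_cast hT'
  have hd : z - p ≠ 0 := sub_ne_zero.2 hpz.symm
  have hsub : ∀ x, x ∈ openSeg p z ∨ x = z →
      (∀ y ∈ openSeg p x, y ∈ openSeg p z) ∧ ∃ c : ℝ, 0 < c ∧ x - p = c • (z - p) := by
    rintro x (hx | rfl)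
    · refine ⟨fun y hy => openSeg_subset_openSeg hx hy, ?_⟩
      obtain ⟨t, h0, h1, rfl⟩ := hx
      exact ⟨t, h0, by abel⟩
    · exact ⟨fun y hy => hy, 1, one_pos, by rw [one_smul]⟩
  have hS' : ∀ x, x ∈ openSeg p z ∨ x = z → ∀ y ∈ S.filter (· ∈ openSeg p x),
      y ∈ openSeg p x ∧ Trans (poly.boundary ℝ) y (x - p) := by
    intro x hx y hy
    rw [Finset.mem_filter, hSmem] at hy
    obtain ⟨-, c, hc, hxc⟩ := hsub x hx
    exact ⟨hy.2, hy.1.2.congr (Eventually.of_forall fun _ => Iff.rfl) hc hxc⟩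
  have hcard' : ∀ x, (S.filter (· ∈ openSeg p x)).card ≤ K :=
    fun x => (Finset.card_filter_le _ _).trans hcard
  -- As long as all earlier crossings are transversal, an edge along the line of sight would put `p`
  -- on a partition line.
  have hcoll : ∀ x, x ∈ openSeg p z ∨ x = z →
      (∀ y ∈ poly.boundary ℝ, y ∈ openSeg p x → y ∈ S) → ¬ HasEdgeAlong poly x (z - p) := by
    intro x hx hxS hedge
    obtain ⟨-, c, hc, hxc⟩ := hsub x hx
    have hedge := hedge.smul c
    rw [← hxc] at hedge
    obtain ⟨w, F, β, β', h1, h2, h3⟩ := hedge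
    exact hpn (mem_partitionLines_of_edgeSplit hP hK hKk h1 h2 hp _ (hS' x hx)
      (fun y hy hys => Finset.mem_filter.2 ⟨hxS y hy hys, hys⟩) (hcard' x) h3)
  -- Likewise, no vertex can come behind a single tangency.
  have htang : ∀ x w, x ∈ openSeg p z ∨ x = z → (∃ i, x = poly i) → w ∈ openSeg p x → w ∉ S →
      Tang (poly.boundary ℝ) w (z - p) →
      (∀ y ∈ poly.boundary ℝ, y ∈ openSeg p x → y ∈ S ∨ y = w) → False := by
    intro x w hx hxv hw hwS hwT hxS
    obtain ⟨-, c, hc, hxc⟩ := hsub x hx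
    refine hpn (mem_partitionLines_of_tang hP hK hKk hp hxv _ (hS' x hx) hw ?_
      (fun h => hwS (Finset.mem_filter.1 h).1) ?_ (hcard' x))
    · obtain ⟨α, β, h1, h2, h3⟩ := hwT
      refine ⟨α, β, h1, ?_, h3⟩
      rw [hxc, cross_smul_left, cross_smul_left]
      have := mul_pos (mul_pos hc hc) h2
      linarith
    · intro y hy hys
      exact (hxS y hy hys).imp_left fun h => Finset.mem_filter.2 ⟨h, hys⟩
  refine ⟨S, hcard, fun y hy => (hSmem y).1 hy, ?_⟩
  obtain ⟨m, hm⟩ := exists_cross_pos hd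
  -- The parameter along the line of sight, as a function of the point; it orders the points of the
  -- segment.
  set τ : Plane → ℝ := fun y => cross (y - p) m / cross (z - p) m with hτ
  have hτt : ∀ t : ℝ, τ (p + t • (z - p)) = t := by
    intro t
    simp only [hτ, add_sub_cancel_left, cross_smul_left]
    field_simp
  have hord : ∀ y ∈ openSeg p z, ∀ x ∈ openSeg p z, y ∈ openSeg p x ↔ τ y < τ x := by
    rintro _ ⟨t, ht0, ht1, rfl⟩ _ ⟨s, hs0, hs1, rfl⟩
    rw [hτt, hτt]
    constructor
    · rintro ⟨u, hu0, hu1, h⟩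
      have := congrArg τ h
      rw [hτt, add_sub_cancel_left, smul_smul, hτt] at this
      rw [this]
      nlinarith
    · intro h
      exact ⟨t / s, by positivity, (div_lt_one hs0).2 h, by
        rw [add_sub_cancel_left, smul_smul, div_mul_cancel₀ _ hs0.ne']⟩
  -- The vertices met non-transversally. By `hbad` every other non-transversal point has one of them
  -- before it, with an edge along the line, so only the first elements of this finite set have to
  -- be examined.
  set V : Set Plane := {y | (∃ i, y = poly i) ∧ y ∈ openSeg p z ∧ y ∉ S} with hVdef
  have hVfin : V.Finite := (finite_range fun i => poly i).subset (by
    rintro y ⟨⟨i, rfl⟩, -⟩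
    exact ⟨i, rfl⟩)
  have hbad : ∀ y ∈ poly.boundary ℝ, y ∈ openSeg p z → y ∉ S →
      y ∈ V ∨ ∃ e ∈ V, τ e < τ y ∧ HasEdgeAlong poly e (z - p) := by
    intro y hy hys hyS
    rcases vertex_or_hasEdgeAlong hP hp.1 hpz hy hys (fun h => hyS ((hSmem y).2 ⟨hys, h⟩)) with h | h
    · exact Or.inl ⟨h, hys, hyS⟩
    · obtain ⟨e, he, hey, hedge⟩ := h
      have hez := openSeg_subset_openSeg hys hey
      exact Or.inr ⟨e, ⟨he, hez, fun h => hedge.not_trans ((hSmem e).1 h).2⟩,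
        (hord e hez y hys).1 hey, hedge⟩
  rcases V.eq_empty_or_nonempty with hV | hV
  · left
    have hall : ∀ y ∈ poly.boundary ℝ, y ∈ openSeg p z → y ∈ S := by
      intro y hy hys
      by_contra hyS
      rcases hbad y hy hys hyS with h | ⟨e, h, -⟩
      · exact eq_empty_iff_forall_notMem.1 hV y h
      · exact eq_empty_iff_forall_notMem.1 hV e h
    exact ⟨hall, fun hz => (vertex_cases hP hz).resolve_left (hcoll z (Or.inr rfl) hall)⟩
  · right
    -- Before the first such vertex all crossings are transversal; `hcoll` leaves only a tangency at
    -- `w`.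
    obtain ⟨w, hw, hmin⟩ := exists_min_image V τ hVfin hV
    have hwS : ∀ y ∈ poly.boundary ℝ, y ∈ openSeg p w → y ∈ S := by
      intro y hy hyw
      by_contra hyS
      have hys := openSeg_subset_openSeg hw.2.1 hyw
      have hlt := (hord y hys w hw.2.1).1 hyw
      rcases hbad y hy hys hyS with h | ⟨e, h, h', -⟩
      · exact (hmin y h).not_gt hlt
      · exact (hmin e h).not_gt (h'.trans hlt)
    have hwe := hcoll w (Or.inl hw.2.1) hwS
    have hwT : Tang (poly.boundary ℝ) w (z - p) :=
      ((vertex_cases hP hw.1).resolve_left hwe).resolve_left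
        fun h => hw.2.2 ((hSmem w).2 ⟨hw.2.1, h⟩)
    -- The first element of `V` after `w` would be a vertex behind the tangency at `w`, contrary to
    -- `htang`.
    have hVw : ∀ x ∈ V, x = w := by
      by_contra! hx
      obtain ⟨x₀, hx₀, hx₀w⟩ := hx
      obtain ⟨x, ⟨hx, hxw⟩, hmin'⟩ := exists_min_image (V \ {w}) τ hVfin.sdiff ⟨x₀, hx₀, hx₀w⟩
      refine htang x w (Or.inl hx.2.1) hx.1 ?_ hw.2.2 hwT ?_
      · rw [hord w hw.2.1 x hx.2.1]
        refine (hmin x hx).lt_of_ne ?_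
        intro h
        apply hxw
        obtain ⟨t, -, -, rfl⟩ := hx.2.1
        obtain ⟨s, -, -, rfl⟩ := hw.2.1
        rw [hτt, hτt] at h
        rw [h]
        rfl
      · intro y hy hyx
        by_contra! hne
        have hys := openSeg_subset_openSeg hx.2.1 hyx
        have hlt := (hord y hys x hx.2.1).1 hyx
        rcases hbad y hy hys hne.1 with h | ⟨e, h, h', hedge⟩
        · exact (hmin' y ⟨h, hne.2⟩).not_gt hlt
        · refine (hmin' e ⟨h, ?_⟩).not_gt (h'.trans hlt)
          rintro rfl
          exact hwe hedge
    have hall : ∀ y ∈ poly.boundary ℝ, y ∈ openSeg p z → y ∈ S ∨ y = w := by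
      intro y hy hys
      by_contra! hne
      rcases hbad y hy hys hne.1 with h | ⟨e, h, h', hedge⟩
      · exact hne.2 (hVw y h)
      · exact hwe (hVw e h ▸ hedge)
    exact ⟨w, hw.2.1, hwT, hw.2.2, hall, fun hz => htang z w (Or.inr rfl) hz hw.2.1 hw.2.2 hwT hall⟩

end LineOfSight

/-! ### Criteria for tameness of the unseen sets -/

section TameNear

/-- The version of `TameAt` for a family of sets that is indexed by points of the plane. -/
def TameNear (U : Plane → Set Plane) (p z : Plane) : Prop :=
  ∀ G : Set Plane, IsOpen G → z ∈ G → ∃ B : Set Plane, IsOpen B ∧ z ∈ B ∧ B ⊆ G ∧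
    ((∀ᶠ p' in 𝓝 p, B ∩ U p' = ∅) ∨
      ∃ q ∈ B, (∀ᶠ p' in 𝓝 p, IsPreconnected (B ∩ U p') ∧
          IsPreconnected (B ∩ interior (U p')) ∧ q ∈ interior (U p')) ∧
        (z ∈ interior (U p) → ∀ᶠ p' in 𝓝 p, B ⊆ U p'))

lemma TameNear.comp {U : Plane → Set Plane} {γ : ℝ → Plane} {I : Set ℝ} {τ : ℝ} {z : Plane}
    (h : TameNear U (γ τ) z) (hγ : Tendsto γ (𝓝[I] τ) (𝓝 (γ τ))) :
    TameAt (fun τ => U (γ τ)) I τ z := by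
  intro G hG hz
  obtain ⟨B, h1, h2, h3, h4 | ⟨q, hq, h4, h5⟩⟩ := h G hG hz
  · exact ⟨B, h1, h2, h3, Or.inl (hγ.eventually h4)⟩
  · exact ⟨B, h1, h2, h3, Or.inr ⟨q, hq, hγ.eventually h4, fun h => hγ.eventually (h5 h)⟩⟩

/-- The radius around `z` is chosen before the neighborhood of `p`, in the order that `TameNear`
requires. -/
lemma eventually_ball {p z : Plane} {Q : Plane × Plane → Prop} (h : ∀ᶠ w in 𝓝 (p, z), Q w) :
    ∀ᶠ r in 𝓝[>] (0 : ℝ), ∀ᶠ p' in 𝓝 p, ∀ q ∈ Metric.ball z r, Q (p', q) := by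
  obtain ⟨P₁, h1, P₂, h2, h⟩ := eventually_prod_iff.1 (nhds_prod_eq (x := p) (y := z) ▸ h)
  obtain ⟨ρ, hρ, hball⟩ := Metric.eventually_nhds_iff_ball.1 h2
  filter_upwards [Ioo_mem_nhdsGT hρ] with r hr
  filter_upwards [h1] with p' h1 q hq
  exact h h1 (hball q (Metric.ball_subset_ball hr.2.le hq))

lemma eventually_ball_subset {z : Plane} {G : Set Plane} (hG : IsOpen G) (hz : z ∈ G) :
    ∀ᶠ r in 𝓝[>] (0 : ℝ), Metric.ball z r ⊆ G := by
  obtain ⟨ρ, hρ, hball⟩ := Metric.isOpen_iff.1 hG z hz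
  filter_upwards [Ioo_mem_nhdsGT hρ] with r hr
  exact (Metric.ball_subset_ball hr.2.le).trans hball

lemma tameNear_of_notMem {U : Plane → Set Plane} {p z : Plane}
    (h : ∀ᶠ w : Plane × Plane in 𝓝 (p, z), w.2 ∉ U w.1) : TameNear U p z := by
  intro G hG hz
  obtain ⟨r, ⟨h1, h2⟩, hr⟩ := (((eventually_ball h).and (eventually_ball_subset hG hz)).and
    eventually_mem_nhdsWithin).exists
  refine ⟨_, Metric.isOpen_ball, Metric.mem_ball_self hr, h2, Or.inl ?_⟩
  filter_upwards [h1] with p' h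
  rw [eq_empty_iff_forall_notMem]
  exact fun q hq => h q hq.1 hq.2

/-- A ball meets a convex set, and the interior of a convex set, in a convex set, so connectedness
is automatic even though `W` moves. `O` supplies an interior point common to all nearby `p'`. By
`hv'` the point `z` is not interior, so the last clause of tameness is void. -/
lemma tameNear_of_convex {U W : Plane → Set Plane} {p z : Plane} (hW : ∀ p', Convex ℝ (W p'))
    (h : ∀ᶠ w : Plane × Plane in 𝓝 (p, z), (w.2 ∈ U w.1 ↔ w.2 ∈ W w.1))
    {O : Set (Plane × Plane)} (hO : IsOpen O) (hOU : ∀ w ∈ O, w.2 ∈ W w.1) {v v' : Plane}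
    (hv : ∀ᶠ ε in 𝓝[>] (0 : ℝ), (p, z + ε • v) ∈ O)
    (hv' : ∀ᶠ ε in 𝓝[>] (0 : ℝ), z + ε • v' ∉ W p) : TameNear U p z := by
  intro G hG hz
  obtain ⟨r, ⟨h1, h2⟩, hr⟩ := (((eventually_ball h).and (eventually_ball_subset hG hz)).and
    eventually_mem_nhdsWithin).exists
  have hr : 0 < r := hr
  have hzB := Metric.mem_ball_self (x := z) hr
  obtain ⟨ε, hε, hεB⟩ := (hv.and ((tendsto_add_smul z v).eventually
    (Metric.isOpen_ball.mem_nhds hzB))).exists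
  refine ⟨_, Metric.isOpen_ball, hzB, h2, Or.inr ⟨z + ε • v, hεB, ?_, ?_⟩⟩
  · have hc : Continuous fun p' : Plane => (p', z + ε • v) := by fun_prop
    filter_upwards [h1, hc.continuousAt.eventually (hO.mem_nhds hε)] with p' h1 h3
    have heq : Metric.ball z r ∩ U p' = Metric.ball z r ∩ W p' := by
      ext q
      exact and_congr_right fun hq => h1 q hq
    have hconv : Convex ℝ (Metric.ball z r ∩ W p') := (convex_ball z r).inter (hW p')
    refine ⟨heq ▸ hconv.isPreconnected, ?_, ?_⟩
    · have : Metric.ball z r ∩ interior (U p') = interior (Metric.ball z r ∩ U p') := by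
        rw [interior_inter, Metric.isOpen_ball.interior_eq]
      rw [this, heq]
      exact hconv.interior.isPreconnected
    · have hc' : Continuous fun q : Plane => (p', q) := by fun_prop
      refine mem_interior.2 ⟨Metric.ball z r ∩ (fun q : Plane => (p', q)) ⁻¹' O, ?_,
        Metric.isOpen_ball.inter (hO.preimage hc'), hεB, h3⟩
      rintro q ⟨hq, hqO⟩
      exact (h1 q hq).2 (hOU _ hqO)
  · intro hint
    exfalso
    obtain ⟨ε, ⟨h3, h4⟩, h5⟩ := (((tendsto_add_smul z v').eventually
      (isOpen_interior.mem_nhds hint)).and ((tendsto_add_smul z v').eventually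
      (Metric.isOpen_ball.mem_nhds hzB)) |>.and hv').exists
    exact h5 ((h1.self_of_nhds _ h4).1 (interior_subset h3))

variable {n : ℕ} {poly : Polygon Plane n}

lemma exists_nhds_inside (hP : IsSimple poly) {z : Plane} (hz : z ∈ region poly) {G : Set Plane}
    (hG : IsOpen G) (hzG : z ∈ G) : ∃ B, IsOpen B ∧ z ∈ B ∧ B ⊆ G ∧
      IsPreconnected (B ∩ inside poly) ∧ (B ∩ inside poly).Nonempty ∧
      B ∩ region poly ⊆ closure (B ∩ inside poly) ∧ (z ∈ interior (region poly) → B ⊆ inside poly) := by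
  rcases hz with hz | hz
  · obtain ⟨B, h1, h2, h3, h4, h5, h6, h7⟩ := exists_sector hP hz hG hzG
    exact ⟨B, h1, h2, h3, h4, h5, h6, fun h => absurd h h7⟩
  · obtain ⟨r, ⟨h1, h2⟩, hr⟩ := (((eventually_ball_subset (isOpen_inside hP) hz).and
      (eventually_ball_subset hG hzG)).and eventually_mem_nhdsWithin).exists
    have heq : Metric.ball z r ∩ inside poly = Metric.ball z r := inter_eq_left.2 h1
    refine ⟨_, Metric.isOpen_ball, Metric.mem_ball_self hr, h2, ?_⟩
    rw [heq]
    exact ⟨(convex_ball z r).isPreconnected, ⟨z, Metric.mem_ball_self hr⟩,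
      inter_subset_left.trans subset_closure, fun _ => h1⟩

/-- Near `z` the unseen set lies between the connected set `B ∩ inside poly` and its closure. So it
is connected, whichever boundary points happen to be seen. -/
lemma tameNear_of_inside (hP : IsSimple poly) {k : ℕ} {p z : Plane} (hz : z ∈ region poly)
    (h : ∀ᶠ w : Plane × Plane in 𝓝 (p, z), w.2 ∈ inside poly → w.2 ∈ unseen poly k w.1) :
    TameNear (unseen poly k) p z := by
  intro G hG hzG
  obtain ⟨r, ⟨h1, h2⟩, hr⟩ := (((eventually_ball h).and (eventually_ball_subset hG hzG)).and
    eventually_mem_nhdsWithin).exists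
  obtain ⟨B, hB, hzB, hBr, hc, ⟨q, hq⟩, hcl, hint⟩ := exists_nhds_inside hP hz Metric.isOpen_ball
    (Metric.mem_ball_self (x := z) hr)
  have hsub : ∀ᶠ p' in 𝓝 p, B ∩ inside poly ⊆ unseen poly k p' := by
    filter_upwards [h1] with p' h1 q hq
    exact h1 q (hBr hq.1) hq.2
  have hBo : IsOpen (B ∩ inside poly) := hB.inter (isOpen_inside hP)
  refine ⟨B, hB, hzB, hBr.trans h2, Or.inr ⟨q, hq.1, ?_, ?_⟩⟩
  · filter_upwards [hsub] with p' hsub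
    have hsub' : B ∩ inside poly ⊆ interior (unseen poly k p') := interior_maximal hsub hBo
    refine ⟨hc.subset_closure (subset_inter inter_subset_left hsub) ?_,
      hc.subset_closure (subset_inter inter_subset_left hsub') ?_, hsub' hq⟩
    · exact fun x hx => hcl ⟨hx.1, hx.2.1⟩
    · exact fun x hx => hcl ⟨hx.1, (interior_subset hx.2).1⟩
  · intro hzi
    have hBi := hint (interior_mono (fun x hx => hx.1) hzi)
    filter_upwards [hsub] with p' hsub x hx
    exact hsub ⟨hx, hBi hx⟩

lemma mem_unseen_iff {k : ℕ} {p q : Plane} (hpq : p ≠ q) :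
    q ∈ unseen poly k p ↔ q ∈ region poly ∧ (k : ℕ∞) < (poly.boundary ℝ ∩ openSeg p q).encard := by
  rw [unseen, mem_ofPred_eq, visible_iff hpq, not_le]

/-- The side of the endpoint of a segment that crosses the boundary transversally, up to one
tangency. -/
lemma inside_iff_even (hP : IsSimple poly) {p q : Plane} (hp : p ∈ inside poly)
    (hq : q ∉ poly.boundary ℝ) (hpq : p ≠ q) (R : Finset Plane)
    (hR : ∀ y ∈ R, y ∈ openSeg p q ∧ Tang (poly.boundary ℝ) y (q - p))
    (hR1 : (R : Set Plane).Subsingleton)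
    (hT : ∀ y ∈ poly.boundary ℝ ∩ openSeg p q, y ∉ R → Trans (poly.boundary ℝ) y (q - p)) {N : ℕ}
    (hN : (poly.boundary ℝ ∩ openSeg p q).encard = N + R.card) : q ∈ inside poly ↔ Even N := by
  classical
  have hfin : (poly.boundary ℝ ∩ openSeg p q).Finite :=
    finite_of_encard_eq_coe (k := N + R.card) (by rw [hN]; push_cast; rfl)
  have hRs : R ⊆ hfin.toFinset := by
    intro y hy
    obtain ⟨h1, α, β, h2, -⟩ := hR y hy
    exact hfin.mem_toFinset.2 ⟨h2.mem, h1⟩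
  have hcard : (hfin.toFinset \ R).card = N := by
    have := hfin.encard_eq_coe_toFinset_card
    rw [hN] at this
    have : N + R.card = hfin.toFinset.card := by exact_mod_cast this
    rw [Finset.card_sdiff_of_subset hRs, ← this]
    simp
  have := inside_iff_inside_iff_even_card hP hp.1 hq hpq (hfin.toFinset \ R) R ?_ hR hR1 ?_ ?_
  · rw [← hcard, ← this]
    simp [hp]
  · intro y hy
    rw [Finset.mem_sdiff, hfin.mem_toFinset] at hy
    exact ⟨hy.1.2, hT y hy.1 hy.2⟩
  · exact fun y hy => (Finset.mem_sdiff.1 hy).2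
  · intro y h1 h2
    by_cases h : y ∈ R
    · exact Or.inr h
    · exact Or.inl (Finset.mem_sdiff.2 ⟨hfin.mem_toFinset.2 ⟨h1, h2⟩, h⟩)

lemma even_of_trans (hP : IsSimple poly) {p q : Plane} (hp : p ∈ inside poly)
    (hq : q ∈ inside poly) (hpq : p ≠ q)
    (hT : ∀ y ∈ poly.boundary ℝ ∩ openSeg p q, Trans (poly.boundary ℝ) y (q - p)) {N : ℕ}
    (hN : (poly.boundary ℝ ∩ openSeg p q).encard = N) : Even N :=
  (inside_iff_even hP hp hq.1 hpq ∅ (by simp) (by simp) (fun y hy _ => hT y hy) (by simpa using hN)).1 hq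

end TameNear

/-! ### Segments that end near a boundary point -/

section EndHits

/-- A segment close to `p z` that ends near a point at which the extension of `p z` crosses `F`
transversally. -/
lemma Trans.eventually_end {F : Set Plane} {p z : Plane} (hpz : p ≠ z) (h : Trans F z (z - p)) :
    ∀ᶠ r in 𝓝[>] (0 : ℝ), ∀ᶠ w : Plane × Plane in 𝓝 (p, z),
      (F ∩ openSeg w.1 w.2 ∩ Metric.ball z r).encard ≤ 1 ∧
      (∀ x ∈ F ∩ openSeg w.1 w.2 ∩ Metric.ball z r, Trans F x (w.2 - w.1)) ∧
      (w.2 ∈ F → F ∩ openSeg w.1 w.2 ∩ Metric.ball z r = ∅) := by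
  -- Doubling the segment makes its endpoint `z` an inner point, to which the result on inner
  -- crossings applies.
  have hz : z ∈ openSeg p (p + (2 : ℝ) • (z - p)) := ⟨1 / 2, by norm_num, by norm_num, by module⟩
  have hT : Trans F z (p + (2 : ℝ) • (z - p) - p) :=
    h.congr (Eventually.of_forall fun _ => Iff.rfl) two_pos (by abel)
  have hc : Continuous fun w : Plane × Plane => (w.1, w.1 + (2 : ℝ) • (w.2 - w.1)) := by fun_prop
  filter_upwards [hT.eventually_hit hz, self_mem_nhdsWithin] with r hr hr0
  have hr0 : 0 < r := hr0
  have hne : ∀ᶠ w : Plane × Plane in 𝓝 (p, z), w.1 ≠ w.2 := by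
    have : IsOpen {w : Plane × Plane | w.1 ≠ w.2} := isOpen_ne_fun continuous_fst continuous_snd
    exact this.mem_nhds hpz
  have hball : ∀ᶠ w : Plane × Plane in 𝓝 (p, z), w.2 ∈ Metric.ball z r :=
    continuous_snd.continuousAt.eventually (Metric.isOpen_ball.mem_nhds (Metric.mem_ball_self hr0))
  filter_upwards [hc.continuousAt.eventually hr, hne, hball] with w ⟨x, hx, hxT⟩ hne hball
  simp only [add_sub_cancel_left] at hxT
  have hw2 : w.2 ∈ openSeg w.1 (w.1 + (2 : ℝ) • (w.2 - w.1)) :=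
    ⟨1 / 2, by norm_num, by norm_num, by module⟩
  have hsub : F ∩ openSeg w.1 w.2 ∩ Metric.ball z r ⊆ {x} := by
    rw [← hx]
    exact inter_subset_inter_left _ (inter_subset_inter_right _ (openSeg_subset_openSeg hw2))
  refine ⟨(encard_le_encard hsub).trans (encard_singleton x).le, ?_, ?_⟩
  · intro y hy
    rw [mem_singleton_iff.1 (hsub hy)]
    exact hxT.congr (Eventually.of_forall fun _ => Iff.rfl) (c := 1 / 2) (by norm_num) (by module)
  · intro hwF
    have h2 : w.2 ∈ ({x} : Set Plane) := hx ▸ ⟨⟨hwF, hw2⟩, hball⟩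
    rw [eq_empty_iff_forall_notMem]
    intro y hy
    have h3 := mem_singleton_iff.1 (hsub hy)
    rw [← mem_singleton_iff.1 h2] at h3
    exact right_notMem_openSeg hne (h3 ▸ hy.1.2)

/-- A segment close to `p z` that ends near a point at which the extension of `p z` touches `F`
tangentially; the arm `α` is the farther one. -/
lemma Arms.eventually_end_tang {F : Set Plane} {p z α β : Plane} (harms : Arms F z α β)
    (hpos : 0 < cross (z - p) α * cross (z - p) β) (hD : 0 < cross (z - p) α * cross α β) :
    ∀ᶠ r in 𝓝[>] (0 : ℝ), ∀ᶠ w : Plane × Plane in 𝓝 (p, z),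
      (cross (z - p) α * cross (w.2 - w.1) (z - w.1) < 0 → 0 < cross (z - p) α * cross (w.2 - z) α →
        (F ∩ openSeg w.1 w.2 ∩ Metric.ball z r).encard = 2 ∧ w.2 ∉ F ∧
          ∀ x ∈ F ∩ openSeg w.1 w.2 ∩ Metric.ball z r, Trans F x (w.2 - w.1)) ∧
      (cross (w.2 - w.1) (z - w.1) = 0 → 0 < cross (z - p) α * cross (w.2 - z) α →
        F ∩ openSeg w.1 w.2 ∩ Metric.ball z r = {z} ∧ w.2 ∉ F ∧ Tang F z (w.2 - w.1)) ∧
      (cross (z - p) α * cross (w.2 - w.1) (z - w.1) < 0 → cross (w.2 - z) α = 0 →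
        (F ∩ openSeg w.1 w.2 ∩ Metric.ball z r).encard = 1 ∧ w.2 ∈ F) ∧
      (¬ (cross (z - p) α * cross (w.2 - w.1) (z - w.1) ≤ 0 ∧ 0 ≤ cross (z - p) α * cross (w.2 - z) α ∧
          0 < cross (z - p) α * cross (w.2 - z) α - cross (z - p) α * cross (w.2 - w.1) (z - w.1)) →
        F ∩ openSeg w.1 w.2 ∩ Metric.ball z r = ∅ ∨
        (F ∩ openSeg w.1 w.2 ∩ Metric.ball z r).encard = 1 ∧ w.2 ∉ F ∧
          ∀ x ∈ F ∩ openSeg w.1 w.2 ∩ Metric.ball z r, Trans F x (w.2 - w.1)) := by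
  have hα := left_ne_zero_of_mul hpos.ne'
  have hβ := right_ne_zero_of_mul hpos.ne'
  have hαβ := right_ne_zero_of_mul hD.ne'
  filter_upwards [harms.eventually_mem_iff (p := p) (z := z) one_pos (by module) hα hβ,
    harms.eventually_trans (p := p) (z := z) hα hβ hαβ, harms.eventually_radius, self_mem_nhdsWithin]
    with r h2 h3 hrad hr0
  have hr0 : 0 < r := hr0
  have hball : ∀ᶠ w : Plane × Plane in 𝓝 (p, z), w.2 ∈ Metric.ball z r :=
    continuous_snd.continuousAt.eventually (Metric.isOpen_ball.mem_nhds (Metric.mem_ball_self hr0))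
  filter_upwards [h2, h3, hball] with w h2 h3 hball
  obtain ⟨ha, hb, -, -, hmem⟩ := h2
  have hF := hrad w.2 hball
  set κ := cross (z - p) α
  set κ' := cross (z - p) β
  set D := cross α β with hDdef
  set c := cross (w.2 - w.1) α with hcdef
  set c' := cross (w.2 - w.1) β with hcdef'
  set o := cross (w.2 - w.1) (z - w.1) with hodef
  set a := cross (w.2 - z) α with hadef
  set b := cross (w.2 - z) β with hbdef
  have hκ2 : 0 < κ * κ := mul_self_pos.2 hα
  -- Expand `w.2 - z` in the basis `α`, `β` and pair it with `w.2 - w.1`. The identity ties the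
  -- position of `w.2` relative to both arms to the side on which the segment passes the apex.
  have hrel : (κ * D) * (κ * o) = (κ * a) * (c' * κ) - (κ * b) * (c * κ) := by
    have h1 := congrArg (cross (w.2 - w.1)) (cross_expand α β (w.2 - z))
    rw [cross_smul_right, cross_add_right, cross_smul_right, cross_smul_right, cross_swap α (w.2 - z)] at h1
    have h4 : cross (w.2 - w.1) (w.2 - z) = -o := by
      rw [hodef, show w.2 - z = (w.2 - w.1) - (z - w.1) by abel, cross_sub_right, cross_self, zero_sub]
    rw [h4] at h1
    linear_combination (-(κ * κ)) * h1
  have hb : 0 < c' * κ := by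
    have : 0 < (c' * κ) * (κ' * κ') := by nlinarith [mul_pos hb hpos]
    exact pos_of_mul_pos_left this (mul_self_nonneg κ')
  have hc0 : c ≠ 0 := left_ne_zero_of_mul ha.ne'
  have hc0' : c' ≠ 0 := left_ne_zero_of_mul hb.ne'
  have hsgn1 : ∀ e : ℝ, 0 < e * κ → (o * e ≤ 0 ↔ κ * o ≤ 0) := by
    intro e he
    have h1 : (κ * κ) * (o * e) = (κ * o) * (e * κ) := by ring
    constructor
    · intro h
      by_contra! h'
      have := mul_pos h' he
      nlinarith
    · intro h
      by_contra! h'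
      have := mul_pos hκ2 h'
      nlinarith
  have hsgn2 : ∀ e f : ℝ, 0 < e * κ → (0 < e * f ↔ 0 < κ * f) := by
    intro e f he
    have h1 : (κ * κ) * (e * f) = (κ * f) * (e * κ) := by ring
    constructor
    · intro h
      have := mul_pos hκ2 h
      rw [h1] at this
      exact pos_of_mul_pos_left this he.le
    · intro h
      have := mul_pos h he
      rw [← h1] at this
      exact pos_of_mul_pos_right this hκ2.le
  simp only [hsgn1 c ha, hsgn1 c' hb, hsgn2 c a ha, hsgn2 c' b hb] at hmem
  have hne : ∀ γ, γ ≠ 0 → cross (w.2 - w.1) γ ≠ 0 → κ * o ≠ 0 → hit z γ w.1 w.2 ≠ z := by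
    intro γ hγ hcγ ho h
    have := hit_sub z γ w.1 w.2
    rw [h, sub_self] at this
    simp [hγ, hcγ, ← hodef, right_ne_zero_of_mul ho] at this
  have hhit : o = 0 → ∀ γ, hit z γ w.1 w.2 = z := by
    intro ho γ
    rw [hit, ← hodef, ho, zero_div, zero_smul, sub_zero]
  have hFβ : OnRay z β w.2 → κ * a ≤ 0 ∧ κ * b = 0 := by
    rintro ⟨s, hs, h⟩
    rw [hadef, hbdef, h, add_sub_cancel_left, cross_smul_left, cross_smul_left, cross_self,
      cross_swap β, ← hDdef]
    exact ⟨by nlinarith [mul_nonneg hs hD.le], by ring⟩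
  have hnF : κ * a ≠ 0 → (κ * a ≤ 0 → κ * b ≠ 0) → w.2 ∉ F := by
    intro h1 h4 hwF
    rcases hF.1 hwF with h | h
    · exact h1 (by rw [hadef, h.cross_eq_zero, mul_zero])
    · exact h4 (hFβ h).1 (hFβ h).2
  -- On the side where the arms can be met, an endpoint that has reached the farther arm is already
  -- past the nearer one.
  have hbpos : κ * o ≤ 0 → 0 ≤ κ * a → 0 < κ * a - κ * o → 0 < κ * b := by
    intro h1 h4 h5
    have : 0 < (κ * b) * (c * κ) := by
      rcases h4.eq_or_lt with h | h
      · nlinarith [mul_pos hD (show 0 < -(κ * o) by linarith)]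
      · nlinarith [mul_pos h hb, mul_nonneg hD.le (neg_nonneg.2 h1)]
    exact pos_of_mul_pos_left this ha.le
  refine ⟨fun ho hA => ?_, fun ho hA => ?_, fun ho hA => ?_, fun hno => ?_⟩
  · have hB := hbpos ho.le hA.le (by linarith)
    have hset : F ∩ openSeg w.1 w.2 ∩ Metric.ball z r = {hit z α w.1 w.2, hit z β w.1 w.2} := by
      ext x
      rw [hmem]
      simp [ho.le, hA, hB]
    refine ⟨?_, hnF hA.ne' fun h => absurd h (not_le.2 hA), ?_⟩
    · rw [hset, encard_pair]
      intro h
      have g1 := hit_sub z α w.1 w.2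
      rw [h, hit_sub z β w.1 w.2] at g1
      have g2 := congrArg (fun v => cross v β) g1
      simp only [cross_smul_left, cross_self, mul_zero, ← hodef, ← hcdef] at g2
      exact mul_ne_zero (neg_ne_zero.2 (div_ne_zero (right_ne_zero_of_mul ho.ne) hc0)) hαβ g2.symm
    · intro x hx
      refine h3 x hx ?_
      rw [hset] at hx
      rcases hx with rfl | hx
      · exact hne α harms.1 hc0 ho.ne
      · rw [mem_singleton_iff] at hx
        rw [hx]
        exact hne β harms.2.1 hc0' ho.ne
  · have hO : κ * o = 0 := by rw [ho, mul_zero]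
    have hB := hbpos hO.le hA.le (by linarith)
    refine ⟨?_, hnF hA.ne' fun h => absurd h (not_le.2 hA), α, β, harms, ?_, hαβ⟩
    · ext x
      rw [hmem, hhit ho, hhit ho, mem_singleton_iff]
      simp [hO, hA, hB]
    · have : 0 < (c * c') * (κ * κ) := by nlinarith [mul_pos ha hb]
      exact pos_of_mul_pos_left this hκ2.le
  · have hA0 : κ * a = 0 := by rw [hA, mul_zero]
    have hB := hbpos ho.le hA0.ge (by linarith)
    constructor
    · rw [encard_eq_one]
      refine ⟨hit z β w.1 w.2, ?_⟩
      ext x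
      rw [hmem]
      simp [hA0, ho.le, hB]
    · rw [hF]
      left
      refine ⟨b / D, ?_, ?_⟩
      · rw [show b / D = (κ * b) / (κ * D) by rw [mul_div_mul_left _ _ hα]]
        positivity
      · have := cross_expand' hαβ (w.2 - z)
        rw [cross_swap α (w.2 - z), ← hadef, hA, neg_zero, zero_div, zero_smul, add_zero] at this
        rw [← this]
        abel
  -- Outside the wedge behind the arms the segment meets no arm, or it ends between the arms and
  -- crosses only `β`. If `κ * o` and `κ * a` both vanish, so does `κ * b`, and there is no
  -- crossing.
  · rcases lt_or_ge 0 (κ * o) with hO | hO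
    · left
      ext x
      rw [hmem]
      simp [not_le.2 hO]
    rcases lt_or_ge (κ * a) 0 with hA | hA
    · rcases lt_or_ge 0 (κ * b) with hB | hB
      · right
        have ho : κ * o < 0 := by
          have h5 : (κ * D) * (κ * o) < 0 := by
            rw [hrel]
            nlinarith [mul_pos hB ha, mul_pos (neg_pos.2 hA) hb]
          by_contra! h
          nlinarith [mul_nonneg hD.le h]
        have hset : F ∩ openSeg w.1 w.2 ∩ Metric.ball z r = {hit z β w.1 w.2} := by
          ext x
          rw [hmem]
          simp [hA.not_gt, hB, hO]
        refine ⟨by rw [hset, encard_singleton], hnF hA.ne fun _ => hB.ne', fun x hx => h3 x hx ?_⟩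
        rw [hset, mem_singleton_iff] at hx
        rw [hx]
        exact hne β harms.2.1 hc0' ho.ne
      · left
        ext x
        rw [hmem]
        simp [hA.not_gt, hB.not_gt]
    · left
      have h6 : κ * a - κ * o ≤ 0 := by
        by_contra! h
        exact hno ⟨hO, hA, h⟩
      have hA0 : κ * a = 0 := by linarith
      have hO0 : κ * o = 0 := by linarith
      have hB : κ * b = 0 := by
        rw [hA0, hO0] at hrel
        simp at hrel
        simpa [hα, hc0] using hrel
      ext x
      rw [hmem]
      simp [hA0, hB]

end EndHits

/-! ### Tameness with no tangency before the endpoint -/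

section Local

variable {n : ℕ} {poly : Polygon Plane n}

/-- Near `z`, the polygon is all of the plane or a half-plane whose edge does not point towards `p`. -/
lemma exists_halfPlane (hP : IsSimple poly) {p z : Plane} (hz : z ∈ region poly) (hpz : p ≠ z)
    (hzv : ¬ ∃ i, z = poly i) (hfin : (poly.boundary ℝ ∩ openSeg p z).Finite) :
    (z ∉ poly.boundary ℝ ∨ Trans (poly.boundary ℝ) z (z - p)) ∧
    ∃ (ν : Plane) (c : ℝ), (c = 1 ∧ ν = 0 ∨ c = 0 ∧ cross (z - p) ν ≠ 0) ∧
      ∀ᶠ x in 𝓝 z, (x ∈ inside poly ↔ 0 < c + cross (x - z) ν) ∧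
        (x ∈ poly.boundary ℝ ↔ c + cross (x - z) ν = 0) := by
  by_cases hzb : z ∈ poly.boundary ℝ
  · rcases boundary_cases hzb with ⟨i, hi⟩ | ⟨i, hi⟩
    swap
    · exact absurd ⟨_, hi⟩ hzv
    have harms := hP.arms_edge hi
    have harms' : Arms (poly.boundary ℝ) z (poly (finRotate n i) - poly i)
      (-((1 : ℝ) • (poly (finRotate n i) - poly i))) := by rwa [one_smul]
    set α := poly (finRotate n i) - poly i
    -- An edge at `z` pointing towards `p` would overlap the segment in infinitely many points.
    have hcr : cross (z - p) α ≠ 0 := by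
      intro h
      obtain ⟨c, hc⟩ := exists_smul_of_cross_eq_zero harms.1 (by rw [cross_swap, h, neg_zero] :
        cross α (z - p) = 0)
      have hp : p = z - c • α := by rw [← hc]; abel
      rcases le_total 0 c with h0 | h0
      · exact OnRay.not_of_finite harms.symm hpz hfin ⟨c, h0, by rw [hp]; module⟩
      · exact OnRay.not_of_finite harms hpz hfin ⟨-c, by linarith, by rw [hp]; module⟩
    refine ⟨Or.inr ?_, ?_⟩
    · rcases lt_or_gt_of_ne hcr with h | h
      · exact ⟨_, _, harms.symm, by rw [cross_neg_right]; linarith, h⟩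
      · exact ⟨_, _, harms, h, by rw [cross_neg_right]; linarith⟩
    · obtain ⟨σ, hσ, hsec⟩ := sector_of_straight hP one_pos harms'
      obtain ⟨r, ⟨h1, -⟩, hr⟩ := (hsec.and eventually_mem_nhdsWithin).exists
      refine ⟨σ • α, 0, Or.inr ⟨rfl, ?_⟩, ?_⟩
      · rw [cross_smul_right]
        exact mul_ne_zero hσ hcr
      · filter_upwards [Metric.ball_mem_nhds z hr] with x hx
        rw [(h1 x hx).1, (h1 x hx).2, zero_add, cross_smul_right]
        simp [hσ]
  -- With `c = 1` and `ν = 0` the half-plane condition always holds, so both cases share one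
  -- formula.
  · refine ⟨Or.inl hzb, 0, 1, Or.inl ⟨rfl, rfl⟩, ?_⟩
    filter_upwards [(isOpen_inside hP).mem_nhds (hz.resolve_left hzb)] with x hx
    simp [hx, hx.1]

lemma eventually_end_of_trans {p z : Plane} (hpz : p ≠ z)
    (h : z ∉ poly.boundary ℝ ∨ Trans (poly.boundary ℝ) z (z - p)) :
    ∀ᶠ r in 𝓝[>] (0 : ℝ), ∀ᶠ w : Plane × Plane in 𝓝 (p, z),
      (poly.boundary ℝ ∩ openSeg w.1 w.2 ∩ Metric.ball z r).encard ≤ 1 ∧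
      (∀ x ∈ poly.boundary ℝ ∩ openSeg w.1 w.2 ∩ Metric.ball z r,
        Trans (poly.boundary ℝ) x (w.2 - w.1)) ∧
      (w.2 ∈ poly.boundary ℝ → poly.boundary ℝ ∩ openSeg w.1 w.2 ∩ Metric.ball z r = ∅) := by
  rcases h with h | h
  · filter_upwards [eventually_ball_subset (isClosed_boundary poly).isOpen_compl h] with r hr
    refine Eventually.of_forall fun w => ?_
    have : poly.boundary ℝ ∩ openSeg w.1 w.2 ∩ Metric.ball z r = ∅ := by
      rw [eq_empty_iff_forall_notMem]
      exact fun x hx => hr hx.2 hx.1.1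
    simp [this]
  · exact h.eventually_end hpz

lemma mem_or_eq_of_mem_segment {p z : Plane} (hp : p ∉ poly.boundary ℝ) (hpz : p ≠ z) {T : Set Plane}
    (hT : ∀ y ∈ poly.boundary ℝ, y ∈ openSeg p z → y ∈ T) :
    ∀ y ∈ poly.boundary ℝ, y ∈ segment ℝ p z → y ∈ T ∨ y = z := by
  intro y hy hys
  by_cases hyz : y = z
  · exact Or.inr hyz
  · left
    refine hT y hy ?_
    rw [← segment_sdiff hpz]
    refine ⟨hys, ?_⟩
    rintro (rfl | h)
    · exact hp hy
    · exact hyz h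

lemma eventually_count_end {p z : Plane} (hp : p ∉ poly.boundary ℝ) (hpz : p ≠ z) (S : Finset Plane)
    (hS : ∀ y ∈ S, y ∈ openSeg p z ∧ Trans (poly.boundary ℝ) y (z - p))
    (hT : ∀ y ∈ poly.boundary ℝ, y ∈ openSeg p z → y ∈ S) :
    ∀ᶠ r in 𝓝[>] (0 : ℝ), ∀ᶠ w : Plane × Plane in 𝓝 (p, z),
      (poly.boundary ℝ ∩ openSeg w.1 w.2).encard =
        S.card + (poly.boundary ℝ ∩ openSeg w.1 w.2 ∩ Metric.ball z r).encard ∧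
      ∀ x ∈ poly.boundary ℝ ∩ openSeg w.1 w.2, x ∉ Metric.ball z r →
        Trans (poly.boundary ℝ) x (w.2 - w.1) := by
  have := eventually_count (isClosed_boundary poly) S {z} hS ?_ ?_
  · simpa using this
  · intro y hy h
    rw [Finset.mem_singleton] at h
    exact right_notMem_openSeg hpz (h ▸ (hS y hy).1)
  · intro y hy hys
    rw [Finset.mem_singleton]
    exact mem_or_eq_of_mem_segment hp hpz (T := S) hT y hy hys

lemma eventually_count_end_tang {p z t : Plane} (hp : p ∉ poly.boundary ℝ) (hpz : p ≠ z)
    (S : Finset Plane) (hS : ∀ y ∈ S, y ∈ openSeg p z ∧ Trans (poly.boundary ℝ) y (z - p))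
    (ht : t ∈ openSeg p z) (htS : t ∉ S)
    (hT : ∀ y ∈ poly.boundary ℝ, y ∈ openSeg p z → y ∈ S ∨ y = t) :
    ∀ᶠ r in 𝓝[>] (0 : ℝ), ∀ᶠ w : Plane × Plane in 𝓝 (p, z),
      (poly.boundary ℝ ∩ openSeg w.1 w.2).encard =
        S.card + ((poly.boundary ℝ ∩ openSeg w.1 w.2 ∩ Metric.ball t r).encard +
          (poly.boundary ℝ ∩ openSeg w.1 w.2 ∩ Metric.ball z r).encard) ∧
      ∀ x ∈ poly.boundary ℝ ∩ openSeg w.1 w.2, x ∉ Metric.ball t r → x ∉ Metric.ball z r →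
        Trans (poly.boundary ℝ) x (w.2 - w.1) := by
  classical
  have htz : t ≠ z := fun h => right_notMem_openSeg hpz (h ▸ ht)
  have := eventually_count (isClosed_boundary poly) S {t, z} hS ?_ ?_
  · filter_upwards [this, eventually_disjoint_balls {t, z}] with r hr hdisj
    filter_upwards [hr] with w hw
    have hd := hdisj t (by simp) z (by simp) htz
    rw [hw.1, ← encard_union_eq (hd.mono inter_subset_right inter_subset_right),
      ← inter_union_distrib_left]
    constructor
    · simp
    · intro x hx h1 h2
      exact hw.2 x hx (by
        simp only [Finset.mem_insert, Finset.mem_singleton]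
        rintro y (rfl | rfl)
        · exact h1
        · exact h2)
  · intro y hy h
    simp only [Finset.mem_insert, Finset.mem_singleton] at h
    rcases h with rfl | rfl
    · exact htS hy
    · exact right_notMem_openSeg hpz (hS _ hy).1
  · intro y hy hys
    rw [Finset.mem_insert, Finset.mem_singleton, ← or_assoc]
    exact mem_or_eq_of_mem_segment hp hpz (T := {y | y ∈ S ∨ y = t}) hT y hy hys

lemma eventually_inside_and_ne (hP : IsSimple poly) {p z : Plane} (hp : p ∈ inside poly)
    (hpz : p ≠ z) : ∀ᶠ w : Plane × Plane in 𝓝 (p, z), w.1 ∈ inside poly ∧ w.1 ≠ w.2 := by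
  have h1 : IsOpen {w : Plane × Plane | w.1 ≠ w.2} := isOpen_ne_fun continuous_fst continuous_snd
  have h2 : IsOpen {w : Plane × Plane | w.1 ∈ inside poly} := (isOpen_inside hP).preimage continuous_fst
  filter_upwards [h1.mem_nhds hpz, h2.mem_nhds hp] with w h1 h2
  exact ⟨h2, h1⟩

lemma tameNear_self (hP : IsSimple poly) {k : ℕ} {p : Plane} (hp : p ∈ inside poly) :
    TameNear (unseen poly k) p p := by
  refine tameNear_of_notMem ?_
  obtain ⟨r, hr, hball⟩ := Metric.isOpen_iff.1 (isOpen_inside hP) p hp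
  have h1 : IsOpen (Metric.ball p r ×ˢ Metric.ball p r) := Metric.isOpen_ball.prod Metric.isOpen_ball
  filter_upwards [h1.mem_nhds ⟨Metric.mem_ball_self hr, Metric.mem_ball_self hr⟩] with w hw hun
  by_cases hne : w.1 = w.2
  · rw [hne] at hun
    exact hun.2 (visible_self k _)
  · refine hun.2 ?_
    rw [visible_iff hne]
    have : poly.boundary ℝ ∩ openSeg w.1 w.2 = ∅ := by
      rw [eq_empty_iff_forall_notMem]
      rintro x ⟨h2, h3⟩
      exact (hball ((convex_ball p r).segment_subset hw.1 hw.2 (openSeg_subset_segment _ _ h3))).1 h2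
    simp [this]

variable {k K : ℕ}

/-- Behind more than `K` transversal crossings nothing inside is seen. -/
lemma tameNear_of_many (hP : IsSimple poly) (hK : Even K) (hkK : k = K ∨ k = K + 1)
    {p z : Plane} (hp : p ∈ inside poly) (hz : z ∈ region poly) (hpz : p ≠ z) (S : Finset Plane)
    (hcard : S.card = K + 1)
    (hS : ∀ y ∈ S, y ∈ openSeg p z ∧ Trans (poly.boundary ℝ) y (z - p)) :
    TameNear (unseen poly k) p z := by
  refine tameNear_of_inside hP hz ?_
  obtain ⟨r, hr⟩ := (eventually_exists_crossings S hS).exists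
  filter_upwards [hr, eventually_inside_and_ne hP hp hpz] with w ⟨h1, h2⟩ ⟨h3, h4⟩ hin
  rw [mem_unseen_iff h4]
  refine ⟨Or.inr hin, ?_⟩
  rw [hcard] at h1
  have hle := encard_le_encard (inter_subset_left : poly.boundary ℝ ∩ openSeg w.1 w.2 ∩
    ⋃ y ∈ S, Metric.ball y r ⊆ _)
  by_contra! hk
  rw [h1] at hle
  -- If the point were seen, there would be exactly `K + 1` crossings, all transversal; this number
  -- is odd, which is impossible for an enclosed endpoint.
  have h5 : (poly.boundary ℝ ∩ openSeg w.1 w.2).encard = ((K + 1 : ℕ) : ℕ∞) := by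
    refine le_antisymm (hk.trans ?_) hle
    rcases hkK with rfl | rfl
    · exact_mod_cast Nat.le_succ _
    · exact le_rfl
  have hfin := finite_of_encard_eq_coe h5
  have h6 := (hfin.subset (inter_subset_left (t := ⋃ y ∈ S, Metric.ball y r))).eq_of_subset_of_encard_le
    inter_subset_left (h5.trans h1.symm).le
  have := even_of_trans hP h3 hin h4 (fun y hy => h2 y (h6.symm ▸ hy)) h5
  exact (Nat.not_even_iff_odd.2 hK.add_one) this

/-- Behind at most `K` crossings, all of them transversal, everything is seen. -/
lemma tameNear_of_few (hP : IsSimple poly) (hK : Even K) (hkK : k = K ∨ k = K + 1)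
    {p z : Plane} (hp : p ∈ inside poly) (hpz : p ≠ z) (S : Finset Plane)
    (hcard : S.card ≤ K) (hS : ∀ y ∈ S, y ∈ openSeg p z ∧ Trans (poly.boundary ℝ) y (z - p))
    (hT : ∀ y ∈ poly.boundary ℝ, y ∈ openSeg p z → y ∈ S)
    (h : z ∉ poly.boundary ℝ ∨ Trans (poly.boundary ℝ) z (z - p)) :
    TameNear (unseen poly k) p z := by
  refine tameNear_of_notMem ?_
  obtain ⟨r, h1, h2⟩ := ((eventually_count_end hp.1 hpz S hS hT).and
    (eventually_end_of_trans hpz h)).exists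
  filter_upwards [h1, h2, eventually_inside_and_ne hP hp hpz] with w ⟨h1, h2⟩ ⟨h3, h4, h5⟩ ⟨h6, h7⟩
  rw [mem_unseen_iff h7]
  rintro ⟨hreg, hlt⟩
  rcases hreg with hb | hin
  · rw [h1, h5 hb, encard_empty, add_zero] at hlt
    have : k < S.card := by exact_mod_cast hlt
    omega
  -- There is at most one further crossing, near `z`. The total is at most `K + 1` and even, hence
  -- at most `K`.
  · obtain ⟨N, hN⟩ := ENat.ne_top_iff_exists.1 (ne_top_of_le_ne_top (ENat.natCast_ne_top 1) h3)
    rw [← hN] at h1 h3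
    have h3 : N ≤ 1 := by exact_mod_cast h3
    rw [h1] at hlt
    have hlt : k < S.card + N := by exact_mod_cast hlt
    have := even_of_trans hP h6 hin h7 (N := S.card + N) (fun y hy => by
      by_cases hyb : y ∈ Metric.ball z r
      · exact h4 y ⟨hy, hyb⟩
      · exact h2 y hy hyb) (by rw [h1]; push_cast; rfl)
    obtain ⟨a, ha⟩ := this
    obtain ⟨b, hb⟩ := hK
    omega

/-- An affine function on the plane. -/
def IsAff (L : Plane → ℝ) : Prop :=
  ∀ (x y : Plane) (s t : ℝ), s + t = 1 → L (s • x + t • y) = s * L x + t * L y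

lemma IsAff.convex_pos {L : Plane → ℝ} (h : IsAff L) : Convex ℝ {x | 0 < L x} := by
  intro x hx y hy s t hs ht hst
  rw [mem_ofPred_eq, h x y s t hst]
  exact (convex_Ioi (0 : ℝ)) hx hy hs ht hst

lemma IsAff.convex_nonneg {L : Plane → ℝ} (h : IsAff L) : Convex ℝ {x | 0 ≤ L x} := by
  intro x hx y hy s t hs ht hst
  rw [mem_ofPred_eq, h x y s t hst]
  exact (convex_Ici (0 : ℝ)) hx hy hs ht hst

lemma IsAff.add {L L' : Plane → ℝ} (h : IsAff L) (h' : IsAff L') : IsAff fun x => L x + L' x := by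
  intro x y s t hst
  simp only [h x y s t hst, h' x y s t hst]
  ring

lemma isAff_cross (c κ : ℝ) (e ν : Plane) : IsAff fun x => c + κ * cross (x - e) ν := by
  intro x y s t hst
  simp only [cross_sub_left, cross_add_left, cross_smul_left]
  rw [show t = 1 - s by linarith]
  ring

/-- Behind a vertex that touches the line of sight. -/
lemma tameNear_of_end_tang (hP : IsSimple poly) (hK : Even K) (hkK : k = K ∨ k = K + 1)
    {p z : Plane} (hp : p ∈ inside poly) (hpz : p ≠ z) (S : Finset Plane)
    (hcard : S.card ≤ K) (hS : ∀ y ∈ S, y ∈ openSeg p z ∧ Trans (poly.boundary ℝ) y (z - p))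
    (hT : ∀ y ∈ poly.boundary ℝ, y ∈ openSeg p z → y ∈ S)
    (h : Tang (poly.boundary ℝ) z (z - p)) : TameNear (unseen poly k) p z := by
  -- The arms are named so that `α` is the farther one.
  obtain ⟨α, β, harms, hpos, hD⟩ : ∃ α β, Arms (poly.boundary ℝ) z α β ∧
      0 < cross (z - p) α * cross (z - p) β ∧ 0 < cross (z - p) α * cross α β := by
    obtain ⟨α, β, harms, hpos, hne⟩ := h
    have hα := left_ne_zero_of_mul hpos.ne'
    rcases lt_or_gt_of_ne (mul_ne_zero hα hne) with h | h
    · refine ⟨β, α, harms.symm, by rwa [mul_comm], ?_⟩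
      rw [cross_swap β α]
      have : 0 < (cross (z - p) β * -cross α β) * (cross (z - p) α * cross (z - p) α) := by
        nlinarith [mul_pos hpos (neg_pos.2 h)]
      exact pos_of_mul_pos_left this (mul_self_nonneg _)
    · exact ⟨α, β, harms, hpos, h⟩
  have hα := left_ne_zero_of_mul hpos.ne'
  have hβ := right_ne_zero_of_mul hpos.ne'
  obtain ⟨r, h1, h2⟩ := ((eventually_count_end hp.1 hpz S hS hT).and
    (harms.eventually_end_tang hpos hD)).exists
  set κ := cross (z - p) α with hκ
  have hloc := (h1.and h2).and (eventually_inside_and_ne hP hp hpz)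
  rcases hcard.lt_or_eq with hcard | hcard
  -- Two extra crossings occur only where all crossings are transversal; parity then makes `S.card`
  -- even, so `S.card + 2 ≤ K`. With at most one extra crossing the bound is immediate.
  · refine tameNear_of_notMem ?_
    filter_upwards [hloc] with w ⟨⟨⟨h1, h2⟩, h3, h4, h5, h6⟩, h7, h8⟩
    rw [mem_unseen_iff h8]
    rintro ⟨hreg, hlt⟩
    rw [h1] at hlt
    have hle : ∀ m : ℕ, (poly.boundary ℝ ∩ openSeg w.1 w.2 ∩ Metric.ball z r).encard = m →
        k < S.card + m := by
      intro m hm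
      rw [hm] at hlt
      exact_mod_cast hlt
    by_cases hc : κ * cross (w.2 - w.1) (z - w.1) ≤ 0 ∧ 0 ≤ κ * cross (w.2 - z) α ∧
          0 < κ * cross (w.2 - z) α - κ * cross (w.2 - w.1) (z - w.1)
    · rcases hc.2.1.eq_or_lt with h9 | h9
      · have := hle 1 (h5 (by linarith [hc.2.2]) ((mul_eq_zero.1 h9.symm).resolve_left hα)).1
        omega
      rcases hc.1.lt_or_eq with h10 | h10
      · obtain ⟨h11, h12, h13⟩ := h3 h10 h9
        have hlt := hle 2 h11
        have := even_of_trans hP h7 (hreg.resolve_left h12) h8 (N := S.card + 2) (fun y hy => by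
          by_cases hyb : y ∈ Metric.ball z r
          · exact h13 y ⟨hy, hyb⟩
          · exact h2 y hy hyb) (by rw [h1, h11]; push_cast; rfl)
        obtain ⟨a, ha⟩ := this
        obtain ⟨b, hb⟩ := hK
        omega
      · have := hle 1 (by rw [(h4 ((mul_eq_zero.1 h10).resolve_left hα) h9).1]; simp)
        omega
    · rcases h6 hc with h9 | h9
      · have := hle 0 (by rw [h9]; simp)
        omega
      · have := hle 1 (by rw [h9.1]; simp)
        omega
  -- the shadow behind `z` is a wedge
  set o : Plane → Plane → ℝ := fun p' q => 0 + (-κ) * cross (q - p') (z - p') with ho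
  set a : Plane → ℝ := fun q => 0 + κ * cross (q - z) α with ha
  have hoA : ∀ p', IsAff (o p') := fun p' => isAff_cross _ _ _ _
  have haA : IsAff a := isAff_cross _ _ _ _
  have ho' : ∀ p' q, κ * cross (q - p') (z - p') = -o p' q := by intro p' q; simp only [ho]; ring
  have ha' : ∀ q, κ * cross (q - z) α = a q := by intro q; simp only [ha]; ring
  have ho0 : ∀ p' q, cross (q - p') (z - p') = 0 ↔ o p' q = 0 := by intro p' q; simp [ho, hα]
  have ha0 : ∀ q, cross (q - z) α = 0 ↔ a q = 0 := by intro q; simp [ha, hα]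
  simp only [ho', ha', ho0, ha0, neg_neg_iff_pos, Left.neg_nonpos_iff, sub_neg_eq_add, hcard] at hloc
  have hoz : ∀ p' , o p' z = 0 := by intro p'; simp [ho]
  have haz : a z = 0 := by simp [ha]
  have hO : IsOpen {w : Plane × Plane | 0 < o w.1 w.2 ∧ 0 < a w.2} := by
    refine (isOpen_lt (f := fun _ => (0 : ℝ)) (g := fun w : Plane × Plane => o w.1 w.2) continuous_const
      ?_).inter (isOpen_lt (f := fun _ => (0 : ℝ)) (g := fun w : Plane × Plane => a w.2) continuous_const ?_)
    · simp only [ho]; fun_prop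
    · simp only [ha]; fun_prop
  -- A direction into the open wedge: the subtracted multiple of `β` makes `a` positive and is half
  -- of the one at which `o` would vanish.
  have hv : ∀ᶠ ε in 𝓝[>] (0 : ℝ), (p, z + ε • (α - (κ / (2 * cross (z - p) β)) • β)) ∈
      {w : Plane × Plane | 0 < o w.1 w.2 ∧ 0 < a w.2} := by
    filter_upwards [self_mem_nhdsWithin] with ε hε
    have hε : 0 < ε := hε
    constructor
    · have : o p (z + ε • (α - (κ / (2 * cross (z - p) β)) • β)) = ε * (κ * κ) / 2 := by
        simp only [ho]
        rw [show z + ε • (α - (κ / (2 * cross (z - p) β)) • β) - p =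
          (z - p) + ε • (α - (κ / (2 * cross (z - p) β)) • β) by abel]
        simp only [cross_add_left, cross_smul_left, cross_sub_left α, cross_self]
        rw [cross_swap α, cross_swap β, ← hκ]
        field_simp
        ring
      show 0 < o p _
      rw [this]
      have := mul_self_pos.2 hα
      positivity
    · have : a (z + ε • (α - (κ / (2 * cross (z - p) β)) • β)) =
          ε * (κ * cross α β) * (κ * cross (z - p) β) / (2 * (cross (z - p) β * cross (z - p) β)) := by
        simp only [ha, add_sub_cancel_left, cross_smul_left, cross_sub_left α, cross_self]
        rw [cross_swap β]
        field_simp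
        ring
      show 0 < a _
      rw [this]
      have := mul_self_pos.2 hβ
      positivity
  rcases hkK with rfl | rfl
  -- For `k = K` one extra crossing already hides a point of the polygon, so both edges of the wedge
  -- belong to the shadow; the apex `z` is seen.
  · refine tameNear_of_convex (W := fun p' => {q | 0 ≤ o p' q} ∩ ({q | 0 ≤ a q} ∩ {q | 0 < a q + o p' q}))
      (fun p' => (hoA p').convex_nonneg.inter (haA.convex_nonneg.inter (haA.add (hoA p')).convex_pos))
      ?_ hO ?_ hv (v' := 0) ?_
    · filter_upwards [hloc] with w ⟨⟨⟨h1, h2⟩, h3, h4, h5, h6⟩, h7, h8⟩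
      rw [mem_unseen_iff h8, h1]
      constructor
      · rintro ⟨hreg, hlt⟩
        by_contra hc
        rcases h6 hc with h9 | ⟨h9, h10, h11⟩
        · rw [h9] at hlt
          simp at hlt
        · rw [h9] at h1
          have := even_of_trans hP h7 (hreg.resolve_left h10) h8 (N := k + 1) (fun y hy => by
            by_cases hyb : y ∈ Metric.ball z r
            · exact h11 y ⟨hy, hyb⟩
            · exact h2 y hy hyb) (by rw [h1]; push_cast; rfl)
          exact (Nat.not_even_iff_odd.2 hK.add_one) this
      · rintro ⟨h9, h10, h11⟩
        have h9 : 0 ≤ o w.1 w.2 := h9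
        have h10 : 0 ≤ a w.2 := h10
        have h11 : 0 < a w.2 + o w.1 w.2 := h11
        rcases h10.eq_or_lt with h12 | h12
        · obtain ⟨h13, h14⟩ := h5 (by linarith) h12.symm
          refine ⟨Or.inl h14, ?_⟩
          rw [h13]
          exact_mod_cast Nat.lt_succ_self k
        rcases h9.eq_or_lt with h13 | h13
        · obtain ⟨h14, h15, h16⟩ := h4 h13.symm h12
          rw [h14, encard_singleton] at h1 ⊢
          refine ⟨Or.inr ?_, by exact_mod_cast Nat.lt_succ_self k⟩
          have hz : z ∈ poly.boundary ℝ ∩ openSeg w.1 w.2 ∩ Metric.ball z r := by rw [h14]; rfl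
          refine (inside_iff_even hP h7 h15 h8 {z} ?_ (by simp) ?_ (N := k) (by simpa using h1)).2 hK
          · simpa using ⟨hz.1.2, h16⟩
          · intro y hy hyz
            refine h2 y hy fun hyb => hyz ?_
            have : y ∈ poly.boundary ℝ ∩ openSeg w.1 w.2 ∩ Metric.ball z r := ⟨hy, hyb⟩
            rw [h14] at this
            simpa using this
        · obtain ⟨h14, h15, h16⟩ := h3 h13 h12
          rw [h14] at h1 ⊢
          refine ⟨Or.inr ?_, by exact_mod_cast (by omega : k < k + 2)⟩
          refine (inside_iff_even hP h7 h15 h8 ∅ (by simp) (by simp) (fun y hy _ => ?_) (N := k + 2)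
            (by rw [h1]; simp)).2 (hK.add even_two)
          by_cases hyb : y ∈ Metric.ball z r
          · exact h16 y ⟨hy, hyb⟩
          · exact h2 y hy hyb
    · rintro w ⟨h1, h2⟩
      exact ⟨h1.le, h2.le, add_pos h2 h1⟩
    · refine Eventually.of_forall fun ε h => ?_
      rw [smul_zero, add_zero] at h
      have : 0 < a z + o p z := h.2.2
      rw [hoz, haz] at this
      simp at this
  -- For `k = K + 1` two extra crossings are needed, which leaves the open wedge.
  · refine tameNear_of_convex (W := fun p' => {q | 0 < o p' q} ∩ {q | 0 < a q})
      (fun p' => (hoA p').convex_pos.inter haA.convex_pos) ?_ hO (fun w hw => hw) hv (v' := 0) ?_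
    · filter_upwards [hloc] with w ⟨⟨⟨h1, h2⟩, h3, h4, h5, h6⟩, h7, h8⟩
      rw [mem_unseen_iff h8, h1]
      constructor
      · rintro ⟨hreg, hlt⟩
        have hle : ∀ m : ℕ, (poly.boundary ℝ ∩ openSeg w.1 w.2 ∩ Metric.ball z r).encard = m → 1 < m := by
          intro m hm
          rw [hm] at hlt
          have : K + 1 < K + m := by exact_mod_cast hlt
          omega
        by_cases hc : 0 ≤ o w.1 w.2 ∧ 0 ≤ a w.2 ∧ 0 < a w.2 + o w.1 w.2
        · obtain ⟨h9, h10, h11⟩ := hc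
          rcases h10.eq_or_lt with h12 | h12
          · exact absurd (hle 1 (h5 (by linarith) h12.symm).1) (lt_irrefl 1)
          rcases h9.eq_or_lt with h13 | h13
          · exact absurd (hle 1 (by rw [(h4 h13.symm h12).1]; simp)) (lt_irrefl 1)
          · exact ⟨h13, h12⟩
        · rcases h6 hc with h9 | h9
          · exact absurd (hle 0 (by rw [h9]; simp)) (by norm_num)
          · exact absurd (hle 1 (by rw [h9.1]; simp)) (lt_irrefl 1)
      · rintro ⟨h9, h10⟩
        obtain ⟨h14, h15, h16⟩ := h3 h9 h10
        rw [h14] at h1 ⊢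
        refine ⟨Or.inr ?_, by exact_mod_cast (by omega : K + 1 < K + 2)⟩
        refine (inside_iff_even hP h7 h15 h8 ∅ (by simp) (by simp) (fun y hy _ => ?_) (N := K + 2)
          (by rw [h1]; simp)).2 (hK.add even_two)
        by_cases hyb : y ∈ Metric.ball z r
        · exact h16 y ⟨hy, hyb⟩
        · exact h2 y hy hyb
    · refine Eventually.of_forall fun ε h => ?_
      rw [smul_zero, add_zero] at h
      have : 0 < a z := h.2
      rw [haz] at this
      exact lt_irrefl _ this

end Local

/-! ### Tameness behind a tangency -/

section BehindTangency

variable {n : ℕ} {poly : Polygon Plane n} {k K : ℕ}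

/-- The crossings of a segment close to one that touches the boundary at `y`. -/
lemma eventually_count_tang (hP : IsSimple poly) {p z y ν : Plane} {c : ℝ} (hp : p ∈ inside poly)
    (hpz : p ≠ z) (S : Finset Plane)
    (hS : ∀ y ∈ S, y ∈ openSeg p z ∧ Trans (poly.boundary ℝ) y (z - p))
    (hy : y ∈ openSeg p z) (hyT : Tang (poly.boundary ℝ) y (z - p)) (hyS : y ∉ S)
    (hT : ∀ x ∈ poly.boundary ℝ, x ∈ openSeg p z → x ∈ S ∨ x = y)
    (hz : z ∉ poly.boundary ℝ ∨ Trans (poly.boundary ℝ) z (z - p))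
    (hν : ∀ᶠ x in 𝓝 z, (x ∈ inside poly ↔ 0 < c + cross (x - z) ν) ∧
      (x ∈ poly.boundary ℝ ↔ c + cross (x - z) ν = 0)) : ∃ κ : ℝ, κ ≠ 0 ∧
    ∀ᶠ w : Plane × Plane in 𝓝 (p, z), ∃ s h : ℕ,
      (κ * cross (w.2 - w.1) (y - w.1) < 0 → s = 0) ∧
      (cross (w.2 - w.1) (y - w.1) = 0 → s = 1) ∧
      (0 < κ * cross (w.2 - w.1) (y - w.1) → s = 2) ∧
      (c + cross (w.2 - z) ν = 0 → h = 0) ∧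
      (0 < c + cross (w.2 - z) ν → h ≤ 1 ∧ Even (S.card + h)) ∧
      (w.2 ∈ unseen poly k w.1 ↔ 0 ≤ c + cross (w.2 - z) ν ∧ k < S.card + (s + h)) := by
  obtain ⟨κ, hκ, hev⟩ := hyT.eventually_hit hy
  -- The sign is reversed so that the positive side is the one with two crossings near `y`.
  refine ⟨-κ, neg_ne_zero.2 hκ, ?_⟩
  obtain ⟨r, ⟨h1, h2⟩, h3⟩ := ((eventually_count_end_tang hp.1 hpz S hS hy hyS hT).and
    (eventually_end_of_trans hpz hz) |>.and hev).exists
  filter_upwards [h1, h2, h3, continuous_snd.continuousAt.eventually hν,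
    eventually_inside_and_ne hP hp hpz] with w ⟨h1, h1'⟩ ⟨h2, h2', h2''⟩ ⟨h3, h4, h5⟩ ⟨h6, h7⟩ ⟨h8, h9⟩
  have hy0 : ∃ s : ℕ, (poly.boundary ℝ ∩ openSeg w.1 w.2 ∩ Metric.ball y r).encard = s ∧
      (-κ * cross (w.2 - w.1) (y - w.1) < 0 → s = 0) ∧
      (cross (w.2 - w.1) (y - w.1) = 0 → s = 1) ∧
      (0 < -κ * cross (w.2 - w.1) (y - w.1) → s = 2) := by
    rw [neg_mul, neg_pos, neg_lt_zero]
    rcases lt_trichotomy (κ * cross (w.2 - w.1) (y - w.1)) 0 with h | h | h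
    · refine ⟨2, (h5 h).1, fun h' => absurd h h'.not_gt, fun h' => ?_, fun _ => rfl⟩
      rw [h', mul_zero] at h
      exact absurd h (lt_irrefl 0)
    · refine ⟨1, ?_, fun h' => absurd h h'.ne', fun _ => rfl, fun h' => absurd h h'.ne⟩
      rw [(h4 ((mul_eq_zero.1 h).resolve_left hκ)).1]
      simp
    · refine ⟨0, by rw [h3 h]; simp, fun _ => rfl, fun h' => ?_, fun h' => absurd h h'.not_gt⟩
      rw [h', mul_zero] at h
      exact absurd h (lt_irrefl 0)
  obtain ⟨s, hs, hs0, hs1, hs2⟩ := hy0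
  obtain ⟨h, hh⟩ := ENat.ne_top_iff_exists.1 (ne_top_of_le_ne_top (ENat.natCast_ne_top 1) h2)
  rw [hs, ← hh] at h1
  refine ⟨s, h, hs0, hs1, hs2, fun hb => ?_, fun hin => ⟨?_, ?_⟩, ?_⟩
  · rw [h2'' (h7.2 hb), encard_empty] at hh
    exact_mod_cast hh
  · rw [← hh] at h2
    exact_mod_cast h2
  -- The crossings near `y` are none, two transversal ones or a tangency, so they do not affect
  -- parity: the remaining `S.card + h` crossings are even in number.
  · have hin := h6.2 hin
    have htr : ∀ x ∈ poly.boundary ℝ ∩ openSeg w.1 w.2, x ∉ Metric.ball y r →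
        Trans (poly.boundary ℝ) x (w.2 - w.1) := by
      intro x hx hxy
      by_cases hxz : x ∈ Metric.ball z r
      · exact h2' x ⟨hx, hxz⟩
      · exact h1' x hx hxy hxz
    rcases lt_trichotomy (κ * cross (w.2 - w.1) (y - w.1)) 0 with ho | ho | ho
    · have := even_of_trans hP h8 hin h9 (N := S.card + (s + h)) (fun x hx => by
        by_cases hxy : x ∈ Metric.ball y r
        · exact (h5 ho).2 x ⟨hx, hxy⟩
        · exact htr x hx hxy) (by rw [h1]; push_cast; rfl)
      rw [hs2 (by rw [neg_mul]; linarith)] at this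
      rw [show S.card + (2 + h) = S.card + h + 2 by ring] at this
      exact (Nat.even_add.1 this).2 even_two
    · have ho := (mul_eq_zero.1 ho).resolve_left hκ
      obtain ⟨h10, h11⟩ := h4 ho
      have hyb : y ∈ poly.boundary ℝ ∩ openSeg w.1 w.2 ∩ Metric.ball y r := by rw [h10]; rfl
      refine (inside_iff_even hP h8 hin.1 h9 {y} ?_ (by simp) ?_ (N := S.card + h) ?_).1 hin
      · simpa using ⟨hyb.1.2, h11⟩
      · intro x hx hxy
        refine htr x hx fun hxb => hxy ?_
        have : x ∈ poly.boundary ℝ ∩ openSeg w.1 w.2 ∩ Metric.ball y r := ⟨hx, hxb⟩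
        rw [h10] at this
        simpa using this
      · rw [h1, hs1 ho]
        push_cast
        simp only [Finset.card_singleton, Nat.cast_one]
        ring
    · have := even_of_trans hP h8 hin h9 (N := S.card + (s + h)) (fun x hx => by
        refine htr x hx fun hxy => ?_
        have : x ∈ poly.boundary ℝ ∩ openSeg w.1 w.2 ∩ Metric.ball y r := ⟨hx, hxy⟩
        rw [h3 ho] at this
        exact this) (by rw [h1]; push_cast; rfl)
      rwa [hs0 (by rw [neg_mul]; linarith), zero_add] at this
  · rw [mem_unseen_iff h9, h1, region, mem_union, h6, h7, le_iff_eq_or_lt, eq_comm (a := (0 : ℝ))]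
    refine and_congr_right fun _ => ?_
    constructor
    · intro h
      exact_mod_cast h
    · intro h
      exact_mod_cast h

/-- Behind a vertex that touches the line of sight in its relative interior. -/
lemma tameNear_of_tang (hP : IsSimple poly) (hK : Even K) (hkK : k = K ∨ k = K + 1)
    {p z y : Plane} (hp : p ∈ inside poly) (hz : z ∈ region poly) (hpz : p ≠ z) (S : Finset Plane)
    (hcard : S.card ≤ K) (hS : ∀ y ∈ S, y ∈ openSeg p z ∧ Trans (poly.boundary ℝ) y (z - p))
    (hy : y ∈ openSeg p z) (hyT : Tang (poly.boundary ℝ) y (z - p)) (hyS : y ∉ S)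
    (hT : ∀ x ∈ poly.boundary ℝ, x ∈ openSeg p z → x ∈ S ∨ x = y) (hzv : ¬ ∃ i, z = poly i) :
    TameNear (unseen poly k) p z := by
  classical
  have hfin : (poly.boundary ℝ ∩ openSeg p z).Finite := by
    refine (insert y S).finite_toSet.subset ?_
    rintro x ⟨h1, h2⟩
    rcases hT x h1 h2 with h | h <;> simp [h]
  obtain ⟨hzT, ν, c, hνc, hν⟩ := exists_halfPlane hP hz hpz hzv hfin
  obtain ⟨κ, hκ, hloc⟩ := eventually_count_tang (k := k) hP hp hpz S hS hy hyT hyS hT hzT hν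
  set L : Plane → Plane → ℝ := fun p' q => 0 + κ * cross (q - p') (y - p') with hL
  set g : Plane → ℝ := fun q => c + 1 * cross (q - z) ν with hg
  have hLA : ∀ p', IsAff (L p') := fun p' => isAff_cross _ _ _ _
  have hgA : IsAff g := isAff_cross _ _ _ _
  have hL1 : ∀ p' q, κ * cross (q - p') (y - p') = L p' q := by intro p' q; simp [hL]
  have hL0 : ∀ p' q, cross (q - p') (y - p') = 0 ↔ L p' q = 0 := by intro p' q; simp [hL, hκ]
  have hg1 : ∀ q, c + cross (q - z) ν = g q := by intro q; simp [hg]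
  simp only [hL1, hL0, hg1] at hloc
  have hd : z - p ≠ 0 := sub_ne_zero.2 hpz.symm
  obtain ⟨m, hm⟩ := exists_cross_pos hd
  obtain ⟨t, ht0, ht1, ht⟩ := hy
  have hLp : ∀ v ε, L p (z + ε • v) = (ε * t) * (κ * cross v (z - p)) := by
    intro v ε
    simp only [hL]
    rw [ht, add_sub_cancel_left, show z + ε • v - p = (z - p) + ε • v by abel]
    simp only [cross_add_left, cross_smul_left, cross_smul_right, cross_self]
    ring
  have hgp : ∀ v ε, g (z + ε • v) = c + ε * cross v ν := by
    intro v ε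
    simp only [hg, add_sub_cancel_left, cross_smul_left]
    ring
  obtain ⟨v, hv⟩ : ∃ v : Plane, ∀ᶠ ε in 𝓝[>] (0 : ℝ), (p, z + ε • v) ∈
      {w : Plane × Plane | 0 < L w.1 w.2 ∧ 0 < g w.2} := by
    rcases hνc with ⟨rfl, rfl⟩ | ⟨rfl, hne⟩
    · refine ⟨(-κ) • m, ?_⟩
      filter_upwards [self_mem_nhdsWithin] with ε hε
      have hε : 0 < ε := hε
      refine ⟨?_, ?_⟩
      · show 0 < L p _
        rw [hLp, cross_smul_left, cross_swap m]
        have : 0 < (ε * t) * ((κ * κ) * cross (z - p) m) := by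
          have := mul_self_pos.2 hκ
          positivity
        linarith
      · show 0 < g _
        rw [hgp]
        simp
    -- The component along `ν` controls `L` and the one along `z - p` controls `g`, so both can be
    -- made positive.
    · refine ⟨(-(κ * cross (z - p) ν)) • ν + (cross (z - p) ν) • (z - p), ?_⟩
      filter_upwards [self_mem_nhdsWithin] with ε hε
      have hε : 0 < ε := hε
      have h2 := mul_self_pos.2 hne
      refine ⟨?_, ?_⟩
      · show 0 < L p _
        rw [hLp, cross_add_left, cross_smul_left, cross_smul_left, cross_self, cross_swap ν]
        have : 0 < (ε * t) * ((κ * κ) * (cross (z - p) ν * cross (z - p) ν)) := by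
          have := mul_self_pos.2 hκ
          positivity
        linarith
      · show 0 < g _
        rw [hgp, cross_add_left, cross_smul_left, cross_smul_left, cross_self]
        have := mul_pos hε h2
        linarith
  -- On the other side of the line through `p` and `y` the tangency is not met, so `z` is not
  -- interior to the shadow.
  have hv' : ∀ᶠ ε in 𝓝[>] (0 : ℝ), L p (z + ε • (κ • m)) < 0 := by
    filter_upwards [self_mem_nhdsWithin] with ε hε
    have hε : 0 < ε := hε
    rw [hLp, cross_smul_left, cross_swap m]
    have : 0 < (ε * t) * ((κ * κ) * cross (z - p) m) := by
      have := mul_self_pos.2 hκ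
      positivity
    linarith
  have hO : IsOpen {w : Plane × Plane | 0 < L w.1 w.2 ∧ 0 < g w.2} := by
    refine (isOpen_lt (f := fun _ => (0 : ℝ)) (g := fun w : Plane × Plane => L w.1 w.2) continuous_const
      ?_).inter (isOpen_lt (f := fun _ => (0 : ℝ)) (g := fun w : Plane × Plane => g w.2) continuous_const ?_)
    · simp only [hL]; fun_prop
    · simp only [hg]; fun_prop
  have hfinish : ∀ W : Plane → Set Plane, (∀ p', Convex ℝ (W p')) →
      (∀ᶠ w : Plane × Plane in 𝓝 (p, z), (w.2 ∈ unseen poly k w.1 ↔ w.2 ∈ W w.1)) →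
      (∀ p' q, 0 < L p' q → 0 < g q → q ∈ W p') → (∀ p' q, q ∈ W p' → 0 ≤ L p' q) →
      TameNear (unseen poly k) p z := fun W h1 h2 h3 h4 =>
    tameNear_of_convex h1 h2 hO (fun w hw => h3 _ _ hw.1 hw.2) hv
      (hv'.mono fun ε h h' => (h4 _ _ h').not_gt h)
  obtain ⟨b, hb⟩ := hK
  -- For enclosed points `S.card + h` is even with `h ≤ 1`. If `S.card + 2 ≤ K`, even two crossings
  -- near `y` leave at most `K`. If `S.card + 1 = K`, then `h = 1` at enclosed points and `h = 0` on
  -- the boundary; if `S.card = K`, then `h = 0` at both. The shadow is the part with `s ≥ 1` or `s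
  -- = 2`, according to `h` and `k`, which decides which edges belong to it.
  have hcase : S.card + 2 ≤ K ∨ S.card + 1 = K ∨ S.card = K := by omega
  rcases hcase with hc | hc | hc
  · refine tameNear_of_notMem ?_
    filter_upwards [hloc] with w ⟨s, h, h1, h2, h3, h4, h5, h6⟩
    rw [h6]
    rintro ⟨h7, h8⟩
    have hs : s ≤ 2 := by
      rcases lt_trichotomy (L w.1 w.2) 0 with h | h | h
      · rw [h1 h]; omega
      · rw [h2 h]; omega
      · rw [h3 h]
    rcases h7.eq_or_lt with h7 | h7
    · have := h4 h7.symm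
      omega
    · obtain ⟨h9, a, ha⟩ := h5 h7
      omega
  · rcases hkK with hk | hk
    · refine hfinish (fun p' => {q | 0 ≤ L p' q} ∩ ({q | 0 ≤ g q} ∩ {q | 0 < g q + L p' q}))
        (fun p' => (hLA p').convex_nonneg.inter (hgA.convex_nonneg.inter (hgA.add (hLA p')).convex_pos))
        ?_ (fun p' q h1 h2 => ⟨h1.le, h2.le, add_pos h2 h1⟩) (fun p' q h => h.1)
      filter_upwards [hloc] with w ⟨s, h, h1, h2, h3, h4, h5, h6⟩
      rw [h6]
      constructor
      · rintro ⟨h7, h8⟩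
        rcases h7.eq_or_lt with h7' | h7'
        · have := h4 h7'.symm
          have hpos : 0 < L w.1 w.2 := by
            by_contra! hle
            rcases hle.lt_or_eq with h | h
            · have := h1 h; omega
            · have := h2 h; omega
          exact ⟨hpos.le, h7, add_pos_of_nonneg_of_pos h7 hpos⟩
        · obtain ⟨h9, a, ha⟩ := h5 h7'
          have hpos : 0 ≤ L w.1 w.2 := by
            by_contra! hlt
            have := h1 hlt
            omega
          exact ⟨hpos, h7, add_pos_of_pos_of_nonneg h7' hpos⟩
      · rintro ⟨h7, h8, h9⟩
        have h7 : 0 ≤ L w.1 w.2 := h7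
        have h8 : 0 ≤ g w.2 := h8
        have h9 : 0 < g w.2 + L w.1 w.2 := h9
        refine ⟨h8, ?_⟩
        rcases h8.eq_or_lt with h10 | h10
        · have := h3 (by linarith)
          omega
        · obtain ⟨h11, a, ha⟩ := h5 h10
          rcases h7.eq_or_lt with h12 | h12
          · have := h2 h12.symm
            omega
          · have := h3 h12
            omega
    · refine hfinish (fun p' => {q | 0 < L p' q} ∩ {q | 0 < g q})
        (fun p' => (hLA p').convex_pos.inter hgA.convex_pos) ?_ (fun p' q h1 h2 => ⟨h1, h2⟩)
        (fun p' q h => le_of_lt h.1)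
      filter_upwards [hloc] with w ⟨s, h, h1, h2, h3, h4, h5, h6⟩
      rw [h6]
      constructor
      · rintro ⟨h7, h8⟩
        have hpos : 0 < g w.2 → 0 < L w.1 w.2 := by
          intro h7
          obtain ⟨h9, a, ha⟩ := h5 h7
          by_contra! hle
          rcases hle.lt_or_eq with h | h
          · have := h1 h; omega
          · have := h2 h; omega
        rcases h7.eq_or_lt with h7' | h7'
        · have := h4 h7'.symm
          rcases lt_trichotomy (L w.1 w.2) 0 with h | h | h
          · have := h1 h; omega
          · have := h2 h; omega
          · have := h3 h; omega
        · exact ⟨hpos h7', h7'⟩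
      · rintro ⟨h7, h8⟩
        have h8 : 0 < g w.2 := h8
        refine ⟨h8.le, ?_⟩
        obtain ⟨h9, a, ha⟩ := h5 h8
        have := h3 h7
        omega
  · have hh : ∀ w : Plane × Plane, ∀ h : ℕ, 0 ≤ g w.2 → (g w.2 = 0 → h = 0) →
        (0 < g w.2 → h ≤ 1 ∧ Even (S.card + h)) → h = 0 := by
      intro w h h7 h4 h5
      rcases h7.eq_or_lt with h7' | h7'
      · exact h4 h7'.symm
      · obtain ⟨h9, a, ha⟩ := h5 h7'
        omega
    rcases hkK with hk | hk
    · refine hfinish (fun p' => {q | 0 ≤ L p' q} ∩ {q | 0 ≤ g q})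
        (fun p' => (hLA p').convex_nonneg.inter hgA.convex_nonneg) ?_
        (fun p' q h1 h2 => ⟨h1.le, h2.le⟩) (fun p' q h => h.1)
      filter_upwards [hloc] with w ⟨s, h, h1, h2, h3, h4, h5, h6⟩
      rw [h6]
      constructor
      · rintro ⟨h7, h8⟩
        refine ⟨?_, h7⟩
        show 0 ≤ L w.1 w.2
        by_contra! hlt
        have := h1 hlt
        have := hh w h h7 h4 h5
        omega
      · rintro ⟨h7, h8⟩
        refine ⟨h8, ?_⟩
        rcases le_iff_eq_or_lt.1 (show 0 ≤ L w.1 w.2 from h7) with h12 | h12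
        · have := h2 h12.symm
          omega
        · have := h3 h12
          omega
    · refine hfinish (fun p' => {q | 0 < L p' q} ∩ {q | 0 ≤ g q})
        (fun p' => (hLA p').convex_pos.inter hgA.convex_nonneg) ?_
        (fun p' q h1 h2 => ⟨h1, h2.le⟩) (fun p' q h => le_of_lt h.1)
      filter_upwards [hloc] with w ⟨s, h, h1, h2, h3, h4, h5, h6⟩
      rw [h6]
      constructor
      · rintro ⟨h7, h8⟩
        refine ⟨?_, h7⟩
        show 0 < L w.1 w.2
        have := hh w h h7 h4 h5
        by_contra! hle
        rcases hle.lt_or_eq with h | h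
        · have := h1 h; omega
        · have := h2 h; omega
      · rintro ⟨h7, h8⟩
        refine ⟨h8, ?_⟩
        have := h3 h7
        omega

end BehindTangency

/-! ### The decomposition is complete -/

section Complete

variable {n : ℕ} {poly : Polygon Plane n}

lemma trans_or_tang_end (hP : IsSimple poly) {p z : Plane} (hz : z ∈ region poly) (hpz : p ≠ z)
    (hfin : (poly.boundary ℝ ∩ openSeg p z).Finite)
    (hv : (∃ i, z = poly i) → Trans (poly.boundary ℝ) z (z - p) ∨ Tang (poly.boundary ℝ) z (z - p)) :
    (z ∉ poly.boundary ℝ ∨ Trans (poly.boundary ℝ) z (z - p)) ∨ Tang (poly.boundary ℝ) z (z - p) := by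
  by_cases hzv : ∃ i, z = poly i
  · exact (hv hzv).imp_left Or.inr
  · exact Or.inl (exists_halfPlane hP hz hpz hzv hfin).1

/-- Off the partition lines, the unseen part of the polygon varies tamely with the point of view. -/
lemma tameNear_unseen (hP : IsSimple poly) {k : ℕ} {p z : Plane} (hp : p ∈ region poly)
    (hpn : p ∉ partitionLines poly k) (hz : z ∈ region poly) : TameNear (unseen poly k) p z := by
  have hpin : p ∈ inside poly := hp.resolve_left fun h => hpn (boundary_subset_partitionLines hP k h)
  -- Only the even part `K` of `k` enters the case distinction on lines of sight, as crossing
  -- numbers of enclosed points are even.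
  obtain ⟨K, hK, hkK⟩ : ∃ K, Even K ∧ (k = K ∨ k = K + 1) := by
    rcases Nat.even_or_odd k with h | ⟨a, ha⟩
    · exact ⟨k, h, Or.inl rfl⟩
    · exact ⟨2 * a, even_two_mul a, Or.inr ha⟩
  have hKk : K ≤ k := by omega
  by_cases hpz : p = z
  · exact hpz ▸ tameNear_self hP hpin
  rcases crossings_cases hP hK hKk hpin hpn hpz with ⟨S, hcard, hS⟩ | ⟨S, hcard, hS, h⟩
  · exact tameNear_of_many hP hK hkK hpin hz hpz S hcard hS
  rcases h with ⟨hT, hv⟩ | ⟨y, hy, hyT, hyS, hT, hzv⟩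
  · have hfin : (poly.boundary ℝ ∩ openSeg p z).Finite :=
      S.finite_toSet.subset fun y hy => hT y hy.1 hy.2
    rcases trans_or_tang_end hP hz hpz hfin hv with h | h
    · exact tameNear_of_few hP hK hkK hpin hpz S hcard hS hT h
    · exact tameNear_of_end_tang hP hK hkK hpin hpz S hcard hS hT h
  · exact tameNear_of_tang hP hK hkK hpin hz hpz S hcard hS hy hyT hyS hT hzv

end Complete

end KModem

theorem theorem3 {n : ℕ} (poly : Polygon Plane n) (hP : KModem.IsSimple poly) (k : ℕ)
    (C : Set Plane) (hC : KModem.IsCell poly k C)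
    (a b : ℝ) (γ : ℝ → Plane) (hγ : ContinuousOn γ (Set.Icc a b))
    (hγC : ∀ t ∈ Set.Icc a b, γ t ∈ C)
    (s t : ℝ) (has : a ≤ s) (hst : s ≤ t) (htb : t ≤ b) :
    ¬ KModem.AppearEvent poly k γ s t ∧ ¬ KModem.DisappearEvent poly k γ s t ∧
      ¬ KModem.MergeEvent poly k γ s t ∧ ¬ KModem.SplitEvent poly k γ s t := by
  obtain ⟨x, hx, rfl⟩ := hC
  have hsub : Icc s t ⊆ Icc a b := Icc_subset_Icc has htb
  refine KModem.no_events_of_tame hst (KModem.isCompact_region hP) fun τ hτ z hz => ?_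
  have hτC := connectedComponentIn_subset _ _ (hγC τ (hsub hτ))
  exact (KModem.tameNear_unseen hP hτC.1 hτC.2 hz).comp ((hγ τ (hsub hτ)).mono hsub)
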